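/- **Setting.** Let $(\Omega,\mathcal F,\mathbb P,\{\mathcal F_t\}_{t\ge0})$ be a filtered probability space satisfying the usual hypotheses, $(\mathbf E,\mathcal E,m)$ a $\sigma$-finite measure space, and $N$ a Poisson random measure on $[0,\infty)\times\mathbf E$ with intensity $dt\otimes m(dz)$ relative to $\{\mathcal F_t\}$ (adapted, and with restriction to $(s,\infty)\times\mathbf E$ independent of $\mathcal F_s$ for every $s$); $\tilde N(dz,dt)=N(dz,dt)-m(dz)\,dt$, and stochastic integrals are the $L^2$ (Itô) integrals against $\tilde N$, taken in càdlàg versions. Let $d\ge1$, $T>0$, $\Pi_T=[0,T)\times\mathbb R^d$, and assume: * $f:\mathbb R\to\mathbb R$ is $C^2$, nondecreasing, Lipschitz with constant $c_f$, and $f(0)=0$; * $\vec v:[0,T]\times\mathbb R^d\to\mathbb R^d$ is $C^1$, with $\operatorname{div}_x\vec v=0$ and $|\vec v|\le V<\infty$ on $\Pi_T$; * $\eta:\mathbb R\times\mathbf E\to\mathbb R$ is measurable in $z$, and there are $\lambda^*\in(0,1)$, $C^*>0$ and $h_1\in L^2(\mathbf E,m)$ with $0\le h_1\le1$ such that $|\eta(u;z)-\eta(w;z)|\le\lambda^*|u-w|h_1(z)$,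 $|\eta(u;z)|\le C^*h_1(z)$ and $\eta(0;z)=0$ for all $u,w\in\mathbb R$, $z\in\mathbf E$; * $u_0$ is an $\mathcal F_0$-measurable $L^2(\mathbb R^d)$-valued random variable with $\mathbb E\|u_0\|_2^2<\infty$. **Mesh.** For $\alpha>0$, an admissible mesh $\mathcal T$ with constant $\alpha$ is a family of pairwise disjoint connected polygonal sets (bounded sets with nonempty interior, contained in the closure of their interior, with boundary contained in finitely many hyperplanes) whose closures cover $\mathbb R^d$, such that the common interface $K|L=\partial K\cap\partial L$ of any two distinct elements lies in a hyperplane, $h=\sup_{K\in\mathcal T}\operatorname{diam}K<\infty$, and $\alpha h^d\le|K|$, $|\partial K|\le\frac1\alpha h^{d-1}$ for all $K\in\mathcal T$ ($d$- and $(d-1)$-dimensional Lebesgue measures). Let $\mathcal E_K$ be the set of the interfaces $\sigma=K|L$ with $|\sigma|>0$, $L\in\mathcal T$, $L\neq K$, and let $n_{K,\sigma}$ be the unit normal to $\sigma$ outward to $K$. **Scheme.** Let $\Delta t=T/M$ with $M\in\mathbb N$, $M\ge1$, $t_n=n\Delta t$, and $$(\vec v\cdot n_{K,\sigma})^{\pm}=\frac1{\Delta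 t\,|\sigma|}\int_{t_n}^{t_{n+1}}\int_\sigma\big(\vec v(t,x)\cdot n_{K,\sigma}\big)^{\pm}\,d\nu(x)\,dt ,$$ where $\nu$ is the $(d-1)$-dimensional Lebesgue measure. The upwind unknowns are defined by $u_K^0=\frac1{|K|}\int_Ku_0\,dx$ and $$\frac{|K|}{\Delta t}(u_K^{n+1}-u_K^n)+\sum_{\sigma=K|L\in\mathcal E_K}|\sigma|\Big\{(\vec v\cdot n_{K,\sigma})^+f(u_K^n)-(\vec v\cdot n_{K,\sigma})^-f(u_L^n)\Big\}=\frac{|K|}{\Delta t}\int_{t_n}^{t_{n+1}}\int_{\mathbf E}\eta(u_K^n;z)\,\tilde N(dz,dt),$$ and for $s\in[t_n,t_{n+1}]$ $$v_K^n(s)=u_K^n+\int_{t_n}^s\sum_{\sigma=K|L\in\mathcal E_K}|\sigma|(\vec v\cdot n_{K,\sigma})^-\frac{f(u_L^n)-f(u_K^n)}{|K|}\,dt+\int_{t_n}^s\int_{\mathbf E}\eta(u_K^n;z)\,\tilde N(dz,dt).$$ Let $u^h(t,x)=u_K^n$ and $v^h(t,x)=v_K^n(t)$ for $x\in K$, $t\in[t_n,t_{n+1})$.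 **Proposition.** Let the data above, $\alpha>0$ and $\xi\in(0,1)$ be fixed. Then there are constants $C,C_1>0$, independent of $h$ and $\Delta t$ (and of the mesh), such that for every admissible mesh $\mathcal T$ with constant $\alpha$ and every time step $\Delta t=T/M$ satisfying the CFL condition $\Delta t\,c_fV\le(1-\xi)\alpha^2h$, one has $v^h-u^h\in L^2(\Omega\times\Pi_T)$ and $$\|v^h-u^h\|_{L^2(\Omega\times\Pi_T)}^2\le Ch+C_1\Delta t .$$ -/

import Mathlib

open MeasureTheory ProbabilityTheory Set Filter Topology
open scoped NNReal ENNReal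

noncomputable section

/-- The space `ℝ^d` with its Euclidean norm. -/
abbrev Sp (d : ℕ) : Type := EuclideanSpace ℝ (Fin d)

/-! ### Meshes -/

/-- A bounded set with nonempty interior, contained in the closure of its interior, whose boundary
lies in finitely many hyperplanes. -/
structure IsPolygonal {d : ℕ} (K : Set (Sp d)) : Prop where
  isBounded : Bornology.IsBounded K
  interior_nonempty : (interior K).Nonempty
  regular : K ⊆ closure (interior K)
  frontier_subset : ∃ H : Finset (Sp d × ℝ), (∀ p ∈ H, p.1 ≠ 0) ∧
    frontier K ⊆ ⋃ p ∈ H, {x | inner ℝ p.1 x = p.2}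

/-- The mesh size `h`, the supremum of the diameters of the control volumes. -/
def meshSize {d : ℕ} (𝒯 : Set (Set (Sp d))) : ℝ := sSup (Metric.diam '' 𝒯)

/-- The common interface `K|L` of two control volumes. -/
def interface {d : ℕ} (K L : Set (Sp d)) : Set (Sp d) := frontier K ∩ frontier L

/-- Admissible meshes of `ℝ^d` with regularity constant `α`. -/
structure IsAdmissibleMesh {d : ℕ} (𝒯 : Set (Set (Sp d))) (α : ℝ) : Prop where
  polygonal : ∀ K ∈ 𝒯, IsPolygonal K
  connected : ∀ K ∈ 𝒯, IsConnected K
  disjoint : 𝒯.PairwiseDisjoint id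
  covers : ⋃ K ∈ 𝒯, closure K = univ
  hyperplane : ∀ K ∈ 𝒯, ∀ L ∈ 𝒯, K ≠ L →
    ∃ (a : Sp d) (c : ℝ), a ≠ 0 ∧ interface K L ⊆ {x | inner ℝ a x = c}
  bddAbove_diam : BddAbove (Metric.diam '' 𝒯)
  volume_ge : ∀ K ∈ 𝒯, ENNReal.ofReal (α * meshSize 𝒯 ^ d) ≤ volume K
  frontier_le : ∀ K ∈ 𝒯,
    Measure.euclideanHausdorffMeasure (d - 1) (frontier K)
      ≤ ENNReal.ofReal (1 / α * meshSize 𝒯 ^ (d - 1))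

/-- The `(d-1)`-dimensional Lebesgue measure `|σ|`, as a real number. -/
def surfaceArea {d : ℕ} (σ : Set (Sp d)) : ℝ :=
  (Measure.euclideanHausdorffMeasure (d - 1) : Measure (Sp d)).real σ

/-- The neighbours `𝒩(K)`: the control volumes sharing with `K` an interface of positive area. -/
def neighbours {d : ℕ} (𝒯 : Set (Set (Sp d))) (K : Set (Sp d)) : Set (Set (Sp d)) :=
  {L | L ∈ 𝒯 ∧ L ≠ K ∧ 0 < surfaceArea (interface K L)}

/-- `n` is the outward unit normal to `K` at the boundary point `x`: near `x`, the set `K` is a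
half space with outward unit normal `n`, up to points of the bounding hyperplane. -/
def IsOutwardNormal {d : ℕ} (K : Set (Sp d)) (x n : Sp d) : Prop :=
  ‖n‖ = 1 ∧ ∃ r > 0, ∀ y ∈ Metric.ball x r,
    (inner ℝ n (y - x) < 0 → y ∈ K) ∧ (0 < inner ℝ n (y - x) → y ∉ K)

open Classical in
/-- The outward unit normal to `K` at `x`; it is `0` at the (negligible) points of an interface
where there is none. On an interface lying in a hyperplane it is a unit normal to that
hyperplane. -/
def outwardNormal {d : ℕ} (K : Set (Sp d)) (x : Sp d) : Sp d :=
  if h : ∃ n, IsOutwardNormal K x n then h.choose else 0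

/-- `(v · n_{K,σ})^+` on the time interval `[nΔt, (n+1)Δt]`, where `σ = K|L`: the mean of the
positive part of `v(t,x) · n_{K,σ}`. -/
def normalVelocityPos {d : ℕ} (v : ℝ → Sp d → Sp d) (Δt : ℝ) (n : ℕ) (K L : Set (Sp d)) : ℝ :=
  1 / (Δt * surfaceArea (interface K L)) *
    ∫ t in (n * Δt)..((n + 1) * Δt), ∫ x in interface K L,
      max (inner ℝ (v t x) (outwardNormal K x)) 0 ∂(Measure.euclideanHausdorffMeasure (d - 1))

/-- `(v · n_{K,σ})^-` on the time interval `[nΔt, (n+1)Δt]`, where `σ = K|L`: the mean of the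
negative part of `v(t,x) · n_{K,σ}`. -/
def normalVelocityNeg {d : ℕ} (v : ℝ → Sp d → Sp d) (Δt : ℝ) (n : ℕ) (K L : Set (Sp d)) : ℝ :=
  1 / (Δt * surfaceArea (interface K L)) *
    ∫ t in (n * Δt)..((n + 1) * Δt), ∫ x in interface K L,
      max (-inner ℝ (v t x) (outwardNormal K x)) 0 ∂(Measure.euclideanHausdorffMeasure (d - 1))

/-- The divergence of a vector field on `ℝ^d`. -/
def divergence {d : ℕ} (w : Sp d → Sp d) (x : Sp d) : ℝ :=
  ∑ i, fderiv ℝ w x (EuclideanSpace.single i 1) i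

/-! ### Poisson random measures and the stochastic integral -/

section Noise

variable {Ω E : Type*} {mΩ : MeasurableSpace Ω} [MeasurableSpace E]

/-- The intensity `dt ⊗ m(dz)` on `[0,∞) × E`. -/
def intensity (m : Measure E) : Measure (ℝ × E) := (volume.restrict (Ici 0)).prod m

/-- `N` is a Poisson random measure on `[0,∞) × E` with intensity `dt ⊗ m(dz)`, relative to the
filtration `ℱ`: it is adapted, and its restriction to `(s,∞) × E` is independent of `ℱ s`. -/
structure IsPoissonRandomMeasure (P : Measure Ω) (ℱ : Filtration ℝ≥0 mΩ) (m : Measure E)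
    (N : Ω → Measure (ℝ × E)) : Prop where
  measurable : ∀ B, MeasurableSet B → Measurable fun ω => N ω B
  law_of_lt_top : ∀ B, MeasurableSet B → intensity m B < ∞ →
    P.map (fun ω => N ω B)
      = (poissonMeasure (intensity m B).toNNReal).map (fun k : ℕ => (k : ℝ≥0∞))
  law_of_eq_top : ∀ B, MeasurableSet B → intensity m B = ∞ → ∀ᵐ ω ∂P, N ω B = ∞
  indep : ∀ (k : ℕ) (B : Fin k → Set (ℝ × E)), (∀ i, MeasurableSet (B i)) →
    Pairwise (fun i j => Disjoint (B i) (B j)) → iIndepFun (fun i ω => N ω (B i)) P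
  adapted : ∀ (t : ℝ≥0) (B : Set (ℝ × E)), MeasurableSet B → B ⊆ Iic (t : ℝ) ×ˢ univ →
    Measurable[ℱ t] fun ω => N ω B
  indep_past : ∀ s : ℝ≥0,
    Indep (⨆ B ∈ {B : Set (ℝ × E) | MeasurableSet B ∧ B ⊆ Ioi (s : ℝ) ×ˢ univ},
      MeasurableSpace.comap (fun ω => N ω B) inferInstance) (ℱ s) P

/-- The compensated measure `Ñ(B) = N(B) - ∫_B m(dz) dt`, for `B` of finite intensity. -/
def compensated (m : Measure E) (N : Ω → Measure (ℝ × E)) (B : Set (ℝ × E)) (ω : Ω) : ℝ :=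
  (N ω).real B - (intensity m).real B

/-- Simple predictable functions
`∑_{i < k} ∑_{j < l} ξ_{ij}(ω) 1_{(τ_i, τ_{i+1}]}(t) 1_{A_j}(z)`, with `ξ_{ij}` bounded and
`ℱ_{τ_i}`-measurable, and the `A_j` disjoint with `m(A_j) < ∞`. -/
structure SimplePredictable (ℱ : Filtration ℝ≥0 mΩ) (m : Measure E) where
  k : ℕ
  l : ℕ
  τ : ℕ → ℝ≥0
  τ_mono : Monotone τ
  A : Fin l → Set E
  A_measurable : ∀ j, MeasurableSet (A j)
  A_disjoint : Pairwise fun i j => Disjoint (A i) (A j)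
  A_finite : ∀ j, m (A j) < ∞
  ξ : ℕ → Fin l → Ω → ℝ
  ξ_measurable : ∀ i j, StronglyMeasurable[ℱ (τ i)] (ξ i j)
  ξ_bounded : ∀ i j, ∃ c, ∀ ω, |ξ i j ω| ≤ c

/-- The function on `Ω × [0,∞) × E` given by a simple predictable function. -/
def SimplePredictable.toFun {ℱ : Filtration ℝ≥0 mΩ} {m : Measure E} (φ : SimplePredictable ℱ m)
    (p : Ω × ℝ × E) : ℝ :=
  ∑ i ∈ Finset.range φ.k, ∑ j,
    (Ioc (φ.τ i : ℝ) (φ.τ (i + 1)) ×ˢ φ.A j).indicator (fun _ => φ.ξ i j p.1) p.2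

/-- The stochastic integral `∫_0^t ∫_E φ(s,z) Ñ(dz,ds)` of a simple predictable function:
`∑_{i,j} ξ_{ij} Ñ((τ_i ∧ t, τ_{i+1} ∧ t] × A_j)`. -/
def SimplePredictable.integral {ℱ : Filtration ℝ≥0 mΩ} {m : Measure E}
    (φ : SimplePredictable ℱ m) (N : Ω → Measure (ℝ × E)) (t : ℝ≥0) (ω : Ω) : ℝ :=
  ∑ i ∈ Finset.range φ.k, ∑ j,
    φ.ξ i j ω * compensated m N (Ioc (min (φ.τ i) t : ℝ) (min (φ.τ (i + 1)) t) ×ˢ φ.A j) ω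

/-- The process `I` is a (càdlàg) version of the stochastic integral process
`t ↦ ∫_0^t ∫_E g(s,z) Ñ(dz,ds)`: it is adapted with almost surely càdlàg paths, and there are simple
predictable functions that converge to `g` in `L²(P ⊗ dt ⊗ m)` and whose integrals up to `t`
converge to `I t` in `L²(P)` for every `t`. -/
def IsStochasticIntegral (P : Measure Ω) (ℱ : Filtration ℝ≥0 mΩ) (m : Measure E)
    (N : Ω → Measure (ℝ × E)) (g : Ω × ℝ × E → ℝ) (I : ℝ≥0 → Ω → ℝ) : Prop :=
  StronglyAdapted ℱ I ∧
  (∀ᵐ ω ∂P, ∀ t, ContinuousWithinAt (fun s => I s ω) (Ici t) t ∧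
    ∃ l, Tendsto (fun s => I s ω) (𝓝[<] t) (𝓝 l)) ∧
  ∃ φ : ℕ → SimplePredictable ℱ m,
    Tendsto (fun k => eLpNorm (fun p => (φ k).toFun p - g p) 2 (P.prod (intensity m)))
      atTop (𝓝 0) ∧
    ∀ t, Tendsto (fun k => eLpNorm (fun ω => (φ k).integral N t ω - I t ω) 2 P) atTop (𝓝 0)

open Classical in
/-- The stochastic integral process `t ↦ ∫_0^t ∫_E g(s,z) Ñ(dz,ds)`. -/
def stochasticIntegral (P : Measure Ω) (ℱ : Filtration ℝ≥0 mΩ) (m : Measure E)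
    (N : Ω → Measure (ℝ × E)) (g : Ω × ℝ × E → ℝ) : ℝ≥0 → Ω → ℝ :=
  if h : ∃ I, IsStochasticIntegral P ℱ m N g I then h.choose else 0

/-- The stochastic integral `∫_{nΔt}^s ∫_E η(X;z) Ñ(dz,dt)`, for `s ∈ [nΔt, (n+1)Δt]`. -/
def noiseIncrement (P : Measure Ω) (ℱ : Filtration ℝ≥0 mΩ) (m : Measure E)
    (N : Ω → Measure (ℝ × E)) (η : ℝ → E → ℝ) (Δt : ℝ) (n : ℕ) (X : Ω → ℝ) (s : ℝ) : Ω → ℝ :=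
  stochasticIntegral P ℱ m N
    (fun p => (Ioc (n * Δt) ((n + 1) * Δt)).indicator (fun _ => η (X p.1) p.2.2) p.2.1)
    s.toNNReal

/-! ### The upwind finite volume scheme -/

/-- The discrete unknowns `u_K^n` of the upwind finite volume scheme:
`u_K^0 = |K|⁻¹ ∫_K u₀ dx` and
`|K| (u_K^{n+1} - u_K^n) / Δt
  + ∑_{σ = K|L} |σ| {(v · n_{K,σ})^+ f(u_K^n) - (v · n_{K,σ})^- f(u_L^n)}
  = |K| / Δt ∫_{nΔt}^{(n+1)Δt} ∫_E η(u_K^n;z) Ñ(dz,dt)`. -/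
def upwind {d : ℕ} (P : Measure Ω) (ℱ : Filtration ℝ≥0 mΩ) (m : Measure E)
    (N : Ω → Measure (ℝ × E)) (η : ℝ → E → ℝ) (f : ℝ → ℝ) (v : ℝ → Sp d → Sp d)
    (u₀ : Ω → Lp ℝ 2 (volume : Measure (Sp d))) (𝒯 : Set (Set (Sp d))) (Δt : ℝ) :
    ℕ → Set (Sp d) → Ω → ℝ
  | 0, K, ω => 1 / volume.real K * ∫ x in K, u₀ ω x
  | n + 1, K, ω =>
      upwind P ℱ m N η f v u₀ 𝒯 Δt n K ω
      - Δt / volume.real K * ∑ᶠ L ∈ neighbours 𝒯 K, surfaceArea (interface K L) *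
          (normalVelocityPos v Δt n K L * f (upwind P ℱ m N η f v u₀ 𝒯 Δt n K ω)
            - normalVelocityNeg v Δt n K L * f (upwind P ℱ m N η f v u₀ 𝒯 Δt n L ω))
      + noiseIncrement P ℱ m N η Δt n (upwind P ℱ m N η f v u₀ 𝒯 Δt n K) ((n + 1) * Δt) ω

/-- The time-continuous unknown `v_K^n(s)`, `s ∈ [nΔt, (n+1)Δt]`:
`v_K^n(s) = u_K^n
  + ∫_{nΔt}^s ∑_{σ = K|L} |σ| (v · n_{K,σ})^- (f(u_L^n) - f(u_K^n)) / |K| dt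
  + ∫_{nΔt}^s ∫_E η(u_K^n;z) Ñ(dz,dt)`. -/
def timeContinuousUnknown {d : ℕ} (P : Measure Ω) (ℱ : Filtration ℝ≥0 mΩ) (m : Measure E)
    (N : Ω → Measure (ℝ × E)) (η : ℝ → E → ℝ) (f : ℝ → ℝ) (v : ℝ → Sp d → Sp d)
    (u₀ : Ω → Lp ℝ 2 (volume : Measure (Sp d))) (𝒯 : Set (Set (Sp d))) (Δt : ℝ)
    (n : ℕ) (K : Set (Sp d)) (s : ℝ) (ω : Ω) : ℝ :=
  upwind P ℱ m N η f v u₀ 𝒯 Δt n K ω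
  + (∫ _t in (n * Δt)..s, ∑ᶠ L ∈ neighbours 𝒯 K,
      surfaceArea (interface K L) * normalVelocityNeg v Δt n K L *
        ((f (upwind P ℱ m N η f v u₀ 𝒯 Δt n L ω) - f (upwind P ℱ m N η f v u₀ 𝒯 Δt n K ω))
          / volume.real K))
  + noiseIncrement P ℱ m N η Δt n (upwind P ℱ m N η f v u₀ 𝒯 Δt n K) s ω

/-- The approximate solution `u^h`: equal to `u_K^n` for `x ∈ K`, `t ∈ [nΔt, (n+1)Δt)`. -/
def upwindApprox {d : ℕ} (P : Measure Ω) (ℱ : Filtration ℝ≥0 mΩ) (m : Measure E)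
    (N : Ω → Measure (ℝ × E)) (η : ℝ → E → ℝ) (f : ℝ → ℝ) (v : ℝ → Sp d → Sp d)
    (u₀ : Ω → Lp ℝ 2 (volume : Measure (Sp d))) (𝒯 : Set (Set (Sp d))) (Δt : ℝ)
    (p : Ω × ℝ × Sp d) : ℝ :=
  ∑ᶠ K ∈ 𝒯, K.indicator (fun _ => upwind P ℱ m N η f v u₀ 𝒯 Δt ⌊p.2.1 / Δt⌋₊ K p.1) p.2.2

/-- The time-continuous approximate solution `v^h`: equal to `v_K^n(t)` for `x ∈ K`,
`t ∈ [nΔt, (n+1)Δt)`. -/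
def timeContinuousApprox {d : ℕ} (P : Measure Ω) (ℱ : Filtration ℝ≥0 mΩ) (m : Measure E)
    (N : Ω → Measure (ℝ × E)) (η : ℝ → E → ℝ) (f : ℝ → ℝ) (v : ℝ → Sp d → Sp d)
    (u₀ : Ω → Lp ℝ 2 (volume : Measure (Sp d))) (𝒯 : Set (Set (Sp d))) (Δt : ℝ)
    (p : Ω × ℝ × Sp d) : ℝ :=
  ∑ᶠ K ∈ 𝒯, K.indicator
    (fun _ => timeContinuousUnknown P ℱ m N η f v u₀ 𝒯 Δt ⌊p.2.1 / Δt⌋₊ K p.2.1 p.1) p.2.2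

end Noise

end

noncomputable section

/-! On a space-time cell the difference `v^h - u^h` is the noise increment since `nΔt` minus `(s -
nΔt)/|K|` times the upwind flux `G_K = ∑_L c_{KL} (f(u_K) - f(u_L))`, where `c_{KL}` is the inflow
from `L` into `K`. The two parts are estimated separately in mean square.

The noise is handled by the Itô isometry: its second moment is at most `κ Δt E|u_K^n|²` with `κ =
lam² ∫ h₁²`, because the Lipschitz bound and `η(0) = 0` give `|η(u)| ≤ lam |u| h₁`. For the flux,
let `D(b,a) = ∫_a^b (f - f(a))` be the entropy dissipation of a jump. Since `f` is monotone and
`c_f`-Lipschitz, `(f(b) - f(a))² ≤ 2 c_f D(b,a)` (`sq_sub_le_dissipation`). Cauchy-Schwarz and the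
CFL condition then give `Δt G_K² ≤ 2(1-ξ)|K| ∑_L c_{KL} D(u_K,u_L)` (`sq_upwind_flux_le`). It
remains to bound the energy `∑_K |K| E|u_K^n|²` uniformly in `n`, and the total dissipation `Δt ∑_n
∑_K ∑_L c_{KL} E D`; the latter is the weak BV estimate.

Both follow from squaring the scheme. The noise is orthogonal to the past, so there is no cross
term. The product `u_K G_K` splits into the dissipation and differences of the entropy flux `∫_0^a s
f'(s) ds`. The CFL condition lets the term `G_K²` absorb only the fraction `1-ξ` of the dissipation
(`sq_upwind_step_le`). Summed over the cells, the entropy flux differences cancel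
(`hasSum_exchange`), because in every cell total inflow equals total outflow. A discrete Gronwall
argument concludes (`energy_estimate`), started by Bessel's inequality for the cell averages of
`u₀`. The outcome is a bound by a constant times `Δt` alone; the term in `h` costs nothing.

Two ingredients carry the rest. The inflow-outflow balance is the divergence theorem on a bounded
set whose boundary lies in finitely many hyperplanes (`IsPolygonal.integral_fderiv`). It is proved
by differentiating the translates of the indicator function: the difference quotients concentrate on
thin layers over the hyperplanes, and the layers converge to surface integrals. The boundary
integral is then split over the interfaces of the mesh (`IsAdmissibleMesh.integral_frontier`). On
the probabilistic side only the upper bound in the isometry and the martingale property are needed.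
Both are proved for simple predictable functions from the independence properties of the random
measure and pass to the `L²` limit. Existence of the stochastic integral is never needed: where the
definition falls back to `0`, both facts are trivial. -/

/-- The hyperplane `⟨n, x⟩ = c`. -/
def hyperplane {d : ℕ} (n : Sp d) (c : ℝ) : Set (Sp d) := {x | inner ℝ n x = c}

/-! ### Lebesgue and surface measure along a hyperplane -/

section Hyperplane
variable {d : ℕ} {n : Sp d}

theorem isClosed_hyperplane (n : Sp d) (c : ℝ) : IsClosed (hyperplane n c) :=
  isClosed_eq (by fun_prop) continuous_const

theorem finrank_orthogonal_unit (hn : ‖n‖ = 1) :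
    Module.finrank ℝ (ℝ ∙ n)ᗮ = d - 1 := by
  have hn0 : n ≠ 0 := by rintro rfl; simp at hn
  have h := (ℝ ∙ n).finrank_add_finrank_orthogonal
  rw [finrank_span_singleton hn0, finrank_euclideanSpace_fin] at h
  omega

theorem inner_coe_orthogonal (y : (ℝ ∙ n)ᗮ) : inner ℝ n (y : Sp d) = 0 :=
  (Submodule.mem_orthogonal _ _).1 y.2 n (Submodule.mem_span_singleton_self n)

/-- Points at signed height `c + s τ` over the hyperplane `nᗮ`. -/
def layerMap (n : Sp d) (c s : ℝ) (p : (ℝ ∙ n)ᗮ × ℝ) : Sp d := (c + s * p.2) • n + (p.1 : Sp d)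

theorem inner_layerMap (hn : ‖n‖ = 1) (c s : ℝ) (p : (ℝ ∙ n)ᗮ × ℝ) :
    inner ℝ n (layerMap n c s p) = c + s * p.2 := by
  rw [layerMap, inner_add_right, inner_smul_right, inner_coe_orthogonal,
    real_inner_self_eq_norm_sq, hn]
  ring

theorem continuous_layerMap (n : Sp d) (c s : ℝ) : Continuous (layerMap n c s) := by
  unfold layerMap; fun_prop

theorem measurableEmbedding_layerMap (hn : ‖n‖ = 1) (c : ℝ) {s : ℝ} (hs : s ≠ 0) :
    MeasurableEmbedding (layerMap n c s) := by
  refine (continuous_layerMap n c s).measurableEmbedding fun p q h => ?_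
  have h2 : c + s * p.2 = c + s * q.2 := by
    rw [← inner_layerMap hn c s p, h, inner_layerMap hn]
  have h3 : p.2 = q.2 := by simpa [hs] using h2
  refine Prod.ext (Subtype.ext ?_) h3
  simpa [layerMap, h3] using h

/-- The orthogonal splitting of the space into the line of `n` and its complement is isometric, so
Lebesgue measure is the product measure in these coordinates. -/
theorem measurePreserving_layerMap_one (hn : ‖n‖ = 1) (c : ℝ) :
    MeasurePreserving (layerMap n c 1) (volume.prod volume) volume := by
  have hn0 : n ≠ 0 := by rintro rfl; simp at hn
  have h1 := ((ℝ ∙ n).measurePreserving_measurableEquivProd (c • n)).symm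
  have h2 : MeasurePreserving (LinearIsometryEquiv.toSpanUnitSingleton n hn) volume volume :=
    LinearIsometryEquiv.measurePreserving _
  have h3 := (h1.comp (h2.prod (MeasurePreserving.id (volume : Measure (ℝ ∙ n)ᗮ)))).comp
    (Measure.measurePreserving_swap (μ := (volume : Measure (ℝ ∙ n)ᗮ)) (ν := (volume : Measure ℝ)))
  rw [InnerProductSpace.euclideanHausdorffMeasure_eq_volume] at h3
  have h4 : layerMap n c 1 = ((ℝ ∙ n).measurableEquivProd (c • n)).symm ∘
      Prod.map (LinearIsometryEquiv.toSpanUnitSingleton n hn) id ∘ Prod.swap := by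
    funext p
    simp [layerMap, add_smul]
    abel
  rw [h4]
  exact h3

/-- Rescaling the height by `s` produces exactly the factor `s⁻¹` of a difference quotient, so that
normalised integrals over thinning layers become integrals over a fixed box. -/
theorem map_layerMap (hn : ‖n‖ = 1) (c : ℝ) {s : ℝ} (hs : 0 < s) :
    Measure.map (layerMap n c s) (volume.prod volume) = ENNReal.ofReal s⁻¹ • volume := by
  have h1 : layerMap n c s = layerMap n c 1 ∘ Prod.map id (s * ·) := by
    ext1 p; simp [layerMap]
  have h2 := Real.map_volume_mul_left hs.ne'
  rw [abs_of_pos (by positivity)] at h2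
  have h3 : Measure.map (Prod.map id (s * ·)) ((volume : Measure (ℝ ∙ n)ᗮ).prod (volume : Measure ℝ))
      = ENNReal.ofReal s⁻¹ • (volume.prod volume) := by
    rw [← Measure.map_prod_map _ _ measurable_id (measurable_const_mul s), h2, Measure.map_id,
      Measure.prod_smul_right]
  rw [h1, ← Measure.map_map (continuous_layerMap n c 1).measurable (by fun_prop), h3,
    Measure.map_smul, (measurePreserving_layerMap_one hn c).map_eq]

theorem isometry_hyperplane_param (n : Sp d) (c : ℝ) :
    Isometry (fun y : (ℝ ∙ n)ᗮ => c • n + (y : Sp d)) := by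
  refine Isometry.of_dist_eq fun x y => ?_
  rw [dist_add_left]; rfl

theorem range_hyperplane_param (hn : ‖n‖ = 1) (c : ℝ) :
    range (fun y : (ℝ ∙ n)ᗮ => c • n + (y : Sp d)) = hyperplane n c := by
  ext x
  constructor
  · rintro ⟨y, rfl⟩
    simp [hyperplane, inner_add_right, inner_smul_right, inner_coe_orthogonal, hn]
  · intro hx
    refine ⟨⟨x - c • n, ?_⟩, by simp⟩
    rw [Submodule.mem_orthogonal_singleton_iff_inner_right, inner_sub_right, inner_smul_right,
      real_inner_self_eq_norm_sq, hn, show inner ℝ n x = c from hx]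
    ring

/-- Isometries preserve Hausdorff measure, and on a Euclidean space of dimension `d - 1` it is
Lebesgue measure; surface integrals can therefore be pulled back to the orthogonal complement of
`n`. -/
theorem map_hyperplane_param (hn : ‖n‖ = 1) (c : ℝ) :
    Measure.map (fun y : (ℝ ∙ n)ᗮ => c • n + (y : Sp d)) volume
      = (Measure.euclideanHausdorffMeasure (d - 1)).restrict (hyperplane n c) := by
  rw [← range_hyperplane_param hn c, ← (isometry_hyperplane_param n c).map_euclideanHausdorffMeasure,
    ← finrank_orthogonal_unit hn, InnerProductSpace.euclideanHausdorffMeasure_eq_volume]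

/-- A level set of a linear form is empty or a translate of the kernel, and here it is a proper
affine subspace. -/
theorem measure_level_eq_zero {F : Type*} [NormedAddCommGroup F] [InnerProductSpace ℝ F]
    [FiniteDimensional ℝ F] [MeasurableSpace F] [BorelSpace F] (ℓ : F →ₗ[ℝ] ℝ) (e : ℝ)
    (h : ∃ x, ℓ x ≠ e) : volume {x | ℓ x = e} = 0 := by
  by_cases hne : ∃ p, ℓ p = e
  · obtain ⟨p, hp⟩ := hne
    have hs : {x | ℓ x = e} = (AffineSubspace.mk' p (LinearMap.ker ℓ) : Set F) := by
      ext x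
      simp [AffineSubspace.mem_mk', sub_eq_zero, hp]
    rw [hs]
    refine Measure.addHaar_affineSubspace _ _ fun htop => ?_
    obtain ⟨x, hx⟩ := h
    have : x ∈ {x | ℓ x = e} := by rw [hs, htop]; trivial
    exact hx this
  · have : {x | ℓ x = e} = ∅ := by
      ext x; simp only [mem_ofPred_eq, mem_empty_iff_false, iff_false]; exact fun hx => hne ⟨x, hx⟩
    simp [this]

theorem volume_hyperplane (hn : n ≠ 0) (c : ℝ) : volume (hyperplane n c) = 0 := by
  refine measure_level_eq_zero (innerSL ℝ n).toLinearMap c ?_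
  by_contra! h
  have h0 := h 0
  have h1 := h n
  simp at h0
  simp [← h0] at h1
  exact hn h1

/-- Pulled back to the first hyperplane, the second one becomes a level set of a linear form. This
is everything only if `n'` is orthogonal to all of `nᗮ`, that is `n' = ±n`, and then the two
hyperplanes coincide. -/
theorem euclideanHausdorffMeasure_hyperplane_inter {n n' : Sp d} (hn : ‖n‖ = 1) (hn' : ‖n'‖ = 1)
    {c c' : ℝ} (hne : hyperplane n c ≠ hyperplane n' c') :
    (Measure.euclideanHausdorffMeasure (d - 1) : Measure (Sp d))
      (hyperplane n c ∩ hyperplane n' c') = 0 := by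
  have hm : Measurable (fun y : (ℝ ∙ n)ᗮ => c • n + (y : Sp d)) :=
    (isometry_hyperplane_param n c).continuous.measurable
  rw [inter_comm, ← Measure.restrict_apply (isClosed_hyperplane n' c').measurableSet,
    ← map_hyperplane_param hn c, Measure.map_apply hm (isClosed_hyperplane n' c').measurableSet]
  have := measure_level_eq_zero ((innerSL ℝ n').toLinearMap ∘ₗ ((ℝ ∙ n)ᗮ).subtype)
    (c' - c * inner ℝ n' n)
  convert this ?_ using 2
  · ext y
    simp [hyperplane, inner_add_right, inner_smul_right]
    constructor <;> intro h <;> linarith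
  by_contra! h
  have h0 : c' = c * inner ℝ n' n := by
    have := h 0; simp at this; linarith
  have h1 : ∀ y ∈ (ℝ ∙ n)ᗮ, inner ℝ n' y = 0 := by
    intro y hy
    have := h ⟨y, hy⟩
    simpa [h0] using this
  have h2 : n' ∈ (ℝ ∙ n) := by
    rw [← Submodule.orthogonal_orthogonal (ℝ ∙ n), Submodule.mem_orthogonal]
    intro y hy
    rw [real_inner_comm]; exact h1 y hy
  obtain ⟨r, rfl⟩ := Submodule.mem_span_singleton.1 h2
  have hr : |r| = 1 := by simpa [norm_smul, hn] using hn'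
  have hr0 : r ≠ 0 := by rintro rfl; simp at hr
  apply hne
  ext x
  simp only [hyperplane, mem_ofPred_eq, inner_smul_left, h0, real_inner_self_eq_norm_sq, hn]
  simp
  constructor
  · rintro rfl; ring
  · intro h
    have : r * inner ℝ n x = r * c := by linarith
    exact mul_left_cancel₀ hr0 this

end Hyperplane

/-- Off the frontier the space is the disjoint union of two open sets, the interior of `K` and the
complement of its closure. -/
theorem IsPreconnected.subset_or_disjoint_of_disjoint_frontier {X : Type*} [TopologicalSpace X]
    {A K : Set X} (hA : IsPreconnected A) (h : Disjoint A (frontier K)) :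
    A ⊆ K ∨ Disjoint A K := by
  have hsub : A ⊆ interior K ∪ (closure K)ᶜ := by
    intro x hx
    by_cases hc : x ∈ closure K
    · left
      by_contra hi
      exact (disjoint_left.1 h hx) ⟨hc, hi⟩
    · right; exact hc
  rcases isPreconnected_iff_subset_of_disjoint.1 hA _ _ isOpen_interior
    isClosed_closure.isOpen_compl hsub (by
      ext x
      simp only [mem_inter_iff, mem_compl_iff, mem_empty_iff_false, iff_false]
      rintro ⟨_, h1, h2⟩
      exact h2 (subset_closure (interior_subset h1))) with h1 | h1
  · exact Or.inl (h1.trans interior_subset)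
  · exact Or.inr (disjoint_left.2 fun x hx hk => h1 hx (subset_closure hk))

/-! ### Outward normals -/

section OutwardNormal
variable {d : ℕ} {K : Set (Sp d)} {x n : Sp d}

/-- If `n' ≠ -n`, the vector `-(n + n')` points strictly inwards for both half spaces, so a short
step along it from `x` lands in `K ∩ L`. -/
theorem IsOutwardNormal.eq_of_disjoint {L : Set (Sp d)} {n' : Sp d} (h : IsOutwardNormal K x n)
    (h' : IsOutwardNormal L x n') (hd : Disjoint K L) : n' = -n := by
  obtain ⟨hn, r, hr, hK⟩ := h
  obtain ⟨hn', r', hr', hL⟩ := h'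
  by_contra hne
  set w := -(n + n') with hw
  have hlt : -1 < inner ℝ n n' := by
    have h1 : 0 < ‖n + n'‖ ^ 2 := by
      have : n + n' ≠ 0 := fun h0 => hne (by rw [eq_neg_iff_add_eq_zero, add_comm]; exact h0)
      positivity
    rw [norm_add_sq_real, hn, hn'] at h1
    linarith
  have hw1 : inner ℝ n w < 0 := by
    rw [hw, inner_neg_right, inner_add_right, real_inner_self_eq_norm_sq, hn]; linarith
  have hw2 : inner ℝ n' w < 0 := by
    rw [hw, inner_neg_right, inner_add_right, real_inner_self_eq_norm_sq, hn', real_inner_comm]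
    linarith
  have hlim : Tendsto (fun t : ℝ => x + t • w) (𝓝[>] 0) (𝓝 x) := by
    have : Continuous (fun t : ℝ => x + t • w) := by fun_prop
    have h0 := this.tendsto 0
    simp only [zero_smul, add_zero] at h0
    exact h0.mono_left nhdsWithin_le_nhds
  obtain ⟨t, ⟨ht1, ht2⟩, ht⟩ := (((hlim.eventually (Metric.ball_mem_nhds x hr)).and
    (hlim.eventually (Metric.ball_mem_nhds x hr'))).and self_mem_nhdsWithin).exists
  have ht : 0 < t := ht
  have e1 := (hK _ ht1).1 (by
    rw [add_sub_cancel_left, inner_smul_right]; exact mul_neg_of_pos_of_neg ht hw1)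
  have e2 := (hL _ ht2).1 (by
    rw [add_sub_cancel_left, inner_smul_right]; exact mul_neg_of_pos_of_neg ht hw2)
  exact disjoint_left.1 hd e1 e2

theorem IsOutwardNormal.compl (h : IsOutwardNormal K x n) : IsOutwardNormal Kᶜ x (-n) := by
  obtain ⟨hn, r, hr, hK⟩ := h
  refine ⟨by simpa, r, hr, fun y hy => ⟨fun h1 => ?_, fun h1 => ?_⟩⟩
  · rw [inner_neg_left] at h1
    exact (hK y hy).2 (by linarith)
  · rw [inner_neg_left] at h1
    simpa using (hK y hy).1 (by linarith)

/-- `K` is disjoint from its complement, whose outward normal is `-n'`. -/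
theorem IsOutwardNormal.unique {n' : Sp d} (h : IsOutwardNormal K x n)
    (h' : IsOutwardNormal K x n') : n' = n := by
  have := h.eq_of_disjoint h'.compl disjoint_compl_right
  simpa using this

theorem IsOutwardNormal.outwardNormal_eq (h : IsOutwardNormal K x n) : outwardNormal K x = n := by
  have hex : ∃ n, IsOutwardNormal K x n := ⟨n, h⟩
  rw [outwardNormal, dif_pos hex]
  exact h.unique hex.choose_spec

theorem norm_outwardNormal_le (K : Set (Sp d)) (x : Sp d) : ‖outwardNormal K x‖ ≤ 1 := by
  unfold outwardNormal
  split_ifs with h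
  · exact h.choose_spec.1.le
  · simp

theorem IsOutwardNormal.exists_mem_ball (hn : ‖n‖ = 1) {r : ℝ} (hr : 0 < r) (x : Sp d) :
    ∃ y ∈ Metric.ball x r, inner ℝ n (y - x) < 0 := by
  refine ⟨x - (r / 2) • n, ?_, ?_⟩
  · rw [Metric.mem_ball, dist_eq_norm, sub_sub_cancel_left, norm_neg, norm_smul, hn]
    simp [abs_of_pos hr]; linarith
  · rw [sub_sub_cancel_left, inner_neg_right, inner_smul_right, real_inner_self_eq_norm_sq, hn]
    simp [hr]

theorem IsOutwardNormal.mem_frontier (h : IsOutwardNormal K x n) : x ∈ frontier K := by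
  have key : ∀ {K : Set (Sp d)} {n : Sp d}, IsOutwardNormal K x n → x ∈ closure K := by
    intro K n h
    obtain ⟨hn, r, hr, hK⟩ := h
    refine Metric.mem_closure_iff.2 fun ε hε => ?_
    obtain ⟨y, hy, hy'⟩ := IsOutwardNormal.exists_mem_ball hn (lt_min hr hε) x
    refine ⟨y, (hK y (Metric.ball_subset_ball (min_le_left _ _) hy)).1 hy', ?_⟩
    rw [dist_comm]
    exact (Metric.mem_ball.1 hy).trans_le (min_le_right _ _)
  rw [frontier_eq_closure_inter_closure]
  exact ⟨key h, key h.compl⟩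

/-- If `K` coincides near `x` with a union of open half balls bounded by a hyperplane through `x`,
the outward normal at `x` is read off from the values of the indicator function. -/
theorem outwardNormal_eq_of_half_balls (hn : ‖n‖ = 1) {e₁ e₂ : ℝ} {r : ℝ} (hr : 0 < r)
    (h : ∀ y ∈ Metric.ball x r, (inner ℝ n (y - x) < 0 → K.indicator 1 y = e₁) ∧
      (0 < inner ℝ n (y - x) → K.indicator 1 y = e₂)) :
    outwardNormal K x = (e₁ - e₂) • n := by
  classical
  have val : ∀ y, K.indicator (1 : Sp d → ℝ) y = if y ∈ K then 1 else 0 := fun y => by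
    simp [indicator_apply]
  have hneg : ∃ y ∈ Metric.ball x r, inner ℝ n (y - x) < 0 :=
    IsOutwardNormal.exists_mem_ball hn hr x
  have hpos : ∃ y ∈ Metric.ball x r, 0 < inner ℝ n (y - x) := by
    obtain ⟨y, hy, hy'⟩ := IsOutwardNormal.exists_mem_ball (n := -n) (by simpa) hr x
    exact ⟨y, hy, by rw [inner_neg_left] at hy'; linarith⟩
  have he₁ : e₁ = 1 ∨ e₁ = 0 := by
    obtain ⟨y, hy, hy'⟩ := hneg
    rw [← (h y hy).1 hy', val]; split_ifs <;> simp
  have he₂ : e₂ = 1 ∨ e₂ = 0 := by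
    obtain ⟨y, hy, hy'⟩ := hpos
    rw [← (h y hy).2 hy', val]; split_ifs <;> simp
  -- With equal values on both sides, `K` is full or empty near `x` off the hyperplane, which no
  -- half space is.
  have hno : e₁ = e₂ → outwardNormal K x = 0 := by
    rintro rfl
    rw [outwardNormal, dif_neg]
    rintro ⟨n', hn', r', hr', hK⟩
    -- A direction that crosses the supposed boundary and is transversal to the given hyperplane: `x
    -- ± t w` lie on opposite sides of the former and both avoid the latter.
    obtain ⟨w, hw, hwn⟩ : ∃ w : Sp d, 0 < inner ℝ n' w ∧ inner ℝ n w ≠ 0 := by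
      by_cases h0 : inner ℝ n n' = 0
      · refine ⟨n' + n, ?_, ?_⟩
        · rw [inner_add_right, real_inner_comm n n', h0, real_inner_self_eq_norm_sq, hn']; norm_num
        · rw [inner_add_right, h0, real_inner_self_eq_norm_sq, hn]; norm_num
      · exact ⟨n', by rw [real_inner_self_eq_norm_sq, hn']; norm_num, h0⟩
    have hlim : Tendsto (fun t : ℝ => t • w) (𝓝[>] 0) (𝓝 0) := by
      have : Continuous (fun t : ℝ => t • w) := by fun_prop
      have h0 := this.tendsto 0
      simp only [zero_smul] at h0
      exact h0.mono_left nhdsWithin_le_nhds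
    obtain ⟨t, ht1, ht⟩ := ((hlim.eventually
      (Metric.ball_mem_nhds (0 : Sp d) (lt_min hr hr'))).and self_mem_nhdsWithin).exists
    have ht : 0 < t := ht
    have hb : ‖t • w‖ < min r r' := by simpa using ht1
    have m1 : x + t • w ∈ Metric.ball x r ∧ x + t • w ∈ Metric.ball x r' := by
      simp only [Metric.mem_ball, dist_eq_norm, add_sub_cancel_left]
      exact ⟨hb.trans_le (min_le_left _ _), hb.trans_le (min_le_right _ _)⟩
    have m2 : x - t • w ∈ Metric.ball x r ∧ x - t • w ∈ Metric.ball x r' := by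
      simp only [Metric.mem_ball, dist_eq_norm, sub_sub_cancel_left, norm_neg]
      exact ⟨hb.trans_le (min_le_left _ _), hb.trans_le (min_le_right _ _)⟩
    have k1 : x + t • w ∉ K := (hK _ m1.2).2 (by
      rw [add_sub_cancel_left, inner_smul_right]; positivity)
    have k2 : x - t • w ∈ K := (hK _ m2.2).1 (by
      rw [sub_sub_cancel_left, inner_neg_right, inner_smul_right]
      have := mul_pos ht hw; linarith)
    have all : ∀ y ∈ Metric.ball x r, inner ℝ n (y - x) ≠ 0 → K.indicator (1 : Sp d → ℝ) y = e₁ :=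
      fun y hy hne => by
        rcases lt_or_gt_of_ne hne with h1 | h1
        · exact (h y hy).1 h1
        · exact (h y hy).2 h1
    have q1 := all _ m1.1 (by
      rw [add_sub_cancel_left, inner_smul_right]; exact mul_ne_zero ht.ne' hwn)
    have q2 := all _ m2.1 (by
      rw [sub_sub_cancel_left, inner_neg_right, inner_smul_right]
      exact neg_ne_zero.2 (mul_ne_zero ht.ne' hwn))
    rw [val, if_neg k1] at q1
    rw [val, if_pos k2] at q2
    linarith
  have memiff : ∀ y, (K.indicator (1 : Sp d → ℝ) y = 1 ↔ y ∈ K) ∧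
      (K.indicator (1 : Sp d → ℝ) y = 0 ↔ y ∉ K) := fun y => by
    rw [val]; split_ifs with hy <;> simp [hy]
  rcases he₁ with rfl | rfl <;> rcases he₂ with rfl | rfl
  · rw [hno rfl]; simp
  · rw [IsOutwardNormal.outwardNormal_eq (n := n)]
    · simp
    · exact ⟨hn, r, hr, fun y hy => ⟨fun h1 => (memiff y).1.1 ((h y hy).1 h1),
        fun h1 => (memiff y).2.1 ((h y hy).2 h1)⟩⟩
  · rw [IsOutwardNormal.outwardNormal_eq (n := -n)]
    · simp
    · refine ⟨by simpa, r, hr, fun y hy => ⟨fun h1 => (memiff y).1.1 ((h y hy).2 ?_),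
        fun h1 => (memiff y).2.1 ((h y hy).1 ?_)⟩⟩
      · rw [inner_neg_left] at h1; linarith
      · rw [inner_neg_left] at h1; linarith
  · rw [hno rfl]; simp

/-- The set is relatively open in the hyperplane: a half ball description at `x` remains valid, with
a smaller radius, at the nearby points of the same hyperplane. -/
theorem measurableSet_isOutwardNormal (K : Set (Sp d)) (n : Sp d) (c : ℝ) :
    MeasurableSet {x | x ∈ hyperplane n c ∧ IsOutwardNormal K x n} := by
  have : {x | x ∈ hyperplane n c ∧ IsOutwardNormal K x n}
      = hyperplane n c ∩ ⋃ x ∈ {x | x ∈ hyperplane n c ∧ IsOutwardNormal K x n},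
        ⋃ r ∈ {r : ℝ | ∀ y ∈ Metric.ball x r,
          (inner ℝ n (y - x) < 0 → y ∈ K) ∧ (0 < inner ℝ n (y - x) → y ∉ K)},
          Metric.ball x r := by
    ext z
    constructor
    · rintro ⟨hz, hz'⟩
      refine ⟨hz, ?_⟩
      obtain ⟨hn, r, hr, hr'⟩ := hz'
      exact mem_iUnion₂_of_mem (⟨hz, ⟨hn, r, hr, hr'⟩⟩ : z ∈ {x | _ ∧ _})
        (mem_iUnion₂_of_mem hr' (Metric.mem_ball_self hr))
    · rintro ⟨hz, hz'⟩
      obtain ⟨x, ⟨hx, hn, -⟩, hz'⟩ := mem_iUnion₂.1 hz'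
      obtain ⟨r, hr, hz'⟩ := mem_iUnion₂.1 hz'
      refine ⟨hz, hn, r - dist z x, sub_pos.2 hz', fun y hy => ?_⟩
      have hxz : inner ℝ n (y - x) = inner ℝ n (y - z) := by
        rw [inner_sub_right, inner_sub_right, show inner ℝ n x = c from hx,
          show inner ℝ n z = c from hz]
      rw [← hxz]
      refine hr y (Metric.mem_ball.2 ?_)
      have := dist_triangle y z x
      have := Metric.mem_ball.1 hy
      linarith
  rw [this]
  refine (isClosed_hyperplane n c).measurableSet.inter (IsOpen.measurableSet ?_)
  exact isOpen_biUnion fun x _ => isOpen_biUnion fun r _ => Metric.isOpen_ball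

end OutwardNormal

/-! ### Hyperplane arrangements and the local structure of polygonal sets -/

section Arrangement
variable {d : ℕ} {K : Set (Sp d)}

/-- A finite family of hyperplanes. -/
def IsArrangement (𝓗 : Finset (Set (Sp d))) : Prop :=
  ∀ H ∈ 𝓗, ∃ n c, ‖n‖ = 1 ∧ H = hyperplane n c

/-- The points lying on two different members of a family of hyperplanes. -/
def crossings (𝓗 : Finset (Set (Sp d))) : Set (Sp d) :=
  ⋃ H ∈ 𝓗, ⋃ H' ∈ 𝓗, ⋃ (_ : H ≠ H'), H ∩ H'

/-- Hyperplanes are collected as sets and not as pairs of a normal and an offset, so that distinct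
members are different hyperplanes and `crossings` is negligible. -/
theorem IsPolygonal.exists_arrangement (hK : IsPolygonal K) :
    ∃ 𝓗 : Finset (Set (Sp d)), IsArrangement 𝓗 ∧ frontier K ⊆ ⋃ H ∈ 𝓗, H := by
  classical
  obtain ⟨S, hS, hsub⟩ := hK.frontier_subset
  refine ⟨S.image fun p => {x | inner ℝ p.1 x = p.2}, ?_, ?_⟩
  · intro H hH
    obtain ⟨p, hp, rfl⟩ := Finset.mem_image.1 hH
    have hp0 : ‖p.1‖ ≠ 0 := norm_ne_zero_iff.2 (hS p hp)
    refine ⟨‖p.1‖⁻¹ • p.1, ‖p.1‖⁻¹ * p.2, by simp [norm_smul, hp0], ?_⟩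
    ext x
    simp [hyperplane, inner_smul_left, hp0]
  · intro x hx
    obtain ⟨p, hp, hx'⟩ := mem_iUnion₂.1 (hsub hx)
    exact mem_iUnion₂_of_mem (Finset.mem_image_of_mem _ hp) hx'

theorem IsArrangement.measure_crossings {𝓗 : Finset (Set (Sp d))} (h : IsArrangement 𝓗) :
    (Measure.euclideanHausdorffMeasure (d - 1) : Measure (Sp d)) (crossings 𝓗) = 0 := by
  refine (measure_biUnion_null_iff 𝓗.countable_toSet).2 fun H hH =>
    (measure_biUnion_null_iff 𝓗.countable_toSet).2 fun H' hH' => ?_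
  refine measure_iUnion_null fun hne => ?_
  obtain ⟨n, c, hn, rfl⟩ := h H hH
  obtain ⟨n', c', hn', rfl⟩ := h H' hH'
  exact euclideanHausdorffMeasure_hyperplane_inter hn hn' hne

theorem IsArrangement.isClosed {𝓗 : Finset (Set (Sp d))} (h : IsArrangement 𝓗) {H : Set (Sp d)}
    (hH : H ∈ 𝓗) : IsClosed H := by
  obtain ⟨n, c, -, rfl⟩ := h H hH
  exact isClosed_hyperplane n c

theorem IsArrangement.volume_eq_zero {𝓗 : Finset (Set (Sp d))} (h : IsArrangement 𝓗)
    {H : Set (Sp d)} (hH : H ∈ 𝓗) : volume H = 0 := by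
  obtain ⟨n, c, hn, rfl⟩ := h H hH
  exact volume_hyperplane (by rintro rfl; simp at hn) c

theorem IsPolygonal.volume_frontier (hK : IsPolygonal K) : volume (frontier K) = 0 := by
  obtain ⟨𝓗, h, hsub⟩ := hK.exists_arrangement
  exact measure_mono_null hsub ((measure_biUnion_null_iff 𝓗.countable_toSet).2
    fun H hH => h.volume_eq_zero hH)

/-- Off the crossings, the indicator function of `K` is locally constant on both sides of the
hyperplane. -/
theorem IsArrangement.exists_half_balls {𝓗 : Finset (Set (Sp d))} (h : IsArrangement 𝓗)
    (hsub : frontier K ⊆ ⋃ H ∈ 𝓗, H) {n : Sp d} {c : ℝ}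
    (hH : hyperplane n c ∈ 𝓗) {x : Sp d} (hx : x ∈ hyperplane n c) (hxc : x ∉ crossings 𝓗) :
    ∃ e₁ e₂ : ℝ, ∃ r > 0, (∀ y ∈ Metric.ball x r, ∀ H' ∈ 𝓗, y ∈ H' → H' = hyperplane n c) ∧
      ∀ y ∈ Metric.ball x r, (inner ℝ n (y - x) < 0 → K.indicator 1 y = e₁) ∧
      (0 < inner ℝ n (y - x) → K.indicator 1 y = e₂) := by
  classical
  have hcl : IsClosed (⋃ H' ∈ 𝓗.filter (· ≠ hyperplane n c), H') :=
    Set.Finite.isClosed_biUnion (Finset.finite_toSet _)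
      fun H' hH' => h.isClosed (Finset.mem_filter.1 hH').1
  have hxn : x ∉ ⋃ H' ∈ 𝓗.filter (· ≠ hyperplane n c), H' := by
    intro hx'
    obtain ⟨H', hH', hxH'⟩ := mem_iUnion₂.1 hx'
    obtain ⟨h1, h2⟩ := Finset.mem_filter.1 hH'
    exact hxc (mem_iUnion₂_of_mem h1 (mem_iUnion₂_of_mem hH (mem_iUnion_of_mem h2 ⟨hxH', hx⟩)))
  obtain ⟨r, hr, hball⟩ := Metric.isOpen_iff.1 hcl.isOpen_compl x hxn
  have honly : ∀ y ∈ Metric.ball x r, ∀ H' ∈ 𝓗, y ∈ H' → H' = hyperplane n c := by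
    intro y hy H' hH' hyH'
    by_contra hne
    exact hball hy (mem_iUnion₂_of_mem (Finset.mem_filter.2 ⟨hH', hne⟩) hyH')
  -- In this ball the frontier can only lie on the given hyperplane, so each open half ball, being
  -- connected, lies inside `K` or outside.
  have key : ∀ A : Set (Sp d), Convex ℝ A → A ⊆ Metric.ball x r → Disjoint A (hyperplane n c) →
      ∃ e : ℝ, ∀ y ∈ A, K.indicator 1 y = e := by
    intro A hA hAb hAd
    have hfr : Disjoint A (frontier K) := by
      refine disjoint_left.2 fun y hy hyf => ?_
      obtain ⟨H', hH', hyH'⟩ := mem_iUnion₂.1 (hsub hyf)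
      exact disjoint_left.1 hAd hy (honly y (hAb hy) H' hH' hyH' ▸ hyH')
    rcases hA.isPreconnected.subset_or_disjoint_of_disjoint_frontier hfr with h1 | h1
    · exact ⟨1, fun y hy => by simp [h1 hy]⟩
    · exact ⟨0, fun y hy => by simp [disjoint_left.1 h1 hy]⟩
  have hlin : IsLinearMap ℝ (fun y : Sp d => inner ℝ n y) :=
    ⟨fun a b => inner_add_right n a b, fun a b => inner_smul_right n b a⟩
  obtain ⟨e₁, he₁⟩ := key (Metric.ball x r ∩ {y | inner ℝ n y < c})
    ((convex_ball x r).inter (convex_halfSpace_lt hlin c)) inter_subset_left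
    (disjoint_left.2 fun y hy hy' => by
      have h1 : inner ℝ n y < c := hy.2
      have h2 : inner ℝ n y = c := hy'
      linarith)
  obtain ⟨e₂, he₂⟩ := key (Metric.ball x r ∩ {y | c < inner ℝ n y})
    ((convex_ball x r).inter (convex_halfSpace_gt hlin c)) inter_subset_left
    (disjoint_left.2 fun y hy hy' => by
      have h1 : c < inner ℝ n y := hy.2
      have h2 : inner ℝ n y = c := hy'
      linarith)
  have hx : inner ℝ n x = c := hx
  refine ⟨e₁, e₂, r, hr, honly, fun y hy => ⟨fun h1 => he₁ y ⟨hy, ?_⟩, fun h1 => he₂ y ⟨hy, ?_⟩⟩⟩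
  · rw [inner_sub_right, hx] at h1; exact sub_neg.1 h1
  · rw [inner_sub_right, hx] at h1; exact sub_pos.1 h1

/-- Cells are not assumed measurable; they differ from their interior by part of a null frontier. -/
theorem IsPolygonal.nullMeasurableSet (hK : IsPolygonal K) :
    NullMeasurableSet K := by
  have h : interior K =ᵐ[volume] K := by
    refine (ae_eq_set).2 ⟨by simp [sdiff_eq_empty.2 interior_subset], ?_⟩
    have hsub : K \ interior K ⊆ frontier K := fun x hx => ⟨subset_closure hx.1, hx.2⟩
    exact measure_mono_null hsub hK.volume_frontier
  exact isOpen_interior.measurableSet.nullMeasurableSet.congr h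

/-- Up to a `(d-1)`-negligible set, a boundary point of a polygonal set either has an outward
normal, or is the centre of a ball contained in the set up to a hyperplane. -/
theorem IsPolygonal.ae_frontier (hK : IsPolygonal K) :
    ∀ᵐ x ∂(Measure.euclideanHausdorffMeasure (d - 1) : Measure (Sp d)), x ∈ frontier K →
      (∃ n, IsOutwardNormal K x n) ∨ ∃ r > 0, Metric.ball x r ⊆ closure (K) := by
  obtain ⟨𝓗, h, hsub⟩ := hK.exists_arrangement
  filter_upwards [compl_mem_ae_iff.2 h.measure_crossings] with x hxc hx
  obtain ⟨H, hH, hxH⟩ := mem_iUnion₂.1 (hsub hx)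
  obtain ⟨n, c, hn, rfl⟩ := h H hH
  obtain ⟨e₁, e₂, r, hr, honly, hb⟩ := h.exists_half_balls hsub hH hxH hxc
  classical
  have val : ∀ y, K.indicator (1 : Sp d → ℝ) y = if y ∈ K then 1 else 0 := fun y => by
    simp [indicator_apply]
  by_cases hout : ∃ n, IsOutwardNormal K x n
  · exact Or.inl hout
  right
  have h0 : outwardNormal K x = 0 := by rw [outwardNormal, dif_neg hout]
  rw [outwardNormal_eq_of_half_balls hn hr hb] at h0
  have hn0 : n ≠ 0 := by rintro rfl; simp at hn
  have he : e₁ = e₂ := by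
    rcases smul_eq_zero.1 h0 with h1 | h1
    · linarith
    · exact absurd h1 hn0
  subst he
  have hall : ∀ y ∈ Metric.ball x r, inner ℝ n (y - x) ≠ 0 → K.indicator (1 : Sp d → ℝ) y = e₁ :=
    fun y hy hne => by
      rcases lt_or_gt_of_ne hne with h1 | h1
      · exact (hb y hy).1 h1
      · exact (hb y hy).2 h1
  -- A nonempty open set has positive volume, so it cannot lie inside the hyperplane.
  have hdense : ∀ U : Set (Sp d), IsOpen U → U.Nonempty → ∃ y ∈ U, inner ℝ n (y - x) ≠ 0 := by
    intro U hU hne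
    by_contra! hcon
    have : U ⊆ hyperplane n c := fun y hy => by
      have h1 := hcon y hy
      rw [inner_sub_right, show inner ℝ n x = c from hxH] at h1
      exact sub_eq_zero.1 h1
    exact (hU.measure_pos volume hne).ne' (measure_mono_null this (volume_hyperplane hn0 c))
  -- Regularity of `K` puts interior points arbitrarily close to `x`, so the common value on the two
  -- sides is `1` and not `0`.
  have hxcl : x ∈ closure (interior K) := closure_minimal hK.regular isClosed_closure hx.1
  obtain ⟨y, hyr, hyK⟩ := mem_closure_iff.1 hxcl _ Metric.isOpen_ball (Metric.mem_ball_self hr)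
  obtain ⟨z, ⟨hz1, hz2⟩, hz3⟩ := hdense (Metric.ball x r ∩ interior K)
    (Metric.isOpen_ball.inter isOpen_interior) ⟨y, hyr, hyK⟩
  have he1 : e₁ = 1 := by
    rw [← hall z hz1 hz3, val, if_pos (interior_subset hz2)]
  refine ⟨r, hr, fun y hy => mem_closure_iff.2 fun U hU hyU => ?_⟩
  obtain ⟨w, ⟨hw1, hw2⟩, hw3⟩ := hdense (U ∩ Metric.ball x r) (hU.inter Metric.isOpen_ball)
    ⟨y, hyU, hy⟩
  refine ⟨w, hw1, ?_⟩
  by_contra hwK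
  have := hall w hw2 hw3
  rw [val, if_neg hwK, he1] at this
  norm_num at this

end Arrangement

/-! ### Surface integrals as limits of integrals over thin layers -/

section Surface
variable {d : ℕ} {K : Set (Sp d)} {n : Sp d}

theorem measure_hyperplane_inter_lt_top (hn : ‖n‖ = 1) (c : ℝ) {B : Set (Sp d)}
    (hB : Bornology.IsBounded B) :
    (Measure.euclideanHausdorffMeasure (d - 1) : Measure (Sp d)) (hyperplane n c ∩ B) < ∞ := by
  have hiso := isometry_hyperplane_param n c
  have hB' : MeasurableSet (closure B) := isClosed_closure.measurableSet
  refine (measure_mono (inter_subset_inter_right _ subset_closure)).trans_lt ?_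
  rw [inter_comm, ← Measure.restrict_apply hB', ← map_hyperplane_param hn c,
    Measure.map_apply hiso.continuous.measurable hB']
  exact (hiso.antilipschitz.isBounded_preimage hB.closure).measure_lt_top

theorem measure_frontier_lt_top (hK : IsPolygonal K) :
    (Measure.euclideanHausdorffMeasure (d - 1) : Measure (Sp d)) (frontier K) < ∞ := by
  obtain ⟨𝓗, h, hsub⟩ := hK.exists_arrangement
  have hb : Bornology.IsBounded (frontier K) := hK.isBounded.closure.subset frontier_subset_closure
  have : frontier K ⊆ ⋃ H ∈ 𝓗, H ∩ frontier K := by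
    intro x hx
    obtain ⟨H, hH, hxH⟩ := mem_iUnion₂.1 (hsub hx)
    exact mem_iUnion₂_of_mem hH ⟨hxH, hx⟩
  refine (measure_mono this).trans_lt ?_
  refine (measure_biUnion_finset_le 𝓗 _).trans_lt (ENNReal.sum_lt_top.2 fun H hH => ?_)
  obtain ⟨n, c, hn, rfl⟩ := h H hH
  exact measure_hyperplane_inter_lt_top hn c hb

/-- Off the crossings the normal on a hyperplane can only be `n`, `-n` or `0`, and the first two
values are taken on measurable sets. -/
theorem IsArrangement.aestronglyMeasurable_outwardNormal {𝓗 : Finset (Set (Sp d))}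
    (h : IsArrangement 𝓗) (hsub : frontier K ⊆ ⋃ H ∈ 𝓗, H) {H : Set (Sp d)} (hH : H ∈ 𝓗) :
    AEStronglyMeasurable (outwardNormal K)
      ((Measure.euclideanHausdorffMeasure (d - 1)).restrict H) := by
  classical
  obtain ⟨n, c, hn, rfl⟩ := h H hH
  have hneg : hyperplane (-n) (-c) = hyperplane n c := by
    ext x; simp [hyperplane, inner_neg_left]
  have m1 := measurableSet_isOutwardNormal K n c
  have m2 := measurableSet_isOutwardNormal K (-n) (-c)
  rw [hneg] at m2
  have hm : StronglyMeasurable fun x =>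
      {x | x ∈ hyperplane n c ∧ IsOutwardNormal K x n}.indicator (fun _ => n) x
      + {x | x ∈ hyperplane n c ∧ IsOutwardNormal K x (-n)}.indicator (fun _ => -n) x :=
    (stronglyMeasurable_const.indicator m1).add (stronglyMeasurable_const.indicator m2)
  refine hm.aestronglyMeasurable.congr ?_
  filter_upwards [ae_restrict_mem (isClosed_hyperplane n c).measurableSet,
    ae_restrict_of_ae (compl_mem_ae_iff.2 h.measure_crossings)] with x hx hxc
  obtain ⟨e₁, e₂, r, hr, -, hb⟩ := h.exists_half_balls hsub hH hx hxc
  have hn0 : n ≠ 0 := by rintro rfl; simp at hn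
  have hnn : n ≠ -n := fun hc => hn0 (by
    have h2 : (2 : ℝ) • n = 0 := by rw [two_smul]; nth_rewrite 2 [hc]; simp
    simpa using h2)
  by_cases h1 : IsOutwardNormal K x n
  · have h2 : ¬ IsOutwardNormal K x (-n) := fun h2 => hnn (h2.unique h1)
    simp [h1, h2, hx, h1.outwardNormal_eq]
  · by_cases h2 : IsOutwardNormal K x (-n)
    · simp [h1, h2, hx, h2.outwardNormal_eq]
    · have h3 : outwardNormal K x = 0 := by
        by_contra h3
        have hex : ∃ n', IsOutwardNormal K x n' := by
          by_contra hex
          exact h3 (by rw [outwardNormal, dif_neg hex])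
        obtain ⟨n', hn'⟩ := hex
        have h4 := hn'.outwardNormal_eq
        rw [outwardNormal_eq_of_half_balls hn hr hb] at h4
        have h5 : ‖(e₁ - e₂) • n‖ = 1 := by rw [h4]; exact hn'.1
        rw [norm_smul, hn, mul_one, Real.norm_eq_abs] at h5
        rcases eq_or_eq_neg_of_abs_eq h5 with h6 | h6
        · rw [h6, one_smul] at h4; exact h1 (h4 ▸ hn')
        · rw [h6, neg_smul, one_smul] at h4; exact h2 (h4 ▸ hn')
      simp [h1, h2, h3]

theorem IsPolygonal.aestronglyMeasurable_outwardNormal (hK : IsPolygonal K) :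
    AEStronglyMeasurable (outwardNormal K)
      ((Measure.euclideanHausdorffMeasure (d - 1)).restrict (frontier K)) := by
  obtain ⟨𝓗, h, hsub⟩ := hK.exists_arrangement
  refine AEStronglyMeasurable.mono_measure ?_ (Measure.restrict_mono hsub le_rfl)
  rw [show (⋃ H ∈ 𝓗, H) = ⋃ H : {H // H ∈ 𝓗}, (H : Set (Sp d)) by ext; simp]
  exact (aestronglyMeasurable_iUnion_iff (s := fun H : {H // H ∈ 𝓗} => (H : Set (Sp d)))).2
    fun H => h.aestronglyMeasurable_outwardNormal hsub H.2

/-- The points at signed height between `0` and `w` over the hyperplane `⟨n, x⟩ = c`. -/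
def slab {d : ℕ} (n : Sp d) (c w : ℝ) : Set (Sp d) := (fun x => inner ℝ n x) ⁻¹' Ioo c (c + w)

theorem measurableSet_slab (n : Sp d) (c w : ℝ) : MeasurableSet (slab n c w) :=
  measurableSet_Ioo.preimage (Continuous.measurable (by fun_prop))

/-- The mass of a thin layer over a hyperplane. -/
theorem tendsto_layer_integral (hn : ‖n‖ = 1) (c : ℝ) {b : ℝ} (hb : 0 ≤ b)
    (F : ℝ → Sp d → ℝ) (G : Sp d → ℝ) (M R : ℝ)
    (hmeas : ∀ s, AEStronglyMeasurable (F s) volume)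
    (hbd : ∀ s ∈ Ioo (0 : ℝ) 1, ∀ x, |F s x| ≤ (Metric.closedBall 0 R).indicator (fun _ => M) x)
    (hlim : ∀ᵐ y ∂((Measure.euclideanHausdorffMeasure (d - 1)).restrict (hyperplane n c)),
      ∀ τ ∈ Ioo 0 b, Tendsto (fun s => F s (y + (s * τ) • n)) (𝓝[>] 0) (𝓝 (G y))) :
    Tendsto (fun s => s⁻¹ * ∫ x in (slab n c (s * b)), F s x)
      (𝓝[>] 0) (𝓝 (b * ∫ y in hyperplane n c, G y ∂(Measure.euclideanHausdorffMeasure (d - 1)))) := by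
  have hIoo : Ioo (0 : ℝ) 1 ∈ 𝓝[>] (0 : ℝ) := Ioo_mem_nhdsGT one_pos
  set μ : Measure ((ℝ ∙ n)ᗮ × ℝ) := volume.prod volume with hμ
  -- Change of variables: the slab of width `s b` becomes the fixed box of heights in `(0, b)`.
  have hmap : ∀ s : ℝ, 0 < s → s⁻¹ *
      ∫ x in (slab n c (s * b)), F s x
      = ∫ p, (Ioo 0 b).indicator (fun _ => F s (layerMap n c s p)) p.2 ∂μ := by
    intro s hs
    have hA := measurableSet_slab n c (s * b)
    rw [← integral_indicator hA]
    have := (measurableEmbedding_layerMap hn c hs.ne').integral_map (μ := μ)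
      ((slab n c (s * b)).indicator (F s))
    rw [map_layerMap hn c hs, integral_smul_measure, ENNReal.toReal_ofReal (by positivity),
      smul_eq_mul] at this
    rw [this]
    refine integral_congr_ae (Eventually.of_forall fun p => ?_)
    beta_reduce
    have hiff : layerMap n c s p ∈ (slab n c (s * b))
        ↔ p.2 ∈ Ioo 0 b := by
      simp only [slab, mem_preimage, inner_layerMap hn, mem_Ioo]
      constructor
      · rintro ⟨h1, h2⟩
        exact ⟨by have : 0 < s * p.2 := by linarith
                  exact (pos_iff_pos_of_mul_pos this).1 hs,
          lt_of_mul_lt_mul_left (by linarith) hs.le⟩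
      · rintro ⟨h1, h2⟩
        have := mul_pos hs h1
        have := mul_lt_mul_of_pos_left h2 hs
        constructor <;> linarith
    by_cases hp : p.2 ∈ Ioo 0 b
    · rw [indicator_of_mem (hiff.2 hp), indicator_of_mem hp]
    · rw [indicator_of_notMem (fun h => hp (hiff.1 h)), indicator_of_notMem hp]
  have hlimit : b * ∫ y in hyperplane n c, G y ∂(Measure.euclideanHausdorffMeasure (d - 1))
      = ∫ p, (Ioo 0 b).indicator (fun _ => G (c • n + (p.1 : Sp d))) p.2 ∂μ := by
    have hemb : MeasurableEmbedding (fun y : (ℝ ∙ n)ᗮ => c • n + (y : Sp d)) :=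
      (isometry_hyperplane_param n c).isClosedEmbedding.measurableEmbedding
    rw [← map_hyperplane_param hn c, hemb.integral_map]
    have := integral_prod_mul (μ := (volume : Measure (ℝ ∙ n)ᗮ)) (ν := (volume : Measure ℝ))
      (fun y => G (c • n + (y : Sp d))) ((Ioo 0 b).indicator 1)
    rw [integral_indicator_one measurableSet_Ioo, Real.volume_real_Ioo_of_le hb, sub_zero,
      mul_comm] at this
    rw [← this]
    refine integral_congr_ae (Eventually.of_forall fun p => ?_)
    by_cases hp : p.2 ∈ Ioo 0 b <;> simp [hp]
  rw [hlimit]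
  have hcongr : (fun s => s⁻¹ * ∫ x in (slab n c (s * b)), F s x)
      =ᶠ[𝓝[>] 0] fun s =>
        ∫ p, (Ioo 0 b).indicator (fun _ => F s (layerMap n c s p)) p.2 ∂μ := by
    filter_upwards [self_mem_nhdsWithin] with s hs using hmap s hs
  refine Tendsto.congr' hcongr.symm ?_
  -- For `s < 1` the point over `p` differs from `p.1` by a vector of norm at most `|c| + b`.
  -- Functions supported in the ball of radius `R` thus pull back into one fixed bounded box.
  refine tendsto_integral_filter_of_dominated_convergence
    ((Metric.closedBall (0 : (ℝ ∙ n)ᗮ) (R + |c| + b) ×ˢ Ioo 0 b).indicator fun _ => |M|) ?_ ?_ ?_ ?_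
  · filter_upwards [self_mem_nhdsWithin] with s hs
    have hs : 0 < s := hs
    have h1 : AEStronglyMeasurable (F s) (Measure.map (layerMap n c s) μ) := by
      rw [map_layerMap hn c hs]
      exact (hmeas s).smul_measure _
    have h2 := h1.comp_measurable (continuous_layerMap n c s).measurable
    have h3 := h2.indicator (s := univ ×ˢ Ioo 0 b) (MeasurableSet.univ.prod measurableSet_Ioo)
    refine h3.congr (Eventually.of_forall fun p => ?_)
    beta_reduce
    by_cases hp : p.2 ∈ Ioo 0 b
    · rw [indicator_of_mem (show p ∈ univ ×ˢ Ioo 0 b from ⟨mem_univ _, hp⟩), indicator_of_mem hp]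
      rfl
    · rw [indicator_of_notMem (fun h : p ∈ univ ×ˢ Ioo 0 b => hp h.2), indicator_of_notMem hp]
  · filter_upwards [hIoo] with s hs
    refine Eventually.of_forall fun p => ?_
    by_cases hp : p.2 ∈ Ioo 0 b
    · rw [indicator_of_mem hp, Real.norm_eq_abs]
      by_cases hp1 : p.1 ∈ Metric.closedBall (0 : (ℝ ∙ n)ᗮ) (R + |c| + b)
      · rw [indicator_of_mem (show p ∈ Metric.closedBall (0 : (ℝ ∙ n)ᗮ) (R + |c| + b) ×ˢ Ioo 0 b from ⟨hp1, hp⟩)]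
        refine (hbd s hs _).trans ?_
        by_cases hx : layerMap n c s p ∈ Metric.closedBall 0 R
        · rw [indicator_of_mem hx]; exact le_abs_self M
        · rw [indicator_of_notMem hx]; exact abs_nonneg M
      · rw [indicator_of_notMem (fun h : p ∈ Metric.closedBall (0 : (ℝ ∙ n)ᗮ) (R + |c| + b) ×ˢ Ioo 0 b =>
          hp1 h.1)]
        refine (hbd s hs _).trans (le_of_eq (indicator_of_notMem (fun hx => hp1 ?_) _))
        rw [mem_closedBall_zero_iff] at hx ⊢
        have h1 : ((p.1 : (ℝ ∙ n)ᗮ) : Sp d) = layerMap n c s p - (c + s * p.2) • n := by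
          simp [layerMap]
        have h2 : ‖(c + s * p.2) • n‖ ≤ |c| + b := by
          rw [norm_smul, hn, mul_one, Real.norm_eq_abs]
          refine (abs_add_le _ _).trans ?_
          have h4 : |s * p.2| ≤ b := by
            rw [abs_of_pos (mul_pos hs.1 hp.1)]
            nlinarith [hs.1, hs.2, hp.1, hp.2]
          linarith
        have h3 : ‖p.1‖ = ‖((p.1 : (ℝ ∙ n)ᗮ) : Sp d)‖ := rfl
        rw [h3, h1]
        refine (norm_sub_le _ _).trans ?_
        linarith
    · rw [indicator_of_notMem hp, norm_zero]
      exact indicator_nonneg (fun _ _ => abs_nonneg M) _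
  · refine (integrable_indicator_iff (Metric.isClosed_closedBall.measurableSet.prod
      measurableSet_Ioo)).2 (integrableOn_const ?_)
    rw [hμ, Measure.prod_prod]
    exact (ENNReal.mul_lt_top Metric.isBounded_closedBall.measure_lt_top (by simp)).ne
  · rw [← map_hyperplane_param hn c] at hlim
    have h1 := ae_of_ae_map (isometry_hyperplane_param n c).continuous.measurable.aemeasurable hlim
    have h2 := Measure.quasiMeasurePreserving_fst (μ := (volume : Measure (ℝ ∙ n)ᗮ))
      (ν := (volume : Measure ℝ)) |>.ae h1
    filter_upwards [h2] with p hp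
    by_cases hp2 : p.2 ∈ Ioo 0 b
    · simp only [indicator_of_mem hp2]
      refine (hp _ hp2).congr fun s => ?_
      congr 1
      simp only [layerMap, add_smul]; abel
    · simp only [indicator_of_notMem hp2]
      exact tendsto_const_nhds

end Surface

/-! ### The divergence theorem on polygonal sets -/

section Divergence
variable {d : ℕ} {K : Set (Sp d)}

/-- The difference quotients of a `C¹` function integrate to the integral of its directional
derivative over a bounded set. -/
theorem tendsto_integral_difference_quotient (hK : IsPolygonal K) {g : Sp d → ℝ}
    (hg : ContDiff ℝ 1 g) (a : Sp d) :
    Tendsto (fun s : ℝ => ∫ x in K, s⁻¹ * (g (x + s • a) - g x)) (𝓝[>] 0)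
      (𝓝 (∫ x in K, fderiv ℝ g x a)) := by
  obtain ⟨R, hR⟩ := hK.isBounded.subset_closedBall 0
  have hcont : Continuous (fun x => ‖fderiv ℝ g x‖) := (hg.continuous_fderiv one_ne_zero).norm
  obtain ⟨C, hC⟩ := (isCompact_closedBall (0 : Sp d) (R + ‖a‖)).bddAbove_image hcont.continuousOn
  have hC' : ∀ x ∈ Metric.closedBall (0 : Sp d) (R + ‖a‖), ‖fderiv ℝ g x‖ ≤ C :=
    fun x hx => hC (mem_image_of_mem _ hx)
  have hvol : volume K ≠ ∞ := hK.isBounded.measure_lt_top.ne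
  -- The mean value inequality on a ball enlarged by `‖a‖` dominates the quotients for `s < 1`.
  refine tendsto_integral_filter_of_dominated_convergence (fun _ => C * ‖a‖) ?_ ?_ ?_ ?_
  · refine Eventually.of_forall fun s => Continuous.aestronglyMeasurable ?_
    have := hg.continuous
    fun_prop
  · filter_upwards [Ioo_mem_nhdsGT (zero_lt_one' ℝ)] with s hs
    rw [ae_restrict_iff'₀ hK.nullMeasurableSet]
    refine Eventually.of_forall fun x hx => ?_
    have hx1 : ‖x‖ ≤ R := by simpa using hR hx
    have hsa : ‖s • a‖ ≤ ‖a‖ := by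
      rw [norm_smul, Real.norm_eq_abs, abs_of_pos hs.1]
      exact mul_le_of_le_one_left (norm_nonneg _) hs.2.le
    have h1 := (convex_closedBall (0 : Sp d) (R + ‖a‖)).norm_image_sub_le_of_norm_fderiv_le
      (f := g) (𝕜 := ℝ) (x := x) (y := x + s • a)
      (fun x _ => (hg.differentiable one_ne_zero).differentiableAt) hC'
      (by rw [mem_closedBall_zero_iff]; linarith [norm_nonneg a])
      (by rw [mem_closedBall_zero_iff]; exact (norm_add_le _ _).trans (by linarith))
    rw [add_sub_cancel_left, norm_smul, Real.norm_of_nonneg hs.1.le] at h1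
    rw [norm_mul, norm_inv, Real.norm_eq_abs, abs_of_pos hs.1, inv_mul_le_iff₀ hs.1]
    linarith
  · exact integrableOn_const hvol
  · refine Eventually.of_forall fun x => ?_
    exact (((hg.differentiable one_ne_zero) x).hasFDerivAt.hasLineDerivAt a).tendsto_slope_zero_right

/-- The number of slabs containing a point. -/
def slabCount {ι : Type*} [Fintype ι] (A : ι → Set (Sp d)) (x : Sp d) : ℝ :=
  ∑ i, (A i).indicator 1 x

theorem slabCount_eq_card {ι : Type*} [Fintype ι] (A : ι → Set (Sp d)) (x : Sp d) :
    ∃ k : ℕ, slabCount A x = k ∧ (k = 0 → ∀ i, x ∉ A i) := by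
  classical
  refine ⟨(Finset.univ.filter fun i => x ∈ A i).card, ?_, ?_⟩
  · rw [slabCount, Finset.card_filter]
    push_cast
    exact Finset.sum_congr rfl fun i _ => by simp [indicator_apply]
  · intro h i hi
    rw [Finset.card_eq_zero, Finset.filter_eq_empty_iff] at h
    exact h (Finset.mem_univ i) hi

theorem abs_inv_slabCount_le {ι : Type*} [Fintype ι] (A : ι → Set (Sp d)) (x : Sp d) :
    |(slabCount A x)⁻¹| ≤ 1 := by
  obtain ⟨k, hk, -⟩ := slabCount_eq_card A x
  rw [hk, abs_of_nonneg (by positivity)]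
  exact Nat.cast_inv_le_one k

/-- The weights `1 / slabCount` form a partition of unity on the union of the slabs, so overlaps are
not counted twice. -/
theorem sum_slab_eq {ι : Type*} [Fintype ι] (A : ι → Set (Sp d)) (x : Sp d) {y : ℝ}
    (h : (∀ i, x ∉ A i) → y = 0) :
    y = ∑ i, (A i).indicator (fun x => y * (slabCount A x)⁻¹) x := by
  obtain ⟨k, hk, hk0⟩ := slabCount_eq_card A x
  have h1 : ∑ i, (A i).indicator (fun x => y * (slabCount A x)⁻¹) x
      = y * (slabCount A x)⁻¹ * slabCount A x := by
    have h2 : ∀ i, (A i).indicator (fun x => y * (slabCount A x)⁻¹) x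
        = y * (slabCount A x)⁻¹ * (A i).indicator 1 x := fun i => by
      by_cases hi : x ∈ A i
      · rw [indicator_of_mem hi, indicator_of_mem hi, Pi.one_apply, mul_one]
      · rw [indicator_of_notMem hi, indicator_of_notMem hi, mul_zero]
    rw [Finset.sum_congr rfl fun i _ => h2 i, ← Finset.mul_sum]
    rfl
  rw [h1]
  rcases Nat.eq_zero_or_pos k with h0 | h0
  · rw [h (hk0 h0)]; simp
  · have : slabCount A x ≠ 0 := by rw [hk]; positivity
    field_simp

theorem measurable_slabCount {ι : Type*} [Fintype ι] {A : ι → Set (Sp d)}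
    (hA : ∀ i, MeasurableSet (A i)) : Measurable (slabCount A) :=
  Finset.measurable_sum _ fun i _ => measurable_one.indicator (hA i)

/-- If the segment from `x - s a` to `x` does not cross any of the hyperplanes, then its endpoints
lie on the same side of `K`. -/
theorem indicator_sub_eq_of_notMem_slab {ι : Type*} {n : ι → Sp d} {c : ι → ℝ}
    (hsub : frontier K ⊆ ⋃ i, hyperplane (n i) (c i)) {a : Sp d} (ha : ∀ i, 0 ≤ inner ℝ (n i) a)
    {s : ℝ} (hs : 0 < s) {x : Sp d} (hx : ∀ i, x ∉ slab (n i) (c i) (s * inner ℝ (n i) a))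
    (h1 : ∀ i, inner ℝ (n i) x ≠ c i) (h2 : ∀ i, inner ℝ (n i) x ≠ c i + s * inner ℝ (n i) a) :
    K.indicator (1 : Sp d → ℝ) (x - s • a) = K.indicator 1 x := by
  have hd : Disjoint (segment ℝ (x - s • a) x) (frontier K) := by
    refine disjoint_left.2 fun z hz hzf => ?_
    obtain ⟨i, hi⟩ := mem_iUnion.1 (hsub hzf)
    have hi : inner ℝ (n i) z = c i := hi
    obtain ⟨α, β, hα, hβ, hαβ, rfl⟩ := hz
    have e : inner ℝ (n i) (α • (x - s • a) + β • x)
        = inner ℝ (n i) x - α * (s * inner ℝ (n i) a) := by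
      rw [inner_add_right, inner_smul_right, inner_sub_right, inner_smul_right, inner_smul_right]
      linear_combination (inner ℝ (n i) x) * hαβ
    rw [e] at hi
    have h3 := mul_nonneg hs.le (ha i)
    have h4 : α * (s * inner ℝ (n i) a) ≤ s * inner ℝ (n i) a :=
      mul_le_of_le_one_left h3 (by linarith)
    have h5 := mul_nonneg hα h3
    exact hx i ⟨lt_of_le_of_ne (by linarith) (h1 i).symm, lt_of_le_of_ne (by linarith) (h2 i)⟩
  have hl := left_mem_segment ℝ (x - s • a) x
  have hr := right_mem_segment ℝ (x - s • a) x
  rcases (convex_segment (𝕜 := ℝ) (x - s • a) x).isPreconnected.subset_or_disjoint_of_disjoint_frontier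
    hd with h | h
  · rw [indicator_of_mem (h hl), indicator_of_mem (h hr)]; simp
  · rw [indicator_of_notMem (disjoint_left.1 h hl), indicator_of_notMem (disjoint_left.1 h hr)]

/-- A finite family of distinct hyperplanes, oriented by a vector, containing the boundary of a
polygonal set. -/
theorem IsPolygonal.exists_oriented (hK : IsPolygonal K) (a : Sp d) :
    ∃ (𝓗 : Finset (Set (Sp d))) (n : 𝓗 → Sp d) (c : 𝓗 → ℝ), IsArrangement 𝓗 ∧
      frontier K ⊆ ⋃ H ∈ 𝓗, H ∧ ∀ H, ‖n H‖ = 1 ∧ (H : Set (Sp d)) = hyperplane (n H) (c H) ∧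
        0 ≤ inner ℝ (n H) a := by
  obtain ⟨𝓗, h, hsub⟩ := hK.exists_arrangement
  have : ∀ H : 𝓗, ∃ n c, ‖n‖ = 1 ∧ (H : Set (Sp d)) = hyperplane n c ∧ 0 ≤ inner ℝ n a := by
    rintro ⟨H, hH⟩
    obtain ⟨n, c, hn, rfl⟩ := h H hH
    rcases le_total 0 (inner ℝ n a) with h0 | h0
    · exact ⟨n, c, hn, rfl, h0⟩
    · refine ⟨-n, -c, by simpa, ?_, by rw [inner_neg_left]; linarith⟩
      ext x; simp [hyperplane, inner_neg_left]
  choose n c hnc using this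
  exact ⟨𝓗, n, c, h, hsub, hnc⟩

theorem outwardNormal_eq_zero_of_notMem_frontier {x : Sp d} (hx : x ∉ frontier K) :
    outwardNormal K x = 0 := by
  rw [outwardNormal, dif_neg]
  rintro ⟨n, hn⟩
  exact hx hn.mem_frontier

/-- The divergence theorem on polygonal sets, for one component. -/
theorem IsPolygonal.integral_fderiv (hK : IsPolygonal K) {g : Sp d → ℝ} (hg : ContDiff ℝ 1 g)
    (a : Sp d) :
    ∫ x in K, fderiv ℝ g x a = ∫ x in frontier K, g x * inner ℝ (outwardNormal K x) a
      ∂(Measure.euclideanHausdorffMeasure (d - 1)) := by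
  classical
  obtain ⟨𝓗, n, c, h𝓗, hsub, hnc⟩ := hK.exists_oriented a
  have hn := fun H => (hnc H).1
  have hH := fun H => (hnc H).2.1
  have ha := fun H => (hnc H).2.2
  have hn0 : ∀ H, n H ≠ 0 := fun H h0 => by have := hn H; rw [h0] at this; simp at this
  have hsub' : frontier K ⊆ ⋃ H : 𝓗, (H : Set (Sp d)) := by
    refine hsub.trans fun x hx => ?_
    obtain ⟨H, hH, hx⟩ := mem_iUnion₂.1 hx
    exact mem_iUnion.2 ⟨⟨H, hH⟩, hx⟩
  have hsub2 : frontier K ⊆ ⋃ H, hyperplane (n H) (c H) := by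
    simpa only [← hH] using hsub'
  obtain ⟨R₀, hR₀⟩ := hK.isBounded.subset_closedBall 0
  set R := R₀ + ‖a‖ with hR
  obtain ⟨M, hM⟩ := (isCompact_closedBall (0 : Sp d) R).bddAbove_image
    hg.continuous.abs.continuousOn
  have hM' : ∀ x ∈ Metric.closedBall (0 : Sp d) R, |g x| ≤ M :=
    fun x hx => hM (mem_image_of_mem _ hx)
  set χ : Sp d → ℝ := K.indicator 1 with hχ
  -- `s⁻¹ F s` is the difference quotient of the indicator function of `K`, tested against `g`. A
  -- translation moves it onto `g` (`hleft`), while its support shrinks to the boundary (`hright`).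
  set F : ℝ → Sp d → ℝ := fun s x => (χ (x - s • a) - χ x) * g x with hF
  set A : ℝ → 𝓗 → Set (Sp d) := fun s H => slab (n H) (c H) (s * inner ℝ (n H) a) with hA
  have hAm : ∀ s H, MeasurableSet (A s H) := fun s H => measurableSet_slab _ _ _
  have hχm : AEStronglyMeasurable χ volume :=
    aestronglyMeasurable_one.indicator₀ hK.nullMeasurableSet
  have hFm : ∀ s, AEStronglyMeasurable (F s) volume := fun s =>
    ((hχm.comp_measurePreserving (measurePreserving_sub_right volume (s • a))).sub hχm).mul
      hg.continuous.aestronglyMeasurable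
  have hFwm : ∀ s, AEStronglyMeasurable (fun x => F s x * (slabCount (A s) x)⁻¹) volume :=
    fun s => (hFm s).mul (measurable_slabCount (hAm s)).inv.aestronglyMeasurable
  have hFbd : ∀ s ∈ Ioo (0 : ℝ) 1, ∀ x,
      |F s x| ≤ (Metric.closedBall 0 R).indicator (fun _ => M) x := by
    intro s hs x
    have hχ01 : ∀ y, 0 ≤ χ y ∧ χ y ≤ 1 := fun y => by
      by_cases hy : y ∈ K <;> simp [hχ, hy]
    by_cases hx : x ∈ Metric.closedBall 0 R
    · rw [indicator_of_mem hx, hF]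
      simp only [abs_mul]
      have h1 : |χ (x - s • a) - χ x| ≤ 1 := by
        rw [abs_le]; constructor <;> linarith [hχ01 (x - s • a), hχ01 x]
      calc |χ (x - s • a) - χ x| * |g x| ≤ 1 * |g x| := by gcongr
        _ ≤ M := by rw [one_mul]; exact hM' x hx
    · rw [indicator_of_notMem hx]
      have hx' : R < ‖x‖ := by simpa using hx
      have h1 : x ∉ K := fun h => by
        have := hR₀ h; rw [mem_closedBall_zero_iff] at this; linarith [norm_nonneg a]
      have h2 : x - s • a ∉ K := fun h => by
        have := hR₀ h; rw [mem_closedBall_zero_iff] at this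
        have h3 : ‖s • a‖ ≤ ‖a‖ := by
          rw [norm_smul, Real.norm_eq_abs, abs_of_pos hs.1]
          exact mul_le_of_le_one_left (norm_nonneg _) hs.2.le
        have h4 : ‖x‖ ≤ ‖x - s • a‖ + ‖s • a‖ := by
          simpa using norm_add_le (x - s • a) (s • a)
        linarith
      simp [hF, hχ, h1, h2]
  have hFwbd : ∀ s ∈ Ioo (0 : ℝ) 1, ∀ x, |F s x * (slabCount (A s) x)⁻¹|
      ≤ (Metric.closedBall 0 R).indicator (fun _ => M) x := by
    intro s hs x
    rw [abs_mul]
    exact (mul_le_of_le_one_right (abs_nonneg _) (abs_inv_slabCount_le _ _)).trans (hFbd s hs x)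
  have hMint : Integrable ((Metric.closedBall (0 : Sp d) R).indicator fun _ => M) volume :=
    (integrable_indicator_iff Metric.isClosed_closedBall.measurableSet).2
      (integrableOn_const Metric.isBounded_closedBall.measure_lt_top.ne)
  have hFint : ∀ s ∈ Ioo (0 : ℝ) 1, Integrable (F s) volume := fun s hs =>
    hMint.mono' (hFm s) (Eventually.of_forall (hFbd s hs))
  have hFwint : ∀ s ∈ Ioo (0 : ℝ) 1,
      Integrable (fun x => F s x * (slabCount (A s) x)⁻¹) volume := fun s hs =>
    hMint.mono' (hFwm s) (Eventually.of_forall (hFwbd s hs))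
  have hgloc : ∀ y : Sp d, Integrable (fun x => χ x * g (x + y)) volume := by
    intro y
    have h1 : IntegrableOn (fun x => g (x + y)) (Metric.closedBall 0 R₀) :=
      (hg.continuous.comp (continuous_add_const y)).continuousOn.integrableOn_compact
        (isCompact_closedBall _ _)
    refine ((h1.mono_set hR₀).integrable_indicator₀ hK.nullMeasurableSet).congr
      (Eventually.of_forall fun x => ?_)
    by_cases hx : x ∈ K <;> simp [hχ, hx]
  have hleft : ∀ s : ℝ, s⁻¹ * ∫ x, F s x = ∫ x in K, s⁻¹ * (g (x + s • a) - g x) := by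
    intro s
    have h1 : Integrable (fun x => χ (x - s • a) * g x) volume := by
      have := (hgloc (s • a)).comp_sub_right (s • a)
      simpa using this
    have h2 : Integrable (fun x => χ x * g x) volume := by simpa using hgloc 0
    have h3 : ∫ x, F s x = (∫ x, χ (x - s • a) * g x) - ∫ x, χ x * g x := by
      rw [← integral_sub h1 h2]
      exact integral_congr_ae (Eventually.of_forall fun x => by simp only [hF]; ring)
    have h4 : ∫ x, χ (x - s • a) * g x = ∫ x, χ x * g (x + s • a) := by
      have := integral_sub_right_eq_self (μ := (volume : Measure (Sp d)))
        (fun x => χ x * g (x + s • a)) (s • a)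
      simpa using this
    rw [h3, h4, ← integral_sub (hgloc _) h2, ← integral_indicator₀ hK.nullMeasurableSet,
      ← integral_const_mul]
    refine integral_congr_ae (Eventually.of_forall fun x => ?_)
    by_cases hx : x ∈ K <;> simp [hχ, hx]
  -- Outside all slabs the segment from `x - s a` to `x` crosses no hyperplane, so `F s` vanishes
  -- there almost everywhere.
  have hright : ∀ s ∈ Ioo (0 : ℝ) 1, s⁻¹ * ∫ x, F s x
      = ∑ H, s⁻¹ * ∫ x in A s H, F s x * (slabCount (A s) x)⁻¹ := by
    intro s hs
    have h1 : ∀ᵐ x : Sp d, ∀ H, inner ℝ (n H) x ≠ c H := ae_all_iff.2 fun H =>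
      compl_mem_ae_iff.2 (volume_hyperplane (hn0 H) (c H))
    have h2 : ∀ᵐ x : Sp d, ∀ H, inner ℝ (n H) x ≠ c H + s * inner ℝ (n H) a :=
      ae_all_iff.2 fun H => compl_mem_ae_iff.2 (volume_hyperplane (hn0 H) _)
    have h3 : ∫ x, F s x = ∫ x, ∑ H, (A s H).indicator
        (fun x => F s x * (slabCount (A s) x)⁻¹) x := by
      refine integral_congr_ae ?_
      filter_upwards [h1, h2] with x hx1 hx2
      have hz : (∀ H, x ∉ A s H) → F s x = 0 := fun hx => by
        have : χ (x - s • a) = χ x :=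
          indicator_sub_eq_of_notMem_slab hsub2 ha hs.1 hx hx1 hx2
        simp [hF, this]
      have := sum_slab_eq (A s) x hz
      rw [this]
      refine Finset.sum_congr rfl fun H _ => ?_
      by_cases hxH : x ∈ A s H
      · rw [indicator_of_mem hxH, indicator_of_mem hxH]
      · rw [indicator_of_notMem hxH, indicator_of_notMem hxH]
    rw [h3, integral_finsetSum _ fun H _ => (hFwint s hs).indicator (hAm s H), Finset.mul_sum]
    exact Finset.sum_congr rfl fun H _ => by rw [integral_indicator (hAm s H)]
  have hlim : ∀ H : 𝓗, Tendsto (fun s => s⁻¹ * ∫ x in A s H, F s x * (slabCount (A s) x)⁻¹)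
      (𝓝[>] 0) (𝓝 (inner ℝ (n H) a * ∫ y in hyperplane (n H) (c H),
        g y * inner ℝ (outwardNormal K y) (n H) ∂(Measure.euclideanHausdorffMeasure (d - 1)))) := by
    intro H
    refine tendsto_layer_integral (hn H) (c H) (ha H)
      (fun s x => F s x * (slabCount (A s) x)⁻¹)
      (fun y => g y * inner ℝ (outwardNormal K y) (n H)) M R hFwm hFwbd ?_
    filter_upwards [ae_restrict_mem (isClosed_hyperplane (n H) (c H)).measurableSet,
      ae_restrict_of_ae (compl_mem_ae_iff.2 h𝓗.measure_crossings)] with y hy hyc τ hτ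
    obtain ⟨e₁, e₂, r, hr, honly, hb⟩ := h𝓗.exists_half_balls hsub
      (show hyperplane (n H) (c H) ∈ 𝓗 from hH H ▸ H.2) hy hyc
    rw [outwardNormal_eq_of_half_balls (hn H) hr hb, real_inner_smul_left,
      real_inner_self_eq_norm_sq, hn H]
    have hlim1 : Tendsto (fun s : ℝ => y + (s * τ) • n H) (𝓝[>] 0) (𝓝 y) := by
      have : Continuous (fun s : ℝ => y + (s * τ) • n H) := by fun_prop
      have h0 := this.tendsto 0
      simp only [zero_mul, zero_smul, add_zero] at h0
      exact h0.mono_left nhdsWithin_le_nhds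
    have hlim2 : Tendsto (fun s : ℝ => y + (s * τ) • n H - s • a) (𝓝[>] 0) (𝓝 y) := by
      have : Continuous (fun s : ℝ => y + (s * τ) • n H - s • a) := by fun_prop
      have h0 := this.tendsto 0
      simp only [zero_mul, zero_smul, add_zero, sub_zero] at h0
      exact h0.mono_left nhdsWithin_le_nhds
    -- Since `0 < τ < ⟨n H, a⟩`, the points `x` and `x - s a` lie on the two sides of `H`, where the
    -- indicator has the values `e₂` and `e₁`. For small `s` no other slab contains `x`, so the
    -- weight is `1`.
    have hev : ∀ᶠ s in 𝓝[>] (0 : ℝ), (e₁ - e₂) * g (y + (s * τ) • n H)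
        = F s (y + (s * τ) • n H) * (slabCount (A s) (y + (s * τ) • n H))⁻¹ := by
      filter_upwards [hlim1.eventually (Metric.ball_mem_nhds y hr),
        hlim2.eventually (Metric.ball_mem_nhds y hr), self_mem_nhdsWithin] with s hs1 hs2 hs
      have hs : 0 < s := hs
      set x := y + (s * τ) • n H with hx
      have hyc : inner ℝ (n H) y = c H := hy
      have hix : inner ℝ (n H) x = c H + s * τ := by
        rw [hx, inner_add_right, inner_smul_right, real_inner_self_eq_norm_sq, hn H, hyc]; ring
      have hsτ : 0 < s * τ := mul_pos hs hτ.1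
      have hsb : s * τ < s * inner ℝ (n H) a := mul_lt_mul_of_pos_left hτ.2 hs
      have hχx : χ x = e₂ := (hb x hs1).2 (by rw [inner_sub_right, hix, hyc]; linarith)
      have hχx' : χ (x - s • a) = e₁ := (hb _ hs2).1 (by
        rw [inner_sub_right, inner_sub_right, hix, hyc, inner_smul_right]; linarith)
      have hcount : slabCount (A s) x = 1 := by
        rw [slabCount, Finset.sum_eq_single H]
        · exact indicator_of_mem (show x ∈ A s H from
            ⟨show c H < inner ℝ (n H) x by rw [hix]; linarith,
              show inner ℝ (n H) x < c H + s * inner ℝ (n H) a by rw [hix]; linarith⟩) _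
        · intro H' _ hne
          refine indicator_of_notMem (fun hmem => hne ?_) _
          obtain ⟨hm1, hm2⟩ : c H' < inner ℝ (n H') x ∧
            inner ℝ (n H') x < c H' + s * inner ℝ (n H') a := hmem
          set D := s * inner ℝ (n H') a with hD
          have hDpos : 0 < D := by linarith
          -- The parameter at which the segment from `x` to `x - s a` meets `H'`. This point is in
          -- the ball, where only `H` occurs.
          set θ := (inner ℝ (n H') x - c H') / D with hθ
          have hθ0 : 0 ≤ θ := div_nonneg (by linarith) hDpos.le
          have hθ1 : θ ≤ 1 := (div_le_one hDpos).2 (by linarith)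
          have hz := (convex_ball y r) hs1 hs2 (sub_nonneg.2 hθ1) hθ0 (by ring)
          have hzH : (1 - θ) • x + θ • (x - s • a) ∈ (H' : Set (Sp d)) := by
            rw [hH H']
            show inner ℝ (n H') _ = c H'
            rw [inner_add_right, inner_smul_right, inner_smul_right, inner_sub_right,
              inner_smul_right, ← hD]
            have : θ * D = inner ℝ (n H') x - c H' := div_mul_cancel₀ _ hDpos.ne'
            linear_combination -this
          have := honly _ hz H' H'.2 hzH
          exact Subtype.ext (this.trans (hH H).symm)
        · simp
      simp only [hF, hcount, hχx, hχx']
      simp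
    refine Tendsto.congr' hev ?_
    have := ((hg.continuous.tendsto y).comp hlim1).const_mul (e₁ - e₂)
    convert this using 2
    simp; ring
  -- Off the crossings the outward normal is a multiple of the unit vector `n H`, so its product
  -- with `a` factors through `n H`.
  have hident : ∀ H : 𝓗, inner ℝ (n H) a * ∫ y in hyperplane (n H) (c H),
        g y * inner ℝ (outwardNormal K y) (n H) ∂(Measure.euclideanHausdorffMeasure (d - 1))
      = ∫ y in (H : Set (Sp d)), g y * inner ℝ (outwardNormal K y) a
        ∂(Measure.euclideanHausdorffMeasure (d - 1)) := by
    intro H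
    rw [← integral_const_mul, hH H]
    refine integral_congr_ae ?_
    filter_upwards [ae_restrict_mem (isClosed_hyperplane (n H) (c H)).measurableSet,
      ae_restrict_of_ae (compl_mem_ae_iff.2 h𝓗.measure_crossings)] with y hy hyc
    obtain ⟨e₁, e₂, r, hr, honly, hb⟩ := h𝓗.exists_half_balls hsub
      (show hyperplane (n H) (c H) ∈ 𝓗 from hH H ▸ H.2) hy hyc
    rw [outwardNormal_eq_of_half_balls (hn H) hr hb, real_inner_smul_left, real_inner_smul_left,
      real_inner_self_eq_norm_sq, hn H]
    ring
  have hfin : ∀ H : 𝓗, IntegrableOn (fun y => g y * inner ℝ (outwardNormal K y) a)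
      (H : Set (Sp d)) (Measure.euclideanHausdorffMeasure (d - 1)) := by
    intro H
    have hmeas : AEStronglyMeasurable (fun y => g y * inner ℝ (outwardNormal K y) a)
        ((Measure.euclideanHausdorffMeasure (d - 1)).restrict (H : Set (Sp d))) :=
      hg.continuous.aestronglyMeasurable.mul
        ((h𝓗.aestronglyMeasurable_outwardNormal hsub H.2).inner aestronglyMeasurable_const)
    have hbint : Integrable ((Metric.closedBall (0 : Sp d) R).indicator fun _ => M * ‖a‖)
        ((Measure.euclideanHausdorffMeasure (d - 1)).restrict (H : Set (Sp d))) := by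
      refine (integrable_indicator_iff Metric.isClosed_closedBall.measurableSet).2
        (integrableOn_const ?_)
      rw [Measure.restrict_apply Metric.isClosed_closedBall.measurableSet, inter_comm, hH H]
      exact (measure_hyperplane_inter_lt_top (hn H) _ Metric.isBounded_closedBall).ne
    refine hbint.mono' hmeas (Eventually.of_forall fun y => ?_)
    by_cases hy : y ∈ Metric.closedBall 0 R
    · rw [indicator_of_mem hy, norm_mul, Real.norm_eq_abs]
      have h1 : ‖inner ℝ (outwardNormal K y) a‖ ≤ ‖a‖ :=
        (norm_inner_le_norm _ _).trans
          (mul_le_of_le_one_left (norm_nonneg _) (norm_outwardNormal_le K y))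
      exact mul_le_mul (hM' y hy) h1 (norm_nonneg _) ((abs_nonneg _).trans (hM' y hy))
    · rw [indicator_of_notMem hy, outwardNormal_eq_zero_of_notMem_frontier]
      · simp
      · intro hyf
        have h1 : closure K ⊆ Metric.closedBall 0 R₀ :=
          closure_minimal hR₀ Metric.isClosed_closedBall
        exact hy (Metric.closedBall_subset_closedBall (by rw [hR]; linarith [norm_nonneg a])
          (h1 hyf.1))
  have hunion : ∫ x in frontier K, g x * inner ℝ (outwardNormal K x) a
      ∂(Measure.euclideanHausdorffMeasure (d - 1))
      = ∑ H : 𝓗, ∫ y in (H : Set (Sp d)), g y * inner ℝ (outwardNormal K y) a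
        ∂(Measure.euclideanHausdorffMeasure (d - 1)) := by
    have h1 : ∫ x in frontier K, g x * inner ℝ (outwardNormal K x) a
        ∂(Measure.euclideanHausdorffMeasure (d - 1))
        = ∫ x in ⋃ H : 𝓗, (H : Set (Sp d)), g x * inner ℝ (outwardNormal K x) a
          ∂(Measure.euclideanHausdorffMeasure (d - 1)) := by
      refine (setIntegral_eq_of_subset_of_forall_sdiff_eq_zero
        (MeasurableSet.iUnion fun H => (h𝓗.isClosed H.2).measurableSet) hsub' fun x hx => ?_).symm
      rw [outwardNormal_eq_zero_of_notMem_frontier hx.2]; simp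
    rw [h1, integral_iUnion_ae (fun H => (h𝓗.isClosed H.2).measurableSet.nullMeasurableSet) ?_
      (integrableOn_finite_iUnion.2 hfin), tsum_fintype]
    · intro H H' hne
      refine measure_mono_null ?_ h𝓗.measure_crossings
      exact fun x hx => mem_iUnion₂_of_mem H.2 (mem_iUnion₂_of_mem H'.2
        (mem_iUnion_of_mem (fun h => hne (Subtype.ext h)) hx))
  rw [hunion]
  refine tendsto_nhds_unique (tendsto_integral_difference_quotient hK hg a) ?_
  have hsum := tendsto_finsetSum Finset.univ fun H _ => hlim H
  simp only [hident] at hsum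
  refine hsum.congr' ?_
  filter_upwards [Ioo_mem_nhdsGT (zero_lt_one' ℝ)] with s hs
  rw [← hright s hs, hleft]

end Divergence

/-! ### Zero total flux, finiteness properties of the mesh, interfaces -/

section Mesh
variable {d : ℕ} {K L : Set (Sp d)} {𝒯 : Set (Set (Sp d))} {α : ℝ}

/-- A divergence-free field has zero total flux through the boundary of a polygonal set. -/
theorem IsPolygonal.integral_flux_eq_zero (hK : IsPolygonal K) {w : Sp d → Sp d}
    (hw : ContDiff ℝ 1 w) (hdiv : ∀ x, divergence w x = 0) :
    ∫ x in frontier K, inner ℝ (w x) (outwardNormal K x)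
      ∂(Measure.euclideanHausdorffMeasure (d - 1)) = 0 := by
  have hwi : ∀ i, ContDiff ℝ 1 fun x => w x i := fun i =>
    (EuclideanSpace.proj (𝕜 := ℝ) i).contDiff.comp hw
  have hcomp := fun i => hK.integral_fderiv (hwi i) (EuclideanSpace.single i 1)
  have hfd : ∀ i x, fderiv ℝ (fun x => w x i) x (EuclideanSpace.single i 1)
      = fderiv ℝ w x (EuclideanSpace.single i 1) i := by
    intro i x
    set pr : Sp d →L[ℝ] ℝ := EuclideanSpace.proj i
    have h1 : HasFDerivAt (fun x => w x i) (pr.comp (fderiv ℝ w x)) x :=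
      pr.hasFDerivAt.comp x ((hw.differentiable one_ne_zero) x).hasFDerivAt
    rw [h1.fderiv]; rfl
  obtain ⟨R, hR⟩ := hK.isBounded.subset_closedBall 0
  have hcl : closure K ⊆ Metric.closedBall 0 R := closure_minimal hR Metric.isClosed_closedBall
  have : IsFiniteMeasure
      ((Measure.euclideanHausdorffMeasure (d - 1)).restrict (frontier K)) :=
    ⟨by rw [Measure.restrict_apply_univ]; exact measure_frontier_lt_top hK⟩
  have hint : ∀ i, Integrable (fun x => w x i * inner ℝ (outwardNormal K x) (EuclideanSpace.single i 1))
      ((Measure.euclideanHausdorffMeasure (d - 1)).restrict (frontier K)) := by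
    intro i
    obtain ⟨M, hM⟩ := (isCompact_closedBall (0 : Sp d) R).bddAbove_image
      (hwi i).continuous.abs.continuousOn
    have hM' : ∀ x ∈ Metric.closedBall (0 : Sp d) R, |w x i| ≤ M :=
      fun x hx => hM (mem_image_of_mem _ hx)
    refine Integrable.of_bound ((hwi i).continuous.aestronglyMeasurable.mul
      (hK.aestronglyMeasurable_outwardNormal.inner aestronglyMeasurable_const)) M ?_
    filter_upwards [ae_restrict_mem isClosed_frontier.measurableSet] with x hx
    rw [norm_mul, Real.norm_eq_abs]
    have h1 : ‖inner ℝ (outwardNormal K x) (EuclideanSpace.single i (1 : ℝ))‖ ≤ 1 :=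
      (norm_inner_le_norm _ _).trans (by simpa using norm_outwardNormal_le K x)
    exact (mul_le_of_le_one_right (abs_nonneg _) h1).trans (hM' x (hcl hx.1))
  have hint2 : ∀ i, IntegrableOn (fun x => fderiv ℝ (fun x => w x i) x (EuclideanSpace.single i 1)) K :=
    fun i => ((((hwi i).continuous_fderiv one_ne_zero).clm_apply
      continuous_const).continuousOn.integrableOn_compact (isCompact_closedBall 0 R)).mono_set hR
  have e1 : ∀ x, inner ℝ (w x) (outwardNormal K x)
      = ∑ i, w x i * inner ℝ (outwardNormal K x) (EuclideanSpace.single i 1) := by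
    intro x
    rw [PiLp.inner_apply]
    refine Finset.sum_congr rfl fun i _ => ?_
    simp [EuclideanSpace.inner_single_right]
    ring
  simp only [e1]
  rw [integral_finsetSum _ fun i _ => hint i, ← Finset.sum_congr rfl fun i _ => hcomp i,
    ← integral_finsetSum _ fun i _ => hint2 i]
  have e2 : ∀ x, ∑ i, fderiv ℝ (fun x => w x i) x (EuclideanSpace.single i 1) = 0 := fun x => by
    simp only [hfd]; exact hdiv x
  simp [e2]

theorem IsAdmissibleMesh.nonempty (h : IsAdmissibleMesh 𝒯 α) : 𝒯.Nonempty := by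
  by_contra hne
  rw [not_nonempty_iff_eq_empty] at hne
  have := h.covers
  rw [hne] at this
  simp only [mem_empty_iff_false, iUnion_of_empty, iUnion_empty] at this
  exact absurd (this ▸ mem_univ (0 : Sp d)) (notMem_empty _)

theorem IsAdmissibleMesh.diam_le (h : IsAdmissibleMesh 𝒯 α) (hK : K ∈ 𝒯) :
    Metric.diam K ≤ meshSize 𝒯 :=
  le_csSup h.bddAbove_diam (mem_image_of_mem _ hK)

/-- In positive dimension a nonempty open set has more than one point. -/
theorem IsAdmissibleMesh.meshSize_pos (h : IsAdmissibleMesh 𝒯 α) (hd : 1 ≤ d) :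
    0 < meshSize 𝒯 := by
  obtain ⟨K, hK⟩ := h.nonempty
  refine lt_of_lt_of_le ?_ (h.diam_le hK)
  obtain ⟨x, hx⟩ := (h.polygonal K hK).interior_nonempty
  have : Nonempty (Fin d) := ⟨⟨0, hd⟩⟩
  have : Nontrivial (Sp d) := inferInstance
  have hnt : (interior K).Nontrivial := by
    by_contra hnt
    have hs : (interior K).Subsingleton := not_nontrivial_iff.1 hnt
    have : interior K = {x} := hs.eq_singleton_of_mem hx
    have h1 : IsOpen ({x} : Set (Sp d)) := this ▸ isOpen_interior
    exact not_isOpen_singleton x h1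
  exact Metric.diam_pos (hnt.mono interior_subset) (h.polygonal K hK).isBounded

theorem IsAdmissibleMesh.le_volume_real (h : IsAdmissibleMesh 𝒯 α) (hK : K ∈ 𝒯) :
    α * meshSize 𝒯 ^ d ≤ volume.real K :=
  (ENNReal.ofReal_le_iff_le_toReal (h.polygonal K hK).isBounded.measure_lt_top.ne).1
    (h.volume_ge K hK)

theorem IsAdmissibleMesh.volume_real_pos (h : IsAdmissibleMesh 𝒯 α) (hd : 1 ≤ d) (hα : 0 < α)
    (hK : K ∈ 𝒯) : 0 < volume.real K := by
  have := h.meshSize_pos hd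
  exact lt_of_lt_of_le (by positivity) (h.le_volume_real hK)

theorem IsAdmissibleMesh.disjoint_of_ne (h : IsAdmissibleMesh 𝒯 α) (hK : K ∈ 𝒯) (hL : L ∈ 𝒯)
    (hne : K ≠ L) : Disjoint K L := h.disjoint hK hL hne

theorem IsAdmissibleMesh.disjoint_interior_closure (h : IsAdmissibleMesh 𝒯 α) (hK : K ∈ 𝒯)
    (hL : L ∈ 𝒯) (hne : K ≠ L) : Disjoint (interior K) (closure L) :=
  ((h.disjoint_of_ne hK hL hne).mono_left interior_subset).closure_right isOpen_interior

/-- These cells are disjoint, lie in one ball enlarged by the mesh size, and each has volume at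
least `α h^d`. -/
theorem IsAdmissibleMesh.finite_inter (h : IsAdmissibleMesh 𝒯 α) (hd : 1 ≤ d) (hα : 0 < α)
    {B : Set (Sp d)} (hB : Bornology.IsBounded B) :
    {K | K ∈ 𝒯 ∧ (closure K ∩ B).Nonempty}.Finite := by
  have hh := h.meshSize_pos hd
  set S := {K | K ∈ 𝒯 ∧ (closure K ∩ B).Nonempty}
  obtain ⟨R, hR⟩ := hB.subset_closedBall 0
  have hsub : (⋃ K : S, (K : Set (Sp d))) ⊆ Metric.closedBall 0 (R + meshSize 𝒯) := by
    refine iUnion_subset fun K x hx => ?_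
    obtain ⟨K, hK, z, hz, hzB⟩ := K
    have h1 := hR hzB
    rw [mem_closedBall_zero_iff] at h1 ⊢
    have h2 : dist x z ≤ Metric.diam K := by
      rw [← Metric.diam_closure]
      exact Metric.dist_le_diam_of_mem (h.polygonal K hK).isBounded.closure (subset_closure hx) hz
    have h3 : ‖x‖ ≤ ‖z‖ + dist x z := by
      have := norm_add_le z (x - z)
      rwa [add_sub_cancel, ← dist_eq_norm] at this
    linarith [h.diam_le hK]
  have := Measure.finite_const_le_meas_of_disjoint_iUnion₀ (volume : Measure (Sp d))
    (ε := ENNReal.ofReal (α * meshSize 𝒯 ^ d)) (by simp; positivity)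
    (As := fun K : S => (K : Set (Sp d)))
    (fun K => (h.polygonal K K.2.1).nullMeasurableSet)
    (fun K L hne => (h.disjoint_of_ne K.2.1 L.2.1 fun h => hne (Subtype.ext h)).aedisjoint)
    (ne_top_of_le_ne_top Metric.isBounded_closedBall.measure_lt_top.ne (measure_mono hsub))
  have huniv : {K : S | ENNReal.ofReal (α * meshSize 𝒯 ^ d) ≤ volume (K : Set (Sp d))} = univ :=
    eq_univ_of_forall fun K => h.volume_ge K K.2.1
  rw [huniv] at this
  exact toFinite_iff_finite this
where toFinite_iff_finite {S : Set (Set (Sp d))} (h : (univ : Set S).Finite) : S.Finite :=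
  Set.finite_coe_iff.1 (Set.finite_univ_iff.1 h)

theorem IsAdmissibleMesh.countable (h : IsAdmissibleMesh 𝒯 α) (hd : 1 ≤ d) (hα : 0 < α) :
    𝒯.Countable := by
  have : 𝒯 ⊆ ⋃ k : ℕ, {K | K ∈ 𝒯 ∧ (closure K ∩ Metric.ball 0 k).Nonempty} := by
    intro K hK
    obtain ⟨x, hx⟩ := (h.polygonal K hK).interior_nonempty
    obtain ⟨k, hk⟩ := exists_nat_gt ‖x‖
    exact mem_iUnion.2 ⟨k, hK, x, subset_closure (interior_subset hx), by simpa using hk⟩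
  exact (countable_iUnion fun k =>
    (h.finite_inter hd hα Metric.isBounded_ball).countable).mono this

theorem IsAdmissibleMesh.volume_compl_iUnion_interior (h : IsAdmissibleMesh 𝒯 α) (hd : 1 ≤ d)
    (hα : 0 < α) : volume (⋃ K ∈ 𝒯, interior K)ᶜ = 0 := by
  have hsub : (⋃ K ∈ 𝒯, interior K)ᶜ ⊆ ⋃ K ∈ 𝒯, frontier K := by
    intro x hx
    have hx' : x ∈ ⋃ K ∈ 𝒯, closure K := h.covers ▸ mem_univ x
    obtain ⟨K, hK, hxK⟩ := mem_iUnion₂.1 hx'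
    exact mem_iUnion₂_of_mem hK ⟨hxK, fun hi => hx (mem_iUnion₂_of_mem hK hi)⟩
  exact measure_mono_null hsub ((measure_biUnion_null_iff (h.countable hd hα)).2
    fun K hK => (h.polygonal K hK).volume_frontier)

theorem interface_comm (K L : Set (Sp d)) : interface K L = interface L K := inter_comm _ _

theorem neighbours_comm (hK : K ∈ 𝒯) : L ∈ neighbours 𝒯 K → K ∈ neighbours 𝒯 L :=
  fun ⟨_, h2, h3⟩ => ⟨hK, h2.symm, interface_comm K L ▸ h3⟩

theorem measurableSet_interface (K L : Set (Sp d)) : MeasurableSet (interface K L) :=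
  (isClosed_frontier.inter isClosed_frontier).measurableSet

theorem IsAdmissibleMesh.finite_neighbours (h : IsAdmissibleMesh 𝒯 α) (hd : 1 ≤ d) (hα : 0 < α)
    (hK : K ∈ 𝒯) : (neighbours 𝒯 K).Finite := by
  refine (h.finite_inter hd hα (h.polygonal K hK).isBounded.closure).subset ?_
  rintro L ⟨hL, -, hpos⟩
  refine ⟨hL, ?_⟩
  have : (interface K L).Nonempty := by
    by_contra hne
    rw [not_nonempty_iff_eq_empty] at hne
    simp [surfaceArea, hne] at hpos
  obtain ⟨x, hx1, hx2⟩ := this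
  exact ⟨x, hx2.1, hx1.1⟩

/-- Almost every point of an interface has opposite outward normals with respect to the two
adjacent control volumes. -/
theorem IsAdmissibleMesh.ae_interface (h : IsAdmissibleMesh 𝒯 α) (hK : K ∈ 𝒯) (hL : L ∈ 𝒯)
    (hne : K ≠ L) :
    ∀ᵐ x ∂(Measure.euclideanHausdorffMeasure (d - 1) : Measure (Sp d)), x ∈ interface K L →
      ∃ n, IsOutwardNormal K x n ∧ IsOutwardNormal L x (-n) := by
  have key : ∀ {K L}, K ∈ 𝒯 → L ∈ 𝒯 → K ≠ L →
      ∀ᵐ x ∂(Measure.euclideanHausdorffMeasure (d - 1) : Measure (Sp d)), x ∈ interface K L →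
        ∃ n, IsOutwardNormal K x n := by
    intro K L hK hL hne
    filter_upwards [(h.polygonal K hK).ae_frontier] with x hx hxi
    rcases hx hxi.1 with hn | ⟨r, hr, hball⟩
    · exact hn
    -- A ball contained in the closure of `K` and centred at a point of the closure of `L` would
    -- meet the interior of `L`.
    · exfalso
      have hxL : x ∈ closure (interior L) :=
        closure_minimal (h.polygonal L hL).regular isClosed_closure hxi.2.1
      obtain ⟨y, hy1, hy2⟩ := mem_closure_iff.1 hxL _ Metric.isOpen_ball (Metric.mem_ball_self hr)
      exact disjoint_left.1 (h.disjoint_interior_closure hL hK hne.symm) hy2 (hball hy1)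
  filter_upwards [key hK hL hne, key hL hK hne.symm] with x h1 h2 hx
  obtain ⟨n, hn⟩ := h1 hx
  obtain ⟨n', hn'⟩ := h2 (interface_comm K L ▸ hx)
  have := hn.eq_of_disjoint hn' (h.disjoint_of_ne hK hL hne)
  exact ⟨n, hn, this ▸ hn'⟩

/-- A boundary point with an outward normal lies on some interface. -/
theorem IsAdmissibleMesh.exists_mem_interface (h : IsAdmissibleMesh 𝒯 α) (hd : 1 ≤ d) (hα : 0 < α)
    (hK : K ∈ 𝒯) {x n : Sp d} (hn : IsOutwardNormal K x n) :
    ∃ L ∈ 𝒯, L ≠ K ∧ x ∈ interface K L := by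
  have hxK := hn.mem_frontier
  obtain ⟨hn1, r, hr, hball⟩ := hn
  -- Points strictly on the outer side near `x` belong to closures of cells other than `K`. Only
  -- finitely many of these come near `x`, so the union of their closures is closed and contains
  -- `x`.
  set S := {L | L ∈ 𝒯 ∧ (closure L ∩ Metric.ball x r).Nonempty} \ {K}
  have hS : S.Finite := (h.finite_inter hd hα Metric.isBounded_ball).sdiff
  have hcl : IsClosed (⋃ L ∈ S, closure L) := hS.isClosed_biUnion fun L _ => isClosed_closure
  have hx : x ∈ ⋃ L ∈ S, closure L := by
    rw [← hcl.closure_eq]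
    refine Metric.mem_closure_iff.2 fun ε hε => ?_
    obtain ⟨y, hy, hy'⟩ := IsOutwardNormal.exists_mem_ball (n := -n) (by simpa) (lt_min hr hε) x
    have hyr := Metric.ball_subset_ball (min_le_left r ε) hy
    have hyε := Metric.ball_subset_ball (min_le_right r ε) hy
    rw [inner_neg_left] at hy'
    refine ⟨y, ?_, by rw [dist_comm]; exact hyε⟩
    have hy2 : y ∈ ⋃ L ∈ 𝒯, closure L := h.covers ▸ mem_univ y
    obtain ⟨L, hL, hyL⟩ := mem_iUnion₂.1 hy2
    refine mem_iUnion₂_of_mem (⟨⟨hL, y, hyL, hyr⟩, ?_⟩ : L ∈ S) hyL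
    rintro rfl
    have hopen : IsOpen (Metric.ball x r ∩ (fun z => inner ℝ n (z - x)) ⁻¹' Ioi 0) :=
      Metric.isOpen_ball.inter (isOpen_Ioi.preimage (by fun_prop))
    obtain ⟨z, ⟨hz1, hz2⟩, hz3⟩ := mem_closure_iff.1 hyL _ hopen
      ⟨hyr, show 0 < inner ℝ n (y - x) by linarith⟩
    exact (hball z hz1).2 hz2 hz3
  obtain ⟨L, hLS, hxL⟩ := mem_iUnion₂.1 hx
  refine ⟨L, hLS.1.1, hLS.2, hxK, hxL, fun hi => ?_⟩
  exact disjoint_left.1 (h.disjoint_interior_closure hLS.1.1 hK hLS.2) hi hxK.1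

theorem IsAdmissibleMesh.measure_interface_lt_top (h : IsAdmissibleMesh 𝒯 α) (hK : K ∈ 𝒯)
    (L : Set (Sp d)) :
    (Measure.euclideanHausdorffMeasure (d - 1) : Measure (Sp d)) (interface K L) < ∞ :=
  (measure_mono inter_subset_left).trans_lt (measure_frontier_lt_top (h.polygonal K hK))

/-- Integrals over the boundary of functions of the normal split over the interfaces. -/
theorem IsAdmissibleMesh.integral_frontier (h : IsAdmissibleMesh 𝒯 α) (hd : 1 ≤ d) (hα : 0 < α)
    (hK : K ∈ 𝒯) {φ : Sp d → ℝ} (hφ : ∀ x, outwardNormal K x = 0 → φ x = 0)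
    (hint : IntegrableOn φ (frontier K) (Measure.euclideanHausdorffMeasure (d - 1))) :
    ∑ L ∈ (h.finite_neighbours hd hα hK).toFinset,
      ∫ x in interface K L, φ x ∂(Measure.euclideanHausdorffMeasure (d - 1))
      = ∫ x in frontier K, φ x ∂(Measure.euclideanHausdorffMeasure (d - 1)) := by
  set S := (h.finite_neighbours hd hα hK).toFinset with hS
  have hmem : ∀ L, L ∈ S ↔ L ∈ neighbours 𝒯 K := fun L => by simp [hS]
  have hUsub : (⋃ L : S, interface K L) ⊆ frontier K :=
    iUnion_subset fun L => inter_subset_left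
  have h1 : ∫ x in frontier K, φ x ∂(Measure.euclideanHausdorffMeasure (d - 1))
      = ∫ x in ⋃ L : S, interface K L, φ x ∂(Measure.euclideanHausdorffMeasure (d - 1)) := by
    refine setIntegral_eq_of_subset_of_ae_sdiff_eq_zero
      isClosed_frontier.measurableSet.nullMeasurableSet hUsub ?_
    -- The interfaces of zero area that `neighbours` leaves out are countably many, hence negligible
    -- together.
    have hall : ∀ᵐ x ∂(Measure.euclideanHausdorffMeasure (d - 1) : Measure (Sp d)),
        ∀ L ∈ 𝒯, L ≠ K → surfaceArea (interface K L) = 0 → x ∉ interface K L := by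
      rw [ae_ball_iff (h.countable hd hα)]
      intro L hL
      by_cases hne : L ≠ K
      · by_cases h0 : surfaceArea (interface K L) = 0
        · have := (measureReal_eq_zero_iff (h.measure_interface_lt_top hK L).ne).1 h0
          filter_upwards [compl_mem_ae_iff.2 this] with x hx _ _ using hx
        · exact Eventually.of_forall fun x _ h => absurd h h0
      · exact Eventually.of_forall fun x h => absurd h hne
    filter_upwards [hall] with x hx hxK
    refine hφ x ?_
    by_contra hnz
    have hex : ∃ n, IsOutwardNormal K x n := by
      by_contra hex
      exact hnz (by rw [outwardNormal, dif_neg hex])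
    obtain ⟨n, hn⟩ := hex
    obtain ⟨L, hL, hLK, hxL⟩ := h.exists_mem_interface hd hα hK hn
    refine hxK.2 (mem_iUnion.2 ⟨⟨L, (hmem L).2 ⟨hL, hLK, ?_⟩⟩, hxL⟩)
    exact lt_of_le_of_ne measureReal_nonneg fun h0 => hx L hL hLK h0.symm hxL
  rw [h1, integral_iUnion_ae (s := fun L : S => interface K L)
    (fun L => (measurableSet_interface K L).nullMeasurableSet) ?_
    (hint.mono_set hUsub), tsum_fintype, Finset.sum_coe_sort S
    (fun L => ∫ x in interface K L, φ x ∂(Measure.euclideanHausdorffMeasure (d - 1)))]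
  -- At a common point of two interfaces of `K`, both neighbours would have outward normal `-n`;
  -- being disjoint, they would also have opposite normals, which forces `n = 0`.
  intro L L' hne
  obtain ⟨hL, hLK, -⟩ := (hmem L).1 L.2
  obtain ⟨hL', hLK', -⟩ := (hmem L').1 L'.2
  have := (h.ae_interface hK hL hLK.symm).and (h.ae_interface hK hL' hLK'.symm)
  refine measure_mono_null (fun x hx => ?_) (ae_iff.1 this)
  intro hx'
  obtain ⟨n, hn1, hn2⟩ := hx'.1 hx.1
  obtain ⟨n', hn1', hn2'⟩ := hx'.2 hx.2
  rw [hn1.unique hn1'] at hn2'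
  have h3 := hn2.eq_of_disjoint hn2' (h.disjoint_of_ne hL hL' fun h => hne (Subtype.ext h))
  rw [neg_neg] at h3
  have h4 : (2 : ℝ) • n = 0 := by rw [two_smul]; nth_rewrite 1 [← h3]; simp
  have h5 : n = 0 := by simpa using h4
  have := hn1.1
  rw [h5] at this
  simp at this

end Mesh

/-! ### Numerical fluxes: conservation and the CFL bound -/

section Flux
variable {d : ℕ} {K L : Set (Sp d)} {𝒯 : Set (Set (Sp d))} {α T V : ℝ} {v : ℝ → Sp d → Sp d}

/-- The flux `|σ| (v · n_{K,σ})^-` from `L` into `K` through their interface. -/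
def inflow (v : ℝ → Sp d → Sp d) (Δt : ℝ) (n : ℕ) (K L : Set (Sp d)) : ℝ :=
  surfaceArea (interface K L) * normalVelocityNeg v Δt n K L

theorem inflow_nonneg {Δt : ℝ} (hΔt : 0 < Δt) (n : ℕ) (K L : Set (Sp d)) :
    0 ≤ inflow v Δt n K L := by
  have h1 : 0 ≤ surfaceArea (interface K L) := measureReal_nonneg
  refine mul_nonneg h1 (mul_nonneg (by positivity) ?_)
  refine intervalIntegral.integral_nonneg (by nlinarith) fun t _ => ?_
  exact integral_nonneg fun x => le_max_right _ _

theorem IsAdmissibleMesh.outwardNormal_eq_neg (h : IsAdmissibleMesh 𝒯 α) (hK : K ∈ 𝒯) (hL : L ∈ 𝒯)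
    (hne : K ≠ L) :
    ∀ᵐ x ∂((Measure.euclideanHausdorffMeasure (d - 1)).restrict (interface K L)),
      outwardNormal L x = -outwardNormal K x := by
  filter_upwards [ae_restrict_of_ae (h.ae_interface hK hL hne),
    ae_restrict_mem (measurableSet_interface K L)] with x hx hxi
  obtain ⟨n, h1, h2⟩ := hx hxi
  rw [h1.outwardNormal_eq, h2.outwardNormal_eq]

/-- Normals on the two sides of an interface are opposite, so what flows out of `K` flows into `L`.
All fluxes can thus be written with `inflow`. -/
theorem IsAdmissibleMesh.normalVelocityPos_eq (h : IsAdmissibleMesh 𝒯 α) (hK : K ∈ 𝒯)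
    (hL : L ∈ 𝒯) (hne : K ≠ L) (v : ℝ → Sp d → Sp d) (Δt : ℝ) (n : ℕ) :
    normalVelocityPos v Δt n K L = normalVelocityNeg v Δt n L K := by
  rw [normalVelocityPos, normalVelocityNeg, interface_comm L K]
  congr 1
  refine intervalIntegral.integral_congr fun t _ => ?_
  refine integral_congr_ae ?_
  filter_upwards [h.outwardNormal_eq_neg hK hL hne] with x hx
  simp only [hx, inner_neg_right, neg_neg]

theorem surfaceArea_mul_normalVelocityPos (h : IsAdmissibleMesh 𝒯 α) (hK : K ∈ 𝒯)
    (hL : L ∈ 𝒯) (hne : K ≠ L) (Δt : ℝ) (n : ℕ) :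
    surfaceArea (interface K L) * normalVelocityPos v Δt n K L = inflow v Δt n L K := by
  rw [h.normalVelocityPos_eq hK hL hne, inflow, interface_comm L K]

theorem inflow_eq (hpos : 0 < surfaceArea (interface K L)) (Δt : ℝ) (n : ℕ) :
    inflow v Δt n K L = 1 / Δt * ∫ t in (n * Δt)..((n + 1) * Δt), ∫ x in interface K L,
      max (-inner ℝ (v t x) (outwardNormal K x)) 0 ∂(Measure.euclideanHausdorffMeasure (d - 1)) := by
  rw [inflow, normalVelocityNeg, ← mul_assoc]
  congr 1
  rw [one_div, one_div, mul_inv]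
  field_simp

theorem inflow_swap_eq (h : IsAdmissibleMesh 𝒯 α) (hK : K ∈ 𝒯)
    (hL : L ∈ 𝒯) (hne : K ≠ L) (hpos : 0 < surfaceArea (interface K L)) (Δt : ℝ) (n : ℕ) :
    inflow v Δt n L K = 1 / Δt * ∫ t in (n * Δt)..((n + 1) * Δt), ∫ x in interface K L,
      max (inner ℝ (v t x) (outwardNormal K x)) 0 ∂(Measure.euclideanHausdorffMeasure (d - 1)) := by
  rw [← surfaceArea_mul_normalVelocityPos h hK hL hne, normalVelocityPos, ← mul_assoc]
  congr 1
  rw [one_div, one_div, mul_inv]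
  field_simp

theorem IsPolygonal.isFiniteMeasure_frontier (hK : IsPolygonal K) :
    IsFiniteMeasure ((Measure.euclideanHausdorffMeasure (d - 1)).restrict (frontier K)) :=
  ⟨by rw [Measure.restrict_apply_univ]; exact measure_frontier_lt_top hK⟩

theorem aestronglyMeasurable_flux (hK : IsPolygonal K)
    (hv : ContinuousOn (fun p : ℝ × Sp d => v p.1 p.2) (Icc 0 T ×ˢ univ)) {s : Set (Sp d)}
    (hs : s ⊆ frontier K) {a b : ℝ} (ha : 0 ≤ a) (hb : b ≤ T) :
    AEStronglyMeasurable (fun p : ℝ × Sp d => inner ℝ (v p.1 p.2) (outwardNormal K p.2))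
      ((volume.restrict (Ioc a b)).prod ((Measure.euclideanHausdorffMeasure (d - 1)).restrict s)) := by
  have := hK.isFiniteMeasure_frontier
  suffices hfr : AEStronglyMeasurable (fun p : ℝ × Sp d => inner ℝ (v p.1 p.2) (outwardNormal K p.2))
      ((volume.restrict (Ioc a b)).prod
        ((Measure.euclideanHausdorffMeasure (d - 1)).restrict (frontier K))) from
    hfr.mono_measure (Measure.prod_mono le_rfl (Measure.restrict_mono hs le_rfl))
  refine AEStronglyMeasurable.inner ?_ hK.aestronglyMeasurable_outwardNormal.comp_snd
  have hm : (volume.restrict (Ioc a b)).prod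
      ((Measure.euclideanHausdorffMeasure (d - 1)).restrict (frontier K))
      = ((volume.restrict (Ioc a b)).prod
        ((Measure.euclideanHausdorffMeasure (d - 1)).restrict (frontier K))).restrict
          (Ioc a b ×ˢ univ) := by
    rw [← Measure.prod_restrict, Measure.restrict_restrict measurableSet_Ioc, inter_self,
      Measure.restrict_univ]
  rw [hm]
  exact (hv.mono (prod_mono (fun t ht => ⟨ha.trans ht.1.le, ht.2.trans hb⟩)
    subset_rfl)).aestronglyMeasurable (measurableSet_Ioc.prod MeasurableSet.univ)

theorem abs_flux_le (hV : ∀ t ∈ Ico 0 T, ∀ x, ‖v t x‖ ≤ V) {t : ℝ} (ht : t ∈ Ico 0 T) (x : Sp d) :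
    |inner ℝ (v t x) (outwardNormal K x)| ≤ V := by
  have h1 := abs_real_inner_le_norm (v t x) (outwardNormal K x)
  have h2 := mul_le_mul (hV t ht x) (norm_outwardNormal_le K x) (norm_nonneg _)
    ((norm_nonneg _).trans (hV t ht x))
  linarith

theorem continuous_velocity (hv : ContinuousOn (fun p : ℝ × Sp d => v p.1 p.2) (Icc 0 T ×ˢ univ))
    {t : ℝ} (ht : t ∈ Ico 0 T) : Continuous (v t) := by
  rw [← continuousOn_univ]
  exact hv.comp (f := fun x => (t, x)) (by fun_prop) fun x _ => ⟨⟨ht.1, ht.2.le⟩, mem_univ _⟩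

theorem integrableOn_flux (hK : IsPolygonal K)
    (hv : ContinuousOn (fun p : ℝ × Sp d => v p.1 p.2) (Icc 0 T ×ˢ univ))
    (hV : ∀ t ∈ Ico 0 T, ∀ x, ‖v t x‖ ≤ V) {t : ℝ} (ht : t ∈ Ico 0 T) :
    IntegrableOn (fun x => inner ℝ (v t x) (outwardNormal K x)) (frontier K)
      (Measure.euclideanHausdorffMeasure (d - 1)) := by
  have := hK.isFiniteMeasure_frontier
  exact Integrable.of_bound ((continuous_velocity hv ht).aestronglyMeasurable.inner
    hK.aestronglyMeasurable_outwardNormal) V (Eventually.of_forall fun x => abs_flux_le hV ht x)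

/-- The velocity is controlled on `[0, T)` only, while the last time step ends at `T`; the endpoint
is a null set. -/
theorem ae_mem_Ico {a b : ℝ} (ha : 0 ≤ a) (hb : b ≤ T) :
    ∀ᵐ t ∂(volume.restrict (Ioc a b)), t ∈ Ico 0 T := by
  filter_upwards [ae_restrict_mem measurableSet_Ioc,
    ae_restrict_of_ae (compl_mem_ae_iff.2 (Real.volume_singleton (a := b)))] with t ht htb
  exact ⟨ha.trans ht.1.le, (lt_of_le_of_ne ht.2 htb).trans_le hb⟩

theorem intervalIntegrable_flux (hK : IsPolygonal K)
    (hv : ContinuousOn (fun p : ℝ × Sp d => v p.1 p.2) (Icc 0 T ×ˢ univ))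
    (hV : ∀ t ∈ Ico 0 T, ∀ x, ‖v t x‖ ≤ V) {s : Set (Sp d)} (hs : s ⊆ frontier K)
    {a b : ℝ} (ha : 0 ≤ a) (hab : a ≤ b) (hb : b ≤ T) (ε : ℝ) (hε : |ε| = 1) :
    IntervalIntegrable (fun t => ∫ x in s, max (ε * inner ℝ (v t x) (outwardNormal K x)) 0
      ∂(Measure.euclideanHausdorffMeasure (d - 1))) volume a b := by
  have := hK.isFiniteMeasure_frontier
  have hsf : IsFiniteMeasure ((Measure.euclideanHausdorffMeasure (d - 1)).restrict s) :=
    ⟨by rw [Measure.restrict_apply_univ]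
        exact (measure_mono hs).trans_lt (measure_frontier_lt_top hK)⟩
  rw [intervalIntegrable_iff_integrableOn_Ioc_of_le hab]
  have hm := ((aestronglyMeasurable_flux hK hv hs ha hb).const_mul ε).sup
    (aestronglyMeasurable_const (b := (0 : ℝ)))
  refine Integrable.of_bound (C := V * ((Measure.euclideanHausdorffMeasure (d - 1)).restrict s).real univ)
    hm.integral_prod_right' ?_
  filter_upwards [ae_mem_Ico ha hb] with t ht
  refine norm_integral_le_of_norm_le_const (Eventually.of_forall fun x => ?_)
  have h1 := abs_flux_le (K := K) hV ht x
  have h2 : |ε * inner ℝ (v t x) (outwardNormal K x)| ≤ V := by rw [abs_mul, hε, one_mul]; exact h1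
  rw [Real.norm_eq_abs, abs_of_nonneg (le_max_right _ _)]
  exact max_le ((le_abs_self _).trans h2) ((abs_nonneg _).trans h2)

/-- The sign `ε = ±1` treats the outgoing and the incoming part of the flux at once. -/
theorem sum_integral_flux (h : IsAdmissibleMesh 𝒯 α) (hd : 1 ≤ d) (hα : 0 < α) (hK : K ∈ 𝒯)
    (hv : ContinuousOn (fun p : ℝ × Sp d => v p.1 p.2) (Icc 0 T ×ˢ univ))
    (hV : ∀ t ∈ Ico 0 T, ∀ x, ‖v t x‖ ≤ V)
    {a b : ℝ} (ha : 0 ≤ a) (hab : a ≤ b) (hb : b ≤ T) (ε : ℝ) (hε : |ε| = 1) :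
    ∑ L ∈ (h.finite_neighbours hd hα hK).toFinset, ∫ t in a..b, ∫ x in interface K L,
      max (ε * inner ℝ (v t x) (outwardNormal K x)) 0 ∂(Measure.euclideanHausdorffMeasure (d - 1))
    = ∫ t in a..b, ∫ x in frontier K, max (ε * inner ℝ (v t x) (outwardNormal K x)) 0
      ∂(Measure.euclideanHausdorffMeasure (d - 1)) := by
  rw [← intervalIntegral.integral_finsetSum fun L _ => intervalIntegrable_flux
    (s := interface K L) (h.polygonal K hK) hv hV inter_subset_left ha hab hb ε hε]
  rw [intervalIntegral.integral_of_le hab, intervalIntegral.integral_of_le hab]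
  refine integral_congr_ae ?_
  filter_upwards [ae_mem_Ico ha hb] with t ht
  refine h.integral_frontier hd hα hK (fun x hx => by simp [hx]) ?_
  have := (h.polygonal K hK).isFiniteMeasure_frontier
  exact ((integrableOn_flux (h.polygonal K hK) hv hV ht).const_mul ε).sup (integrable_const 0)

theorem sum_inflow (h : IsAdmissibleMesh 𝒯 α) (hd : 1 ≤ d) (hα : 0 < α) (hK : K ∈ 𝒯)
    (hv : ContDiffOn ℝ 1 (fun p : ℝ × Sp d => v p.1 p.2) (Icc 0 T ×ˢ univ))
    (hV : ∀ t ∈ Ico 0 T, ∀ x, ‖v t x‖ ≤ V)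
    {Δt : ℝ} {n : ℕ} (hΔt : 0 < Δt) (hn : (n + 1) * Δt ≤ T) :
    ∑ L ∈ (h.finite_neighbours hd hα hK).toFinset, inflow v Δt n K L
      = 1 / Δt * ∫ t in (n * Δt)..((n + 1) * Δt), ∫ x in frontier K,
        max (-1 * inner ℝ (v t x) (outwardNormal K x)) 0
        ∂(Measure.euclideanHausdorffMeasure (d - 1)) := by
  rw [← sum_integral_flux h hd hα hK hv.continuousOn hV (by positivity) (by nlinarith) hn (-1)
    (by simp), Finset.mul_sum]
  refine Finset.sum_congr rfl fun L hL => ?_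
  have hL : L ∈ neighbours 𝒯 K := by simpa using hL
  simp only [inflow_eq hL.2.2, neg_one_mul]

theorem sum_inflow_swap (h : IsAdmissibleMesh 𝒯 α) (hd : 1 ≤ d) (hα : 0 < α) (hK : K ∈ 𝒯)
    (hv : ContDiffOn ℝ 1 (fun p : ℝ × Sp d => v p.1 p.2) (Icc 0 T ×ˢ univ))
    (hV : ∀ t ∈ Ico 0 T, ∀ x, ‖v t x‖ ≤ V)
    {Δt : ℝ} {n : ℕ} (hΔt : 0 < Δt) (hn : (n + 1) * Δt ≤ T) :
    ∑ L ∈ (h.finite_neighbours hd hα hK).toFinset, inflow v Δt n L K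
      = 1 / Δt * ∫ t in (n * Δt)..((n + 1) * Δt), ∫ x in frontier K,
        max (1 * inner ℝ (v t x) (outwardNormal K x)) 0
        ∂(Measure.euclideanHausdorffMeasure (d - 1)) := by
  rw [← sum_integral_flux h hd hα hK hv.continuousOn hV (by positivity) (by nlinarith) hn 1
    (by simp), Finset.mul_sum]
  refine Finset.sum_congr rfl fun L hL => ?_
  have hL : L ∈ neighbours 𝒯 K := by simpa using hL
  simp only [inflow_swap_eq h hK hL.1 hL.2.1.symm hL.2.2, one_mul]

/-- The difference of the positive and negative parts is the normal velocity itself, and its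
integral over the boundary vanishes at each time by the divergence theorem. -/
theorem sum_inflow_eq_sum_swap (h : IsAdmissibleMesh 𝒯 α) (hd : 1 ≤ d) (hα : 0 < α) (hK : K ∈ 𝒯)
    (hv : ContDiffOn ℝ 1 (fun p : ℝ × Sp d => v p.1 p.2) (Icc 0 T ×ˢ univ))
    (hV : ∀ t ∈ Ico 0 T, ∀ x, ‖v t x‖ ≤ V)
    {Δt : ℝ} {n : ℕ} (hΔt : 0 < Δt) (hn : (n + 1) * Δt ≤ T)
    (hdiv : ∀ t ∈ Ico 0 T, ∀ x, divergence (v t) x = 0) :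
    ∑ L ∈ (h.finite_neighbours hd hα hK).toFinset, inflow v Δt n L K
      = ∑ L ∈ (h.finite_neighbours hd hα hK).toFinset, inflow v Δt n K L := by
  rw [sum_inflow h hd hα hK hv hV hΔt hn, sum_inflow_swap h hd hα hK hv hV hΔt hn]
  congr 1
  have hab : (n : ℝ) * Δt ≤ (n + 1) * Δt := by nlinarith
  rw [intervalIntegral.integral_of_le hab, intervalIntegral.integral_of_le hab]
  refine integral_congr_ae ?_
  filter_upwards [ae_mem_Ico (T := T) (show 0 ≤ (n : ℝ) * Δt by positivity) hn] with t ht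
  have hfin := (h.polygonal K hK).isFiniteMeasure_frontier
  have hint := integrableOn_flux (h.polygonal K hK) hv.continuousOn hV ht
  have hi : ∀ ε : ℝ, Integrable (fun x => max (ε * inner ℝ (v t x) (outwardNormal K x)) 0)
      ((Measure.euclideanHausdorffMeasure (d - 1)).restrict (frontier K)) := fun ε =>
    (hint.const_mul ε).sup (integrable_const 0)
  rw [← sub_eq_zero, ← integral_sub (hi 1) (hi (-1))]
  have hw : ContDiff ℝ 1 (v t) := by
    rw [← contDiffOn_univ]
    exact hv.comp (f := fun x => (t, x)) (by fun_prop) fun x _ => ⟨⟨ht.1, ht.2.le⟩, mem_univ _⟩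
  refine Eq.trans ?_ ((h.polygonal K hK).integral_flux_eq_zero hw (hdiv t ht))
  refine integral_congr_ae (Eventually.of_forall fun x => ?_)
  simp only [one_mul, neg_one_mul]
  rcases le_total 0 (inner ℝ (v t x) (outwardNormal K x)) with h0 | h0
  · rw [max_eq_left h0, max_eq_right (by linarith)]; ring
  · rw [max_eq_right h0, max_eq_left (by linarith)]; ring

theorem sum_inflow_le (h : IsAdmissibleMesh 𝒯 α) (hd : 1 ≤ d) (hα : 0 < α) (hK : K ∈ 𝒯)
    (hv : ContDiffOn ℝ 1 (fun p : ℝ × Sp d => v p.1 p.2) (Icc 0 T ×ˢ univ))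
    (hV : ∀ t ∈ Ico 0 T, ∀ x, ‖v t x‖ ≤ V)
    {Δt : ℝ} {n : ℕ} (hΔt : 0 < Δt) (hn : (n + 1) * Δt ≤ T) :
    ∑ L ∈ (h.finite_neighbours hd hα hK).toFinset, inflow v Δt n K L
      ≤ V * (1 / α * meshSize 𝒯 ^ (d - 1)) := by
  have hab : (n : ℝ) * Δt ≤ (n + 1) * Δt := by nlinarith
  have hT : 0 < T := lt_of_lt_of_le (by positivity) hn
  have hV0 : 0 ≤ V := (norm_nonneg _).trans (hV 0 ⟨le_rfl, hT⟩ 0)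
  have hh := h.meshSize_pos hd
  have hfin := (h.polygonal K hK).isFiniteMeasure_frontier
  have harea : ((Measure.euclideanHausdorffMeasure (d - 1)).restrict (frontier K)).real univ
      ≤ 1 / α * meshSize 𝒯 ^ (d - 1) := by
    rw [measureReal_restrict_apply_univ]
    exact ENNReal.toReal_le_of_le_ofReal (by positivity) (h.frontier_le K hK)
  rw [sum_inflow h hd hα hK hv hV hΔt hn]
  have hle : ∫ t in (n * Δt)..((n + 1) * Δt), ∫ x in frontier K,
        max (-1 * inner ℝ (v t x) (outwardNormal K x)) 0
        ∂(Measure.euclideanHausdorffMeasure (d - 1))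
      ≤ ∫ t in (n * Δt)..((n + 1) * Δt), V * (1 / α * meshSize 𝒯 ^ (d - 1)) := by
    rw [intervalIntegral.integral_of_le hab, intervalIntegral.integral_of_le hab]
    refine integral_mono_ae ?_ (integrable_const _) ?_
    · exact (intervalIntegrable_iff_integrableOn_Ioc_of_le hab).1
        (intervalIntegrable_flux (h.polygonal K hK) hv.continuousOn hV subset_rfl (by positivity)
          hab hn (-1) (by simp))
    · filter_upwards [ae_mem_Ico (T := T) (show 0 ≤ (n : ℝ) * Δt by positivity) hn] with t ht
      rw [measureReal_restrict_apply_univ] at harea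
      refine (Real.le_norm_self _).trans ((norm_integral_le_of_norm_le_const (C := V)
        (Eventually.of_forall fun x => ?_)).trans
        (by rw [measureReal_restrict_apply_univ]; exact mul_le_mul_of_nonneg_left harea hV0))
      have h2 := abs_flux_le (K := K) hV ht x
      rw [Real.norm_eq_abs, abs_of_nonneg (le_max_right _ _), neg_one_mul]
      exact max_le ((neg_le_abs _).trans h2) hV0
  rw [intervalIntegral.integral_const, smul_eq_mul] at hle
  rw [one_div, inv_mul_le_iff₀ hΔt]
  refine hle.trans (le_of_eq ?_)
  ring

/-- This is where the factor `α² h` of the CFL condition is spent: against `|∂K| ≤ h^(d-1)/α` it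
yields `α h^d ≤ |K|`. -/
theorem sum_inflow_le_volume (h : IsAdmissibleMesh 𝒯 α) (hd : 1 ≤ d) (hα : 0 < α) (hK : K ∈ 𝒯)
    (hv : ContDiffOn ℝ 1 (fun p : ℝ × Sp d => v p.1 p.2) (Icc 0 T ×ˢ univ))
    (hV : ∀ t ∈ Ico 0 T, ∀ x, ‖v t x‖ ≤ V)
    {Δt : ℝ} {n : ℕ} (hΔt : 0 < Δt) (hn : (n + 1) * Δt ≤ T)
    {cf ξ : ℝ} (hcf : 0 ≤ cf) (hξ : ξ < 1)
    (hcfl : Δt * (cf * V) ≤ (1 - ξ) * α ^ 2 * meshSize 𝒯) :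
    Δt * cf * ∑ L ∈ (h.finite_neighbours hd hα hK).toFinset, inflow v Δt n K L
      ≤ (1 - ξ) * volume.real K := by
  have h1 := sum_inflow_le h hd hα hK hv hV hΔt hn
  have h2 := h.le_volume_real hK
  have hh := h.meshSize_pos hd
  have hpow : meshSize 𝒯 ^ d = meshSize 𝒯 * meshSize 𝒯 ^ (d - 1) := by
    rw [← pow_succ']; congr 1; omega
  calc Δt * cf * ∑ L ∈ (h.finite_neighbours hd hα hK).toFinset, inflow v Δt n K L
      ≤ Δt * cf * (V * (1 / α * meshSize 𝒯 ^ (d - 1))) := by gcongr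
    _ = Δt * (cf * V) * (1 / α * meshSize 𝒯 ^ (d - 1)) := by ring
    _ ≤ (1 - ξ) * α ^ 2 * meshSize 𝒯 * (1 / α * meshSize 𝒯 ^ (d - 1)) := by gcongr
    _ = (1 - ξ) * (α * meshSize 𝒯 ^ d) := by rw [hpow]; field_simp
    _ ≤ (1 - ξ) * volume.real K := mul_le_mul_of_nonneg_left h2 (by linarith)

end Flux

/-! ### Mean and variance of the Poisson law -/

section PoissonMoments

/-- The identity `n r^n / n! = r · r^(n-1) / (n-1)!` shifts the index. It is applied with `φ = 1`
for the first moment and `φ n = n` for the second. -/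
theorem hasSum_poisson_mul (r : ℝ≥0) {φ : ℕ → ℝ} {S : ℝ}
    (h : HasSum (fun n : ℕ => Real.exp (-r) * r ^ n / (n.factorial : ℝ) * φ (n + 1)) S) :
    HasSum (fun n : ℕ => Real.exp (-r) * r ^ n / (n.factorial : ℝ) * (n * φ n)) (r * S) := by
  rw [← hasSum_nat_add_iff' 1]
  simp only [Finset.range_one, Finset.sum_singleton, Nat.cast_zero, zero_mul, mul_zero, sub_zero]
  have e : (fun n : ℕ => Real.exp (-r) * r ^ (n + 1) / ((n + 1).factorial : ℝ)
      * ((n + 1 : ℕ) * φ (n + 1)))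
      = fun n : ℕ => (r : ℝ) * (Real.exp (-r) * r ^ n / (n.factorial : ℝ) * φ (n + 1)) := by
    funext n
    rw [Nat.factorial_succ]
    push_cast
    field_simp
    ring
  rw [e]
  exact h.mul_left (r : ℝ)

theorem poissonMeasure_moments (r : ℝ≥0) :
    (Integrable (fun k : ℕ => (k : ℝ) - r) (poissonMeasure r) ∧
      ∫ k : ℕ, ((k : ℝ) - r) ∂(poissonMeasure r) = 0) ∧
    (Integrable (fun k : ℕ => ((k : ℝ) - r) ^ 2) (poissonMeasure r) ∧
      ∫ k : ℕ, ((k : ℝ) - r) ^ 2 ∂(poissonMeasure r) = r) := by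
  have h0 := hasSum_one_poissonMeasure r
  have h1 : HasSum (fun n : ℕ => Real.exp (-r) * r ^ n / (n.factorial : ℝ) * n) r := by
    have := hasSum_poisson_mul r (φ := fun _ => 1) (S := 1) (by simpa using h0)
    simpa using this
  have h2 : HasSum (fun n : ℕ => Real.exp (-r) * r ^ n / (n.factorial : ℝ) * (n : ℝ) ^ 2)
      (r * (r + 1)) := by
    have := hasSum_poisson_mul r (φ := fun n => (n : ℝ)) (S := r + 1) (by
      convert h1.add h0 using 2 with n
      push_cast; ring)
    convert this using 2 with n
    ring
  have i1 : Integrable (fun k : ℕ => (k : ℝ)) (poissonMeasure r) := by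
    rw [integrable_poissonMeasure_iff]
    simpa using h1.summable
  have i2 : Integrable (fun k : ℕ => (k : ℝ) ^ 2) (poissonMeasure r) := by
    rw [integrable_poissonMeasure_iff]
    simpa using h2.summable
  have e1 : ∫ k : ℕ, (k : ℝ) ∂(poissonMeasure r) = r := by
    rw [integral_poissonMeasure]; simpa using h1.tsum_eq
  have e2 : ∫ k : ℕ, (k : ℝ) ^ 2 ∂(poissonMeasure r) = r * (r + 1) := by
    rw [integral_poissonMeasure]; simpa using h2.tsum_eq
  have ex : (fun k : ℕ => ((k : ℝ) - r) ^ 2)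
      = fun k : ℕ => (k : ℝ) ^ 2 - 2 * r * k + (r : ℝ) ^ 2 := by
    funext k; ring
  refine ⟨⟨i1.sub (integrable_const _), ?_⟩, ?_, ?_⟩
  · rw [integral_sub i1 (integrable_const _), e1]; simp
  · rw [ex]; exact (i2.sub (i1.const_mul _)).add (integrable_const _)
  · have i3 : Integrable (fun k : ℕ => (k : ℝ) ^ 2 - 2 * r * k) (poissonMeasure r) :=
      i2.sub (i1.const_mul _)
    rw [ex, integral_add i3 (integrable_const _), integral_sub i2 (i1.const_mul _), integral_const_mul, e1, e2]
    simp; ring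

end PoissonMoments

/-! ### Moments and independence of the compensated random measure -/

section Noise
variable {Ω E : Type*} {mΩ : MeasurableSpace Ω} [MeasurableSpace E]
  {P : Measure Ω} {ℱ : Filtration ℝ≥0 mΩ} {m : Measure E} {N : Ω → Measure (ℝ × E)}

theorem measurable_compensated_of_measurable {mΩ' : MeasurableSpace Ω} {B : Set (ℝ × E)}
    (h : Measurable[mΩ'] fun ω => N ω B) : Measurable[mΩ'] (compensated m N B) :=
  (h.ennreal_toReal).sub_const _

theorem IsPoissonRandomMeasure.measurable_compensated (hN : IsPoissonRandomMeasure P ℱ m N)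
    {B : Set (ℝ × E)} (hB : MeasurableSet B) : Measurable (compensated m N B) :=
  measurable_compensated_of_measurable (hN.measurable B hB)

theorem IsPoissonRandomMeasure.compensated_moments [IsProbabilityMeasure P]
    (hN : IsPoissonRandomMeasure P ℱ m N)
    {B : Set (ℝ × E)} (hB : MeasurableSet B) (hfin : intensity m B < ∞) :
    MemLp (compensated m N B) 2 P ∧ ∫ ω, compensated m N B ω ∂P = 0 ∧
      ∫ ω, compensated m N B ω ^ 2 ∂P = (intensity m).real B := by
  set r : ℝ≥0 := (intensity m B).toNNReal with hr
  have hrr : (intensity m).real B = r := rfl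
  obtain ⟨⟨i1, e1⟩, i2, e2⟩ := poissonMeasure_moments r
  have hlaw := hN.law_of_lt_top B hB hfin
  have hcast : Measurable (fun k : ℕ => (k : ℝ≥0∞)) := measurable_from_top
  have hmeas : Measurable fun ω => N ω B := hN.measurable B hB
  -- Expectations of functions of the compensated mass are transported through the law of `N B` to
  -- the Poisson law on the natural numbers.
  have tr : ∀ ψ : ℝ → ℝ, Measurable ψ →
      (Integrable (fun k : ℕ => ψ ((k : ℝ) - r)) (poissonMeasure r) →
        Integrable (fun ω => ψ (compensated m N B ω)) P) ∧
      ∫ ω, ψ (compensated m N B ω) ∂P = ∫ k : ℕ, ψ ((k : ℝ) - r) ∂(poissonMeasure r) := by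
    intro ψ hψ
    have hm : Measurable fun x : ℝ≥0∞ => ψ (x.toReal - r) :=
      hψ.comp (measurable_id.ennreal_toReal.sub_const _)
    constructor
    · intro hi
      have h1 : Integrable (fun x : ℝ≥0∞ => ψ (x.toReal - r)) (P.map fun ω => N ω B) := by
        rw [hlaw, integrable_map_measure hm.aestronglyMeasurable hcast.aemeasurable]
        simpa [Function.comp_def] using hi
      exact (integrable_map_measure hm.aestronglyMeasurable hmeas.aemeasurable).1 h1
    · have h1 := integral_map (μ := P) hmeas.aemeasurable hm.aestronglyMeasurable
      have h2 := integral_map (μ := poissonMeasure r) hcast.aemeasurable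
        (f := fun x : ℝ≥0∞ => ψ (x.toReal - r)) hm.aestronglyMeasurable
      rw [hlaw, h2] at h1
      exact (by simpa using h1.symm : ∫ ω, ψ ((N ω B).toReal - r) ∂P = _)
  refine ⟨?_, ?_, ?_⟩
  · rw [memLp_two_iff_integrable_sq (hN.measurable_compensated hB).aestronglyMeasurable]
    exact (tr (fun x => x ^ 2) (by fun_prop)).1 i2
  · exact (tr (fun x => x) (by fun_prop)).2.trans e1
  · exact (tr (fun x => x ^ 2) (by fun_prop)).2.trans e2

theorem IsPoissonRandomMeasure.ae_lt_top [IsProbabilityMeasure P]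
    (hN : IsPoissonRandomMeasure P ℱ m N)
    {B : Set (ℝ × E)} (hB : MeasurableSet B) (hfin : intensity m B < ∞) :
    ∀ᵐ ω ∂P, N ω B < ∞ := by
  have hlaw := hN.law_of_lt_top B hB hfin
  have hcast : Measurable (fun k : ℕ => (k : ℝ≥0∞)) := measurable_from_top
  refine ae_of_ae_map (hN.measurable B hB).aemeasurable (p := fun x => x < ∞) ?_
  rw [hlaw, ae_map_iff hcast.aemeasurable measurableSet_Iio]
  exact Eventually.of_forall fun k => ENNReal.natCast_lt_top k

/-- Additivity holds only almost surely, because passing to real values requires both random masses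
to be finite. -/
theorem IsPoissonRandomMeasure.compensated_union [IsProbabilityMeasure P]
    (hN : IsPoissonRandomMeasure P ℱ m N)
    {B B' : Set (ℝ × E)} (hB : MeasurableSet B) (hB' : MeasurableSet B')
    (hfin : intensity m B < ∞) (hfin' : intensity m B' < ∞) (hd : Disjoint B B') :
    ∀ᵐ ω ∂P, compensated m N (B ∪ B') ω = compensated m N B ω + compensated m N B' ω := by
  filter_upwards [hN.ae_lt_top hB hfin, hN.ae_lt_top hB' hfin'] with ω h1 h2
  rw [compensated, measureReal_union hd hB' h1.ne h2.ne,
    measureReal_union hd hB' hfin.ne hfin'.ne, compensated, compensated]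
  ring

theorem compensated_empty (ω : Ω) : compensated m N ∅ ω = 0 := by simp [compensated]

/-- The `σ`-algebra generated by the restriction of `N` to `(s, ∞) × E`. -/
abbrev futureSigma (N : Ω → Measure (ℝ × E)) (s : ℝ≥0) : MeasurableSpace Ω :=
  ⨆ B ∈ {B : Set (ℝ × E) | MeasurableSet B ∧ B ⊆ Ioi (s : ℝ) ×ˢ univ},
    MeasurableSpace.comap (fun ω => N ω B) inferInstance

theorem measurable_compensated_future {s : ℝ≥0} {B : Set (ℝ × E)} (hB : MeasurableSet B)
    (hs : B ⊆ Ioi (s : ℝ) ×ˢ univ) : Measurable[futureSigma N s] (compensated m N B) := by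
  refine measurable_compensated_of_measurable ?_
  refine Measurable.mono (comap_measurable fun ω => N ω B) ?_ le_rfl
  exact le_iSup₂_of_le B ⟨hB, hs⟩ le_rfl

theorem IsPoissonRandomMeasure.futureSigma_le (hN : IsPoissonRandomMeasure P ℱ m N) (s : ℝ≥0) :
    futureSigma N s ≤ mΩ :=
  iSup₂_le fun B hB => (hN.measurable B hB.1).comap_le

/-- The future of the random measure factors out of expectations of past random variables. -/
theorem IsPoissonRandomMeasure.integral_mul_future [IsProbabilityMeasure P]
    (hN : IsPoissonRandomMeasure P ℱ m N) {s : ℝ≥0} {X Y : Ω → ℝ}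
    (hX : StronglyMeasurable[ℱ s] X) (hY : Measurable[futureSigma N s] Y) :
    ∫ ω, X ω * Y ω ∂P = (∫ ω, X ω ∂P) * ∫ ω, Y ω ∂P := by
  have hind : IndepFun X Y P := by
    have h1 := (hN.indep_past s).symm
    exact indep_of_indep_of_le_left (indep_of_indep_of_le_right h1 hY.comap_le)
      hX.measurable.comap_le
  exact hind.integral_fun_mul_eq_mul_integral (hX.mono (ℱ.le s)).aestronglyMeasurable
    (hY.mono (hN.futureSigma_le s) le_rfl).aestronglyMeasurable

theorem IsPoissonRandomMeasure.integral_mul_compensated [IsProbabilityMeasure P]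
    (hN : IsPoissonRandomMeasure P ℱ m N) {s : ℝ≥0} {X : Ω → ℝ} (hX : StronglyMeasurable[ℱ s] X)
    {B : Set (ℝ × E)} (hB : MeasurableSet B) (hfin : intensity m B < ∞)
    (hs : B ⊆ Ioi (s : ℝ) ×ˢ univ) : ∫ ω, X ω * compensated m N B ω ∂P = 0 := by
  rw [hN.integral_mul_future hX (measurable_compensated_future hB hs),
    (hN.compensated_moments hB hfin).2.1, mul_zero]

theorem IsPoissonRandomMeasure.integral_mul_compensated_sq [IsProbabilityMeasure P]
    (hN : IsPoissonRandomMeasure P ℱ m N) {s : ℝ≥0} {X : Ω → ℝ} (hX : StronglyMeasurable[ℱ s] X)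
    {B : Set (ℝ × E)} (hB : MeasurableSet B) (hfin : intensity m B < ∞)
    (hs : B ⊆ Ioi (s : ℝ) ×ˢ univ) :
    ∫ ω, X ω * compensated m N B ω ^ 2 ∂P = (∫ ω, X ω ∂P) * (intensity m).real B := by
  rw [hN.integral_mul_future hX ((measurable_compensated_future hB hs).pow_const 2),
    (hN.compensated_moments hB hfin).2.2]

/-- Covers disjoint sets over the same time interval, where the filtration cannot separate the two
factors and independence over disjoint sets is needed in addition. -/
theorem IsPoissonRandomMeasure.integral_mul_compensated_mul [IsProbabilityMeasure P]
    (hN : IsPoissonRandomMeasure P ℱ m N) {s : ℝ≥0} {X : Ω → ℝ} (hX : StronglyMeasurable[ℱ s] X)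
    {B B' : Set (ℝ × E)} (hB : MeasurableSet B) (hB' : MeasurableSet B') (hfin : intensity m B < ∞)
    (hd : Disjoint B B') (hs : B ⊆ Ioi (s : ℝ) ×ˢ univ) (hs' : B' ⊆ Ioi (s : ℝ) ×ˢ univ) :
    ∫ ω, X ω * (compensated m N B ω * compensated m N B' ω) ∂P = 0 := by
  have hind : IndepFun (compensated m N B) (compensated m N B') P := by
    have h1 := hN.indep 2 ![B, B'] (by intro i; fin_cases i <;> simpa) (by
      intro i j hij
      fin_cases i <;> fin_cases j
      · exact absurd rfl hij
      · exact hd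
      · exact hd.symm
      · exact absurd rfl hij)
    have h2 := h1.indepFun (show (0 : Fin 2) ≠ 1 by decide)
    exact h2.comp (φ := fun x : ℝ≥0∞ => x.toReal - (intensity m).real B)
      (ψ := fun x : ℝ≥0∞ => x.toReal - (intensity m).real B')
      (measurable_id.ennreal_toReal.sub_const _) (measurable_id.ennreal_toReal.sub_const _)
  have hm : Measurable[futureSigma N s] fun ω => compensated m N B ω * compensated m N B' ω :=
    (measurable_compensated_future hB hs).mul (measurable_compensated_future hB' hs')
  rw [hN.integral_mul_future hX hm,
    hind.integral_fun_mul_eq_mul_integral (hN.measurable_compensated hB).aestronglyMeasurable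
      (hN.measurable_compensated hB').aestronglyMeasurable,
    (hN.compensated_moments hB hfin).2.1, zero_mul, mul_zero]

theorem IsPoissonRandomMeasure.stronglyMeasurable_compensated
    (hN : IsPoissonRandomMeasure P ℱ m N) {t : ℝ≥0}
    {B : Set (ℝ × E)} (hB : MeasurableSet B) (ht : B ⊆ Iic (t : ℝ) ×ˢ univ) :
    StronglyMeasurable[ℱ t] (compensated m N B) :=
  (measurable_compensated_of_measurable (hN.adapted t B hB ht)).stronglyMeasurable

end Noise

/-! ### Simple predictable functions: Itô isometry and martingale property -/

section Isometry
variable {Ω E : Type*} {mΩ : MeasurableSpace Ω} [MeasurableSpace E]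
  {P : Measure Ω} {ℱ : Filtration ℝ≥0 mΩ} {m : Measure E} {N : Ω → Measure (ℝ × E)}

instance [SigmaFinite m] : SigmaFinite (intensity m) := by unfold intensity; infer_instance

/-- The rectangle `(τ_i ∧ t, τ_{i+1} ∧ t] × A_j`. -/
def SimplePredictable.cell (φ : SimplePredictable ℱ m) (t : ℝ≥0) (p : ℕ × Fin φ.l) : Set (ℝ × E) :=
  Ioc (min (φ.τ p.1) t : ℝ) (min (φ.τ (p.1 + 1)) t) ×ˢ φ.A p.2

/-- The index set of a simple predictable function. -/
def SimplePredictable.idx (φ : SimplePredictable ℱ m) : Finset (ℕ × Fin φ.l) :=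
  Finset.range φ.k ×ˢ Finset.univ

variable (φ : SimplePredictable ℱ m) (t : ℝ≥0)

theorem SimplePredictable.integral_eq (ω : Ω) :
    φ.integral N t ω = ∑ p ∈ φ.idx, φ.ξ p.1 p.2 ω * compensated m N (φ.cell t p) ω := by
  rw [SimplePredictable.integral, SimplePredictable.idx, Finset.sum_product]
  rfl

theorem SimplePredictable.measurableSet_cell (p : ℕ × Fin φ.l) : MeasurableSet (φ.cell t p) :=
  measurableSet_Ioc.prod (φ.A_measurable p.2)

theorem SimplePredictable.intensity_cell_lt_top [SigmaFinite m] (p : ℕ × Fin φ.l) :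
    intensity m (φ.cell t p) < ∞ := by
  rw [intensity, SimplePredictable.cell, Measure.prod_prod]
  refine ENNReal.mul_lt_top ((Measure.restrict_apply_le _ _).trans_lt ?_) (φ.A_finite p.2)
  simp

theorem SimplePredictable.cell_eq_empty {p : ℕ × Fin φ.l} (h : t ≤ φ.τ p.1) :
    φ.cell t p = ∅ := by
  have h1 : (t : ℝ) ≤ φ.τ p.1 := by exact_mod_cast h
  rw [SimplePredictable.cell, min_eq_right h1, Ioc_eq_empty (not_lt.2 (min_le_right _ _)),
    empty_prod]

theorem SimplePredictable.cell_subset_Ioi {p : ℕ × Fin φ.l} (h : φ.τ p.1 ≤ t) :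
    φ.cell t p ⊆ Ioi (φ.τ p.1 : ℝ) ×ˢ univ := by
  have h1 : (φ.τ p.1 : ℝ) ≤ t := by exact_mod_cast h
  rw [SimplePredictable.cell, min_eq_left h1]
  exact prod_mono Ioc_subset_Ioi_self (subset_univ _)

theorem SimplePredictable.cell_subset_Iic (p : ℕ × Fin φ.l) :
    φ.cell t p ⊆ Iic (φ.τ (p.1 + 1) : ℝ) ×ˢ univ :=
  prod_mono (fun _ hx => hx.2.trans (min_le_left _ _)) (subset_univ _)

theorem SimplePredictable.disjoint_cell {p q : ℕ × Fin φ.l} (h : p ≠ q) :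
    Disjoint (φ.cell t p) (φ.cell t q) := by
  have key : ∀ {p q : ℕ × Fin φ.l}, p.1 < q.1 → Disjoint (φ.cell t p) (φ.cell t q) := by
    intro p q hlt
    refine disjoint_left.2 fun x hx hx' => ?_
    have h1 : x.1 ≤ min (φ.τ (p.1 + 1) : ℝ) t := hx.1.2
    have h2 : min (φ.τ q.1 : ℝ) t < x.1 := hx'.1.1
    have h3 : (φ.τ (p.1 + 1) : ℝ) ≤ φ.τ q.1 := by exact_mod_cast φ.τ_mono hlt
    have h4 := min_le_min_right (t : ℝ) h3
    linarith
  rcases lt_trichotomy p.1 q.1 with hlt | heq | hgt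
  · exact key hlt
  · have hne : p.2 ≠ q.2 := fun h' => h (Prod.ext heq h')
    exact disjoint_left.2 fun x hx hx' => disjoint_left.1 (φ.A_disjoint hne) hx.2 hx'.2
  · exact (key hgt).symm

theorem SimplePredictable.memLp_ξ [IsProbabilityMeasure P] (i : ℕ) (j : Fin φ.l) (p : ℝ≥0∞) :
    MemLp (φ.ξ i j) p P := by
  obtain ⟨c, hc⟩ := φ.ξ_bounded i j
  exact MemLp.of_bound ((φ.ξ_measurable i j).mono (ℱ.le _)).aestronglyMeasurable c
    (Eventually.of_forall hc)

theorem SimplePredictable.memLp_term [SigmaFinite m] [IsProbabilityMeasure P]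
    (hN : IsPoissonRandomMeasure P ℱ m N)
    (p : ℕ × Fin φ.l) :
    MemLp (fun ω => φ.ξ p.1 p.2 ω * compensated m N (φ.cell t p) ω) 2 P :=
  (hN.compensated_moments (φ.measurableSet_cell t p) (φ.intensity_cell_lt_top t p)).1.mul
    (φ.memLp_ξ p.1 p.2 ∞)

theorem SimplePredictable.memLp_integral [SigmaFinite m] [IsProbabilityMeasure P]
    (hN : IsPoissonRandomMeasure P ℱ m N) : MemLp (φ.integral N t) 2 P := by
  have : φ.integral N t = fun ω =>
      ∑ p ∈ φ.idx, φ.ξ p.1 p.2 ω * compensated m N (φ.cell t p) ω :=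
    funext fun ω => φ.integral_eq t ω
  rw [this]
  exact memLp_finsetSum _ fun p _ => φ.memLp_term t hN p

/-- On the diagonal the variance of the compensated mass appears. For different time intervals the
later increment is centred and independent of everything else in the product. For the same interval
the two masses are independent and centred, and independent of the coefficients. -/
theorem SimplePredictable.integral_term_mul [SigmaFinite m] [IsProbabilityMeasure P]
    (hN : IsPoissonRandomMeasure P ℱ m N) (p q : ℕ × Fin φ.l) :
    ∫ ω, (φ.ξ p.1 p.2 ω * compensated m N (φ.cell t p) ω)
        * (φ.ξ q.1 q.2 ω * compensated m N (φ.cell t q) ω) ∂P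
      = (∫ ω, φ.ξ p.1 p.2 ω * φ.ξ q.1 q.2 ω ∂P)
        * (intensity m).real (φ.cell t p ∩ φ.cell t q) := by
  by_cases hpq : p = q
  · subst hpq
    rw [inter_self]
    rcases le_total t (φ.τ p.1) with h | h
    · simp [φ.cell_eq_empty t h, compensated_empty]
    · rw [← hN.integral_mul_compensated_sq (s := φ.τ p.1) (X := fun ω => φ.ξ p.1 p.2 ω * φ.ξ p.1 p.2 ω)
        ((φ.ξ_measurable _ _).mul (φ.ξ_measurable _ _)) (φ.measurableSet_cell t p)
        (φ.intensity_cell_lt_top t p) (φ.cell_subset_Ioi t h)]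
      exact integral_congr_ae (Eventually.of_forall fun ω => by ring)
  rw [(φ.disjoint_cell t hpq).inter_eq, measureReal_empty, mul_zero]
  have key : ∀ {p q : ℕ × Fin φ.l}, p.1 < q.1 →
      ∫ ω, (φ.ξ p.1 p.2 ω * compensated m N (φ.cell t p) ω)
        * (φ.ξ q.1 q.2 ω * compensated m N (φ.cell t q) ω) ∂P = 0 := by
    intro p q hlt
    rcases le_total t (φ.τ q.1) with h | h
    · simp [φ.cell_eq_empty t h, compensated_empty]
    · have hτ : φ.τ (p.1 + 1) ≤ φ.τ q.1 := φ.τ_mono hlt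
      have hτ' : φ.τ p.1 ≤ φ.τ q.1 := φ.τ_mono hlt.le
      have hC : StronglyMeasurable[ℱ (φ.τ q.1)] (compensated m N (φ.cell t p)) :=
        (hN.stronglyMeasurable_compensated (φ.measurableSet_cell t p)
          (φ.cell_subset_Iic t p)).mono (ℱ.mono hτ)
      have hX : StronglyMeasurable[ℱ (φ.τ q.1)] fun ω =>
          (φ.ξ p.1 p.2 ω * compensated m N (φ.cell t p) ω) * φ.ξ q.1 q.2 ω :=
        (((φ.ξ_measurable _ _).mono (ℱ.mono hτ')).mul hC).mul (φ.ξ_measurable _ _)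
      rw [← hN.integral_mul_compensated hX (φ.measurableSet_cell t q)
        (φ.intensity_cell_lt_top t q) (φ.cell_subset_Ioi t h)]
      exact integral_congr_ae (Eventually.of_forall fun ω => by ring)
  rcases lt_trichotomy p.1 q.1 with hlt | heq | hgt
  · exact key hlt
  · rcases le_total t (φ.τ q.1) with h | h
    · simp [φ.cell_eq_empty t h, compensated_empty]
    · have hX : StronglyMeasurable[ℱ (φ.τ q.1)] fun ω => φ.ξ p.1 p.2 ω * φ.ξ q.1 q.2 ω :=
        ((φ.ξ_measurable p.1 p.2).mono (ℱ.mono (by rw [heq]))).mul (φ.ξ_measurable _ _)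
      have hs := φ.cell_subset_Ioi t h
      have hs' := φ.cell_subset_Ioi t (p := p) (heq ▸ h)
      rw [heq] at hs'
      rw [← hN.integral_mul_compensated_mul hX (φ.measurableSet_cell t p)
        (φ.measurableSet_cell t q) (φ.intensity_cell_lt_top t p) (φ.disjoint_cell t hpq) hs' hs]
      exact integral_congr_ae (Eventually.of_forall fun ω => by ring)
  · rw [← key hgt]
    exact integral_congr_ae (Eventually.of_forall fun ω => by ring)

theorem integral_sum_sq {X ι : Type*} {mX : MeasurableSpace X} {μ : Measure X} (s : Finset ι)
    (F : ι → X → ℝ) (hF : ∀ i ∈ s, MemLp (F i) 2 μ) :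
    ∫ x, (∑ i ∈ s, F i x) ^ 2 ∂μ = ∑ i ∈ s, ∑ j ∈ s, ∫ x, F i x * F j x ∂μ := by
  simp only [pow_two, Finset.sum_mul_sum]
  have hint : ∀ i ∈ s, ∀ j ∈ s, Integrable (fun x => F i x * F j x) μ := fun i hi j hj =>
    (hF i hi).integrable_mul (hF j hj)
  rw [integral_finsetSum _ fun i hi => integrable_finsetSum _ fun j hj => hint i hi j hj]
  exact Finset.sum_congr rfl fun i hi => integral_finsetSum _ fun j hj => hint i hi j hj

/-- The terms of a simple predictable function stopped at `t`. -/
def SimplePredictable.stoppedTerm (p : ℕ × Fin φ.l) (x : Ω × ℝ × E) : ℝ :=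
  φ.ξ p.1 p.2 x.1 * (φ.cell t p).indicator 1 x.2

theorem SimplePredictable.stopped_eq (x : Ω × ℝ × E) :
    (Iic (t : ℝ)).indicator (fun _ => φ.toFun x) x.2.1 = ∑ p ∈ φ.idx, φ.stoppedTerm t p x := by
  rw [SimplePredictable.idx, Finset.sum_product]
  by_cases hx : x.2.1 ∈ Iic (t : ℝ)
  · rw [indicator_of_mem hx, SimplePredictable.toFun]
    refine Finset.sum_congr rfl fun i _ => Finset.sum_congr rfl fun j _ => ?_
    have hx : x.2.1 ≤ t := hx
    have hiff : x.2 ∈ φ.cell t (i, j) ↔ x.2 ∈ Ioc (φ.τ i : ℝ) (φ.τ (i + 1)) ×ˢ φ.A j := by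
      simp only [SimplePredictable.cell, mem_prod, mem_Ioc, le_min_iff, min_lt_iff, hx, and_true,
        not_lt.2 hx, or_false]
    rw [SimplePredictable.stoppedTerm]
    by_cases h : x.2 ∈ φ.cell t (i, j)
    · rw [indicator_of_mem h, indicator_of_mem (hiff.1 h)]; simp
    · rw [indicator_of_notMem h, indicator_of_notMem (fun h' => h (hiff.2 h'))]; simp
  · rw [indicator_of_notMem hx]
    refine (Finset.sum_eq_zero fun i _ => Finset.sum_eq_zero fun j _ => ?_).symm
    rw [SimplePredictable.stoppedTerm, indicator_of_notMem, mul_zero]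
    intro h
    exact hx (h.1.2.trans (min_le_right _ _))

theorem SimplePredictable.memLp_stoppedTerm [SigmaFinite m] [IsProbabilityMeasure P]
    (p : ℕ × Fin φ.l) : MemLp (φ.stoppedTerm t p) 2 (P.prod (intensity m)) := by
  have h1 : MemLp ((φ.cell t p).indicator (1 : ℝ × E → ℝ)) 2 (intensity m) :=
    memLp_indicator_const 2 (φ.measurableSet_cell t p) 1 (Or.inr (φ.intensity_cell_lt_top t p).ne)
  have h2 := φ.memLp_ξ (P := P) p.1 p.2 2
  have hm : AEStronglyMeasurable (φ.stoppedTerm t p) (P.prod (intensity m)) :=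
    h2.1.comp_fst.mul h1.1.comp_snd
  rw [memLp_two_iff_integrable_sq hm]
  have h3 := (h2.integrable_sq).mul_prod h1.integrable_sq
  refine h3.congr (Eventually.of_forall fun x => ?_)
  simp only [SimplePredictable.stoppedTerm, mul_pow]

theorem SimplePredictable.integral_stoppedTerm_mul [SigmaFinite m] [IsProbabilityMeasure P]
    (p q : ℕ × Fin φ.l) :
    ∫ x, φ.stoppedTerm t p x * φ.stoppedTerm t q x ∂(P.prod (intensity m))
      = (∫ ω, φ.ξ p.1 p.2 ω * φ.ξ q.1 q.2 ω ∂P)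
        * (intensity m).real (φ.cell t p ∩ φ.cell t q) := by
  rw [← integral_indicator_one ((φ.measurableSet_cell t p).inter (φ.measurableSet_cell t q)),
    ← integral_prod_mul]
  refine integral_congr_ae (Eventually.of_forall fun x => ?_)
  simp only [SimplePredictable.stoppedTerm, inter_indicator_one, Pi.mul_apply]
  ring

theorem eLpNorm_two_eq_of_integral_sq_eq {X Y : Type*} {mX : MeasurableSpace X}
    {mY : MeasurableSpace Y} {μ : Measure X} {ν : Measure Y} {F : X → ℝ} {G : Y → ℝ}
    (hF : MemLp F 2 μ) (hG : MemLp G 2 ν) (h : ∫ x, F x ^ 2 ∂μ = ∫ y, G y ^ 2 ∂ν) :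
    eLpNorm F 2 μ = eLpNorm G 2 ν := by
  rw [hF.eLpNorm_eq_integral_rpow_norm two_ne_zero ENNReal.ofNat_ne_top,
    hG.eLpNorm_eq_integral_rpow_norm two_ne_zero ENNReal.ofNat_ne_top]
  simp [h]

/-- The Itô isometry for simple predictable functions. -/
theorem SimplePredictable.eLpNorm_integral [SigmaFinite m] [IsProbabilityMeasure P]
    (hN : IsPoissonRandomMeasure P ℱ m N) :
    eLpNorm (φ.integral N t) 2 P
      = eLpNorm (fun x : Ω × ℝ × E => (Iic (t : ℝ)).indicator (fun _ => φ.toFun x) x.2.1) 2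
        (P.prod (intensity m)) := by
  have h1 : (fun x : Ω × ℝ × E => (Iic (t : ℝ)).indicator (fun _ => φ.toFun x) x.2.1)
      = fun x => ∑ p ∈ φ.idx, φ.stoppedTerm t p x := funext (φ.stopped_eq t)
  refine eLpNorm_two_eq_of_integral_sq_eq (φ.memLp_integral t hN) ?_ ?_
  · rw [h1]
    exact memLp_finsetSum _ fun p _ => φ.memLp_stoppedTerm t p
  -- Both squares expand into double sums, and the entries agree one by one.
  · simp only [φ.stopped_eq t, SimplePredictable.integral_eq]
    rw [integral_sum_sq _ _ fun p _ => φ.memLp_term t hN p,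
      integral_sum_sq _ _ fun p _ => φ.memLp_stoppedTerm t p]
    simp only [φ.integral_term_mul t hN, φ.integral_stoppedTerm_mul]

theorem SimplePredictable.measurable_toFun : Measurable φ.toFun := by
  unfold SimplePredictable.toFun
  refine Finset.measurable_sum _ fun i _ => Finset.measurable_sum _ fun j _ => ?_
  have h1 : (fun p : Ω × ℝ × E => (Ioc (φ.τ i : ℝ) (φ.τ (i + 1)) ×ˢ φ.A j).indicator
      (fun _ => φ.ξ i j p.1) p.2)
      = (Prod.snd ⁻¹' (Ioc (φ.τ i : ℝ) (φ.τ (i + 1)) ×ˢ φ.A j)).indicator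
        (fun p : Ω × ℝ × E => φ.ξ i j p.1) := rfl
  rw [h1]
  exact (((φ.ξ_measurable i j).mono (ℱ.le _)).measurable.comp measurable_fst).indicator
    ((measurableSet_Ioc.prod (φ.A_measurable j)).preimage measurable_snd)

/-- The part `((τ_i ∧ t) ∨ s, (τ_{i+1} ∧ t) ∨ s] × A_j` of a cell that lies after time `s`. -/
def SimplePredictable.lateCell (s : ℝ≥0) (p : ℕ × Fin φ.l) : Set (ℝ × E) :=
  Ioc (max (min (φ.τ p.1) t) s : ℝ) (max (min (φ.τ (p.1 + 1)) t) s) ×ˢ φ.A p.2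

variable {s : ℝ≥0}

theorem SimplePredictable.cell_eq_union (hst : s ≤ t) (p : ℕ × Fin φ.l) :
    φ.cell t p = φ.cell s p ∪ φ.lateCell t s p ∧ Disjoint (φ.cell s p) (φ.lateCell t s p) := by
  have h1 : (φ.τ p.1 : ℝ) ≤ φ.τ (p.1 + 1) := by exact_mod_cast φ.τ_mono (Nat.le_succ _)
  have h2 : (s : ℝ) ≤ t := by exact_mod_cast hst
  constructor
  · rw [SimplePredictable.cell, SimplePredictable.cell, SimplePredictable.lateCell, ← union_prod]
    congr 1
    ext x
    simp only [mem_Ioc, mem_union, min_lt_iff, le_min_iff, max_lt_iff, le_max_iff]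
    grind
  · refine disjoint_left.2 fun x hx hx' => ?_
    have h3 : x.1 ≤ min (φ.τ (p.1 + 1) : ℝ) s := hx.1.2
    have h4 : max (min (φ.τ p.1 : ℝ) t) s < x.1 := hx'.1.1
    have h5 := min_le_right (φ.τ (p.1 + 1) : ℝ) s
    have h6 := le_max_right (min (φ.τ p.1 : ℝ) t) s
    linarith

/-- The martingale property of the integral of a simple predictable function. -/
theorem SimplePredictable.integral_mul_eq [SigmaFinite m] [IsProbabilityMeasure P]
    (hN : IsPoissonRandomMeasure P ℱ m N) (hst : s ≤ t) {Y : Ω → ℝ}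
    (hY : StronglyMeasurable[ℱ s] Y) (hY2 : MemLp Y 2 P) :
    ∫ ω, Y ω * φ.integral N t ω ∂P = ∫ ω, Y ω * φ.integral N s ω ∂P := by
  simp only [SimplePredictable.integral_eq, Finset.mul_sum]
  have hint : ∀ r : ℝ≥0, ∀ p, Integrable
      (fun ω => Y ω * (φ.ξ p.1 p.2 ω * compensated m N (φ.cell r p) ω)) P := fun r p =>
    hY2.integrable_mul (φ.memLp_term r hN p)
  rw [integral_finsetSum _ fun p _ => hint t p, integral_finsetSum _ fun p _ => hint s p]
  refine Finset.sum_congr rfl fun p _ => ?_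
  obtain ⟨hu, hd⟩ := φ.cell_eq_union t hst p
  have hm : MeasurableSet (φ.lateCell t s p) := measurableSet_Ioc.prod (φ.A_measurable p.2)
  have hfin : intensity m (φ.lateCell t s p) < ∞ := by
    refine (measure_mono ?_).trans_lt (φ.intensity_cell_lt_top t p)
    rw [hu]; exact subset_union_right
  have hL : MemLp (fun ω => φ.ξ p.1 p.2 ω * compensated m N (φ.lateCell t s p) ω) 2 P :=
    (hN.compensated_moments hm hfin).1.mul (φ.memLp_ξ p.1 p.2 ∞)
  -- `Y` times the coefficient is known at time `max τ_i s`, and the late cell lies strictly after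
  -- that time.
  have hzero : ∫ ω, Y ω * (φ.ξ p.1 p.2 ω * compensated m N (φ.lateCell t s p) ω) ∂P = 0 := by
    rcases le_total t (φ.τ p.1) with h | h
    · have : φ.lateCell t s p = ∅ := by
        have h1 := φ.cell_eq_empty t h
        rw [hu] at h1
        exact (union_empty_iff.1 h1).2
      simp [this, compensated_empty]
    · have hX : StronglyMeasurable[ℱ (max (φ.τ p.1) s)] fun ω => Y ω * φ.ξ p.1 p.2 ω :=
        (hY.mono (ℱ.mono (le_max_right _ _))).mul
          ((φ.ξ_measurable _ _).mono (ℱ.mono (le_max_left _ _)))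
      have hsub : φ.lateCell t s p ⊆ Ioi ((max (φ.τ p.1) s : ℝ≥0) : ℝ) ×ˢ univ := by
        have h1 : (φ.τ p.1 : ℝ) ≤ t := by exact_mod_cast h
        rw [SimplePredictable.lateCell, min_eq_left h1, NNReal.coe_max]
        exact prod_mono Ioc_subset_Ioi_self (subset_univ _)
      rw [← hN.integral_mul_compensated hX hm hfin hsub]
      exact integral_congr_ae (Eventually.of_forall fun ω => by ring)
  have hae := hN.compensated_union (φ.measurableSet_cell s p) hm (φ.intensity_cell_lt_top s p)
    hfin hd
  have hintL : Integrable
      (fun ω => Y ω * (φ.ξ p.1 p.2 ω * compensated m N (φ.lateCell t s p) ω)) P :=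
    hY2.integrable_mul hL
  rw [← add_zero (∫ ω, Y ω * (φ.ξ p.1 p.2 ω * compensated m N (φ.cell s p) ω) ∂P), ← hzero,
    ← integral_add (hint s p) hintL]
  refine integral_congr_ae ?_
  filter_upwards [hae] with ω hω
  rw [hu, hω]
  ring

end Isometry

theorem eLpNorm_two_sq {X : Type*} {mX : MeasurableSpace X} {μ : Measure X} (F : X → ℝ) :
    eLpNorm F 2 μ ^ 2 = ∫⁻ x, ENNReal.ofReal (F x ^ 2) ∂μ := by
  have h := eLpNorm_nnreal_pow_eq_lintegral (f := F) (μ := μ) (p := 2) two_ne_zero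
  simp only [NNReal.coe_ofNat, ENNReal.rpow_ofNat, ENNReal.coe_ofNat] at h
  rw [h]
  refine lintegral_congr fun x => ?_
  rw [← ofReal_norm, ← ENNReal.ofReal_pow (norm_nonneg _), Real.norm_eq_abs, sq_abs]

theorem MeasureTheory.MemLp.eLpNorm_two_sq_eq {X : Type*} {mX : MeasurableSpace X} {μ : Measure X}
    {F : X → ℝ} (hF : MemLp F 2 μ) : eLpNorm F 2 μ ^ 2 = ENNReal.ofReal (∫ x, F x ^ 2 ∂μ) := by
  rw [eLpNorm_two_sq, ofReal_integral_eq_lintegral_ofReal hF.integrable_sq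
    (Eventually.of_forall fun x => sq_nonneg _)]

/-! ### Passage to general integrands -/

section StochasticIntegral
variable {Ω E : Type*} {mΩ : MeasurableSpace Ω} [MeasurableSpace E]
  {P : Measure Ω} {ℱ : Filtration ℝ≥0 mΩ} {m : Measure E} {N : Ω → Measure (ℝ × E)}
  {g : Ω × ℝ × E → ℝ} {I : ℝ≥0 → Ω → ℝ}

/-- The function `g` stopped at time `t`. -/
def stopAt (g : Ω × ℝ × E → ℝ) (t : ℝ≥0) (x : Ω × ℝ × E) : ℝ :=
  (Iic (t : ℝ)).indicator (fun _ => g x) x.2.1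

theorem MeasureTheory.AEStronglyMeasurable.stopAt {μ : Measure (Ω × ℝ × E)}
    (hg : AEStronglyMeasurable g μ) (t : ℝ≥0) : AEStronglyMeasurable (stopAt g t) μ :=
  hg.indicator (s := (fun x : Ω × ℝ × E => x.2.1) ⁻¹' Iic (t : ℝ))
    (measurableSet_Iic.preimage (by fun_prop))

theorem norm_stopAt_le {Ω E : Type*} (g : Ω × ℝ × E → ℝ) (t : ℝ≥0) (x : Ω × ℝ × E) :
    ‖stopAt g t x‖ ≤ ‖g x‖ := by
  unfold stopAt
  by_cases h : x.2.1 ∈ Iic (t : ℝ)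
  · rw [indicator_of_mem h]
  · rw [indicator_of_notMem h, norm_zero]; exact norm_nonneg _

theorem IsStochasticIntegral.aestronglyMeasurable (hI : IsStochasticIntegral P ℱ m N g I) (t : ℝ≥0) :
    AEStronglyMeasurable (I t) P := ((hI.1 t).mono (ℱ.le t)).aestronglyMeasurable

/-- One half of the Itô isometry. -/
theorem IsStochasticIntegral.eLpNorm_le [SigmaFinite m] [IsProbabilityMeasure P]
    (hN : IsPoissonRandomMeasure P ℱ m N) (hI : IsStochasticIntegral P ℱ m N g I)
    (hg : AEStronglyMeasurable g (P.prod (intensity m))) (t : ℝ≥0) :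
    eLpNorm (I t) 2 P ≤ eLpNorm (stopAt g t) 2 (P.prod (intensity m)) := by
  have hmI := hI.aestronglyMeasurable t
  obtain ⟨-, -, φ, hφ, hφt⟩ := hI
  set e : ℝ≥0∞ := eLpNorm (stopAt g t) 2 (P.prod (intensity m))
  -- Triangle inequality through the `k`-th approximant and its isometry; stopping does not increase
  -- the approximation error of the integrand, so both errors vanish in the limit.
  have hle : ∀ k, eLpNorm (I t) 2 P
      ≤ eLpNorm (fun ω => (φ k).integral N t ω - I t ω) 2 P
        + (eLpNorm (fun p => (φ k).toFun p - g p) 2 (P.prod (intensity m)) + e) := by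
    intro k
    have hm1 := ((φ k).memLp_integral t hN).1
    have hm2 := (φ k).measurable_toFun.aestronglyMeasurable (μ := P.prod (intensity m))
    have h1 : I t = (φ k).integral N t - fun ω => (φ k).integral N t ω - I t ω := by
      funext ω; simp
    have h2 : eLpNorm ((φ k).integral N t) 2 P
        ≤ eLpNorm (fun p => (φ k).toFun p - g p) 2 (P.prod (intensity m)) + e := by
      rw [(φ k).eLpNorm_integral t hN]
      have h3 : (fun x : Ω × ℝ × E => (Iic (t : ℝ)).indicator (fun _ => (φ k).toFun x) x.2.1)
          = stopAt (fun p => (φ k).toFun p - g p) t + stopAt g t := by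
        funext x
        simp only [stopAt, Pi.add_apply]
        by_cases h : x.2.1 ∈ Iic (t : ℝ)
        · simp only [indicator_of_mem h]; ring
        · simp only [indicator_of_notMem h]; ring
      rw [h3]
      refine (eLpNorm_add_le ((hm2.sub hg).stopAt t) (hg.stopAt t) one_le_two).trans ?_
      gcongr
      exact eLpNorm_mono (norm_stopAt_le _ t)
    calc eLpNorm (I t) 2 P
        ≤ eLpNorm ((φ k).integral N t) 2 P
          + eLpNorm (fun ω => (φ k).integral N t ω - I t ω) 2 P := by
          conv_lhs => rw [h1]
          exact eLpNorm_sub_le hm1 (hm1.sub hmI) one_le_two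
      _ ≤ _ := by rw [add_comm]; gcongr
  have hlim := (hφt t).add (hφ.add (tendsto_const_nhds (x := e)))
  rw [zero_add, zero_add] at hlim
  exact ge_of_tendsto' hlim hle

/-- By Cauchy-Schwarz, `L²` convergence of the integrals gives `L¹` convergence of the products with
a fixed `Y`. -/
theorem IsStochasticIntegral.tendsto_integral_mul [SigmaFinite m] [IsProbabilityMeasure P]
    (hN : IsPoissonRandomMeasure P ℱ m N) {t : ℝ≥0} {J Y : Ω → ℝ} (hY2 : MemLp Y 2 P)
    (hJ : MemLp J 2 P) {φ : ℕ → SimplePredictable ℱ m}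
    (h : Tendsto (fun k => eLpNorm (fun ω => (φ k).integral N t ω - J ω) 2 P) atTop (𝓝 0)) :
    Tendsto (fun k => ∫ ω, Y ω * (φ k).integral N t ω ∂P) atTop (𝓝 (∫ ω, Y ω * J ω ∂P)) := by
  refine tendsto_integral_of_L1' _ (hY2.integrable_mul hJ).aestronglyMeasurable
    (Eventually.of_forall fun k => hY2.integrable_mul ((φ k).memLp_integral t hN)) ?_
  have hle : ∀ k, eLpNorm ((fun ω => Y ω * (φ k).integral N t ω) - fun ω => Y ω * J ω) 1 P
      ≤ eLpNorm Y 2 P * eLpNorm (fun ω => (φ k).integral N t ω - J ω) 2 P := by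
    intro k
    have h1 := eLpNorm_smul_le_mul_eLpNorm (p := 2) (q := 2) (r := 1)
      (((φ k).memLp_integral t hN).1.sub hJ.1) hY2.1
    refine le_trans (le_of_eq ?_) h1
    congr 1
    funext ω
    simp only [Pi.sub_apply, Pi.smul_apply', smul_eq_mul]
    ring
  have h2 := ENNReal.Tendsto.const_mul h (Or.inr hY2.2.ne)
  rw [mul_zero] at h2
  exact tendsto_of_tendsto_of_tendsto_of_le_of_le tendsto_const_nhds h2 (fun _ => zero_le) hle

/-- The martingale property of the stochastic integral. -/
theorem IsStochasticIntegral.integral_mul_eq [SigmaFinite m] [IsProbabilityMeasure P]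
    (hN : IsPoissonRandomMeasure P ℱ m N) (hI : IsStochasticIntegral P ℱ m N g I)
    (hg : MemLp g 2 (P.prod (intensity m))) {s t : ℝ≥0} (hst : s ≤ t) {Y : Ω → ℝ}
    (hY : StronglyMeasurable[ℱ s] Y) (hY2 : MemLp Y 2 P) :
    ∫ ω, Y ω * I t ω ∂P = ∫ ω, Y ω * I s ω ∂P := by
  have hmem : ∀ r, MemLp (I r) 2 P := fun r =>
    ⟨hI.aestronglyMeasurable r, (hI.eLpNorm_le hN hg.1 r).trans_lt
      ((eLpNorm_mono (norm_stopAt_le g r)).trans_lt hg.2)⟩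
  obtain ⟨-, -, φ, hφ, hφt⟩ := hI
  have h1 := IsStochasticIntegral.tendsto_integral_mul hN hY2 (hmem t) (hφt t)
  have h2 := IsStochasticIntegral.tendsto_integral_mul hN hY2 (hmem s) (hφt s)
  refine tendsto_nhds_unique h1 (h2.congr fun k => ?_)
  exact ((φ k).integral_mul_eq t hN hst hY hY2).symm

/-- A process with almost surely right-continuous paths is jointly measurable up to null sets. -/
theorem aestronglyMeasurable_of_rightContinuous [SFinite P] (hI : ∀ t, Measurable (I t))
    (hc : ∀ᵐ ω ∂P, ∀ t, ContinuousWithinAt (fun s => I s ω) (Ici t) t) :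
    AEStronglyMeasurable (fun p : Ω × ℝ => I p.2.toNNReal p.1) (P.prod volume) := by
  -- A point of the grid of mesh `1/(k+1)` to the right of `t`; the `+ 1` keeps the approximation on
  -- the side where paths are continuous. Sampling at countably many times is jointly measurable.
  set r : ℕ → ℝ≥0 → ℝ≥0 := fun k t => (⌊(k + 1) * t⌋₊ + 1) / (k + 1) with hr
  have hrt : ∀ k t, t ≤ r k t := fun k t => by
    rw [hr]; simp only
    rw [le_div_iff₀ (by positivity), mul_comm]
    exact (Nat.lt_floor_add_one _).le
  have hrt2 : ∀ k t, r k t ≤ t + 1 / (k + 1) := fun k t => by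
    rw [hr]; simp only
    rw [add_div]
    gcongr
    rw [div_le_iff₀ (by positivity), mul_comm]
    exact Nat.floor_le zero_le
  have hlim : ∀ t, Tendsto (fun k => r k t) atTop (𝓝[Ici t] t) := by
    intro t
    refine tendsto_nhdsWithin_iff.2 ⟨?_, Eventually.of_forall fun k => hrt k t⟩
    have h1 : Tendsto (fun k : ℕ => t + 1 / ((k : ℝ≥0) + 1)) atTop (𝓝 (t + 0)) :=
      tendsto_const_nhds.add tendsto_one_div_add_atTop_nhds_zero_nat
    rw [add_zero] at h1
    exact tendsto_of_tendsto_of_tendsto_of_le_of_le tendsto_const_nhds h1 (fun k => hrt k t)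
      (fun k => hrt2 k t)
  refine aestronglyMeasurable_of_tendsto_ae atTop
    (f := fun k (p : Ω × ℝ) => I (r k p.2.toNNReal) p.1) (fun k => ?_) ?_
  · have h1 : Measurable fun q : Ω × ℕ => I ((q.2 + 1) / (k + 1)) q.1 :=
      measurable_from_prod_countable_left fun j => hI (((j : ℝ≥0) + 1) / ((k : ℝ≥0) + 1))
    have h2 : Measurable fun p : Ω × ℝ => (p.1, ⌊((k : ℝ≥0) + 1) * p.2.toNNReal⌋₊) :=
      measurable_fst.prodMk (Nat.measurable_floor.comp
        ((measurable_snd.real_toNNReal).const_mul _))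
    exact (h1.comp h2).aestronglyMeasurable
  · filter_upwards [Measure.quasiMeasurePreserving_fst.ae hc] with p hp
    exact (hp p.2.toNNReal).tendsto.comp (hlim _)

end StochasticIntegral

/-! ### The noise increments of the scheme -/

section NoiseIncrement
variable {Ω E : Type*} {mΩ : MeasurableSpace Ω} [MeasurableSpace E]
  {P : Measure Ω} {ℱ : Filtration ℝ≥0 mΩ} {m : Measure E} {N : Ω → Measure (ℝ × E)}
  {η : ℝ → E → ℝ} {Δt : ℝ} {n : ℕ} {X : Ω → ℝ}

/-- This dichotomy replaces an existence theorem: every later property of the noise is checked also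
for the default value `0`. -/
theorem noiseIncrement_cases (P : Measure Ω) (ℱ : Filtration ℝ≥0 mΩ) (m : Measure E)
    (N : Ω → Measure (ℝ × E)) (η : ℝ → E → ℝ) (Δt : ℝ) (n : ℕ) (X : Ω → ℝ) :
    (∃ I, IsStochasticIntegral P ℱ m N
      (fun p => (Ioc (n * Δt) ((n + 1) * Δt)).indicator (fun _ => η (X p.1) p.2.2) p.2.1) I ∧
      ∀ s, noiseIncrement P ℱ m N η Δt n X s = I s.toNNReal) ∨
    ∀ s, noiseIncrement P ℱ m N η Δt n X s = 0 := by
  unfold noiseIncrement stochasticIntegral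
  split_ifs with h
  · exact Or.inl ⟨h.choose, h.choose_spec, fun _ => rfl⟩
  · exact Or.inr fun _ => rfl

theorem stronglyMeasurable_noiseIncrement (s : ℝ) :
    StronglyMeasurable[ℱ s.toNNReal] (noiseIncrement P ℱ m N η Δt n X s) := by
  rcases noiseIncrement_cases P ℱ m N η Δt n X with ⟨I, hI, h⟩ | h
  · rw [h]; exact hI.1 _
  · rw [h]; exact stronglyMeasurable_zero

theorem aestronglyMeasurable_noiseIncrement [SFinite P] :
    AEStronglyMeasurable (fun p : Ω × ℝ => noiseIncrement P ℱ m N η Δt n X p.2 p.1)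
      (P.prod volume) := by
  rcases noiseIncrement_cases P ℱ m N η Δt n X with ⟨I, hI, h⟩ | h
  · simp only [h]
    exact aestronglyMeasurable_of_rightContinuous (fun t => ((hI.1 t).mono (ℱ.le t)).measurable)
      (hI.2.1.mono fun ω hω t => (hω t).1)
  · simp only [h]
    exact aestronglyMeasurable_const

variable {lam : ℝ} {h₁ : E → ℝ}

/-- The dominating function of the integrand of the noise. -/
def noiseBound (lam : ℝ) (h₁ : E → ℝ) (X : Ω → ℝ) (a b : ℝ) (p : Ω × ℝ × E) : ℝ :=
  lam * X p.1 * ((Ioc a b).indicator 1 p.2.1 * h₁ p.2.2)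

theorem memLp_noiseBound [SigmaFinite m] [IsProbabilityMeasure P] (hX : MemLp X 2 P)
    (hh₁ : MemLp h₁ 2 m) {a b : ℝ} (ha : 0 ≤ a) (hab : a ≤ b) :
    MemLp (noiseBound lam h₁ X a b) 2 (P.prod (intensity m)) ∧
      ∫ p, noiseBound lam h₁ X a b p ^ 2 ∂(P.prod (intensity m))
        = (b - a) * (lam ^ 2 * ∫ z, h₁ z ^ 2 ∂m) * ∫ ω, X ω ^ 2 ∂P := by
  have i1 : Integrable (fun ω => (lam * X ω) ^ 2) P := (hX.const_mul lam).integrable_sq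
  have hsq : ∀ t : ℝ, ((Ioc a b).indicator (1 : ℝ → ℝ) t) ^ 2 = (Ioc a b).indicator 1 t := fun t => by
    by_cases h : t ∈ Ioc a b <;> simp [h]
  have hfin : (volume.restrict (Ici (0 : ℝ))) (Ioc a b) ≠ ∞ :=
    ((Measure.restrict_apply_le _ _).trans_lt (by simp)).ne
  have i2 : Integrable (fun t : ℝ => ((Ioc a b).indicator (1 : ℝ → ℝ) t) ^ 2)
      (volume.restrict (Ici 0)) := by
    simp only [hsq]
    exact (integrable_indicator_iff measurableSet_Ioc).2 (integrableOn_const hfin)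
  have i3 := i2.mul_prod hh₁.integrable_sq
  have i4 := i1.mul_prod (ν := intensity m) i3
  have hm : AEStronglyMeasurable (noiseBound lam h₁ X a b) (P.prod (intensity m)) := by
    have hm2 : AEStronglyMeasurable (fun q : ℝ × E => (Ioc a b).indicator 1 q.1 * h₁ q.2)
        (intensity m) :=
      (measurable_one.indicator measurableSet_Ioc).aestronglyMeasurable.comp_fst.mul
        hh₁.1.comp_snd
    exact (hX.1.const_mul lam).comp_fst.mul hm2.comp_snd
  have hfun : (fun p => noiseBound lam h₁ X a b p ^ 2) = fun p : Ω × ℝ × E => (lam * X p.1) ^ 2 *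
      ((Ioc a b).indicator (1 : ℝ → ℝ) p.2.1 ^ 2 * h₁ p.2.2 ^ 2) := by
    funext p; simp only [noiseBound]; ring
  constructor
  · rw [memLp_two_iff_integrable_sq hm, hfun]
    exact i4
  · rw [hfun, integral_prod_mul (fun ω => (lam * X ω) ^ 2) (fun q : ℝ × E =>
      (Ioc a b).indicator (1 : ℝ → ℝ) q.1 ^ 2 * h₁ q.2 ^ 2), intensity,
      integral_prod_mul (fun t : ℝ => (Ioc a b).indicator (1 : ℝ → ℝ) t ^ 2)
      (fun z => h₁ z ^ 2)]
    simp only [hsq, mul_pow]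
    have hsub : Ioc a b ∩ Ici 0 = Ioc a b :=
      inter_eq_left.2 fun t ht => ha.trans ht.1.le
    rw [integral_indicator_one measurableSet_Ioc, integral_const_mul,
      measureReal_restrict_apply measurableSet_Ioc, hsub, Real.volume_real_Ioc_of_le hab]
    ring

/-- A function continuous in `u` and measurable in `z` is jointly measurable; continuity is the
Lipschitz bound with `h₁ ≤ 1`. -/
theorem measurable_uncurry_noise (hη_meas : ∀ u, Measurable (η u)) (hh₁ : ∀ z, 0 ≤ h₁ z ∧ h₁ z ≤ 1)
    (hη_lip : ∀ u w z, |η u z - η w z| ≤ lam * |u - w| * h₁ z) :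
    Measurable (Function.uncurry η) := by
  refine measurable_uncurry_of_continuous_of_measurable (fun z => ?_) hη_meas
  refine (LipschitzWith.of_dist_le_mul (K := |lam|.toNNReal) fun u w => ?_).continuous
  rw [Real.dist_eq, Real.dist_eq, Real.coe_toNNReal _ (abs_nonneg _)]
  refine (hη_lip u w z).trans ?_
  calc lam * |u - w| * h₁ z ≤ |lam| * |u - w| * h₁ z := by
        gcongr
        · exact (hh₁ z).1
        · exact le_abs_self _
    _ ≤ |lam| * |u - w| := mul_le_of_le_one_right (by positivity) (hh₁ z).2

section Bounds
variable [SigmaFinite m] [IsProbabilityMeasure P]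

/-- The second moment and the orthogonality of the noise. -/
theorem noiseIncrement_bounds (hN : IsPoissonRandomMeasure P ℱ m N)
    (hη_meas : ∀ u, Measurable (η u)) (hh₁ : MemLp h₁ 2 m) (hh₁_range : ∀ z, 0 ≤ h₁ z ∧ h₁ z ≤ 1)
    (hη_lip : ∀ u w z, |η u z - η w z| ≤ lam * |u - w| * h₁ z) (hη_zero : ∀ z, η 0 z = 0)
    (hΔt : 0 < Δt) (hX : StronglyMeasurable[ℱ (n * Δt).toNNReal] X) (hX2 : MemLp X 2 P) :
    (∀ s ∈ Icc (n * Δt) ((n + 1) * Δt), MemLp (noiseIncrement P ℱ m N η Δt n X s) 2 P ∧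
      ∫ ω, noiseIncrement P ℱ m N η Δt n X s ω ^ 2 ∂P
        ≤ (s - n * Δt) * (lam ^ 2 * ∫ z, h₁ z ^ 2 ∂m) * ∫ ω, X ω ^ 2 ∂P) ∧
    ∀ Y, StronglyMeasurable[ℱ (n * Δt).toNNReal] Y → MemLp Y 2 P →
      ∫ ω, Y ω * noiseIncrement P ℱ m N η Δt n X ((n + 1) * Δt) ω ∂P = 0 := by
  have h0 : 0 ≤ (n : ℝ) * Δt := by positivity
  have h01 : (n : ℝ) * Δt ≤ (n + 1) * Δt := by nlinarith
  rcases noiseIncrement_cases P ℱ m N η Δt n X with ⟨I, hI, h⟩ | h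
  swap
  · simp only [h]
    refine ⟨fun s hs => ⟨MemLp.zero, ?_⟩, fun Y _ _ => by simp⟩
    simp only [Pi.zero_apply, ne_eq, OfNat.ofNat_ne_zero, not_false_eq_true, zero_pow,
      integral_zero]
    have h1 : 0 ≤ ∫ ω, X ω ^ 2 ∂P := integral_nonneg fun ω => sq_nonneg _
    have h2 : 0 ≤ ∫ z, h₁ z ^ 2 ∂m := integral_nonneg fun ω => sq_nonneg _
    have h3 : 0 ≤ s - n * Δt := sub_nonneg.2 hs.1
    positivity
  set g : Ω × ℝ × E → ℝ :=
    fun p => (Ioc (n * Δt) ((n + 1) * Δt)).indicator (fun _ => η (X p.1) p.2.2) p.2.1 with hg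
  have hgm : AEStronglyMeasurable g (P.prod (intensity m)) := by
    have h1 : Measurable fun p : Ω × ℝ × E => η (X p.1) p.2.2 :=
      (measurable_uncurry_noise hη_meas hh₁_range hη_lip).comp
        (((hX.mono (ℱ.le _)).measurable.comp measurable_fst).prodMk
          (measurable_snd.comp measurable_snd))
    exact (h1.indicator (s := (fun p : Ω × ℝ × E => p.2.1) ⁻¹' Ioc (n * Δt) ((n + 1) * Δt))
      (measurableSet_Ioc.preimage (by fun_prop))).aestronglyMeasurable
  -- Comparison with `η 0 = 0` makes the noise linearly bounded in the unknown, as the Gronwall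
  -- argument requires.
  have hηb : ∀ u z, |η u z| ≤ |lam * u * h₁ z| := fun u z => by
    have h1 := hη_lip u 0 z
    rw [hη_zero, sub_zero, sub_zero] at h1
    refine h1.trans ?_
    rw [abs_mul, abs_mul, abs_of_nonneg (hh₁_range z).1]
    gcongr
    · exact (hh₁_range z).1
    · exact le_abs_self _
  have hgb : ∀ s : ℝ, ∀ p, p.2.1 ≤ s → ‖g p‖ ≤ ‖noiseBound lam h₁ X (n * Δt) s p‖ := by
    intro s p hp
    by_cases h1 : p.2.1 ∈ Ioc (n * Δt) ((n + 1) * Δt)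
    · have h2 : p.2.1 ∈ Ioc (n * Δt) s := ⟨h1.1, hp⟩
      simp only [hg, noiseBound, indicator_of_mem h1, indicator_of_mem h2, Pi.one_apply, one_mul]
      exact hηb _ _
    · simp only [hg, indicator_of_notMem h1, norm_zero]; exact norm_nonneg _
  have hle : ∀ s : ℝ, 0 ≤ s → eLpNorm (I s.toNNReal) 2 P
      ≤ eLpNorm (noiseBound lam h₁ X (n * Δt) s) 2 (P.prod (intensity m)) := by
    intro s hs
    refine (hI.eLpNorm_le hN hgm _).trans (eLpNorm_mono fun p => ?_)
    by_cases hp : p.2.1 ∈ Iic ((s.toNNReal : ℝ≥0) : ℝ)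
    · simp only [stopAt, indicator_of_mem hp]
      exact hgb s p (by rw [Real.coe_toNNReal _ hs] at hp; exact hp)
    · simp only [stopAt, indicator_of_notMem hp, norm_zero]; exact norm_nonneg _
  have hg2 : MemLp g 2 (P.prod (intensity m)) := by
    refine (memLp_noiseBound (lam := lam) hX2 hh₁ h0 h01).1.mono hgm (Eventually.of_forall fun p => ?_)
    by_cases h1 : p.2.1 ∈ Ioc (n * Δt) ((n + 1) * Δt)
    · exact hgb _ p h1.2
    · simp only [hg, indicator_of_notMem h1, norm_zero]; exact norm_nonneg _
  constructor
  · intro s hs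
    obtain ⟨hb1, hb2⟩ := memLp_noiseBound (lam := lam) (m := m) hX2 hh₁ h0 hs.1
    have hle' := hle s (h0.trans hs.1)
    have hmem : MemLp (I s.toNNReal) 2 P := ⟨hI.aestronglyMeasurable _, hle'.trans_lt hb1.2⟩
    rw [h]
    refine ⟨hmem, ?_⟩
    rw [← hb2]
    have h3 : eLpNorm (I s.toNNReal) 2 P ^ 2
        ≤ eLpNorm (noiseBound lam h₁ X (n * Δt) s) 2 (P.prod (intensity m)) ^ 2 := by gcongr
    rw [hmem.eLpNorm_two_sq_eq, hb1.eLpNorm_two_sq_eq] at h3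
    exact (ENNReal.ofReal_le_ofReal_iff (integral_nonneg fun _ => sq_nonneg _)).1 h3
  · intro Y hY hY2
    -- The martingale property moves the integral back to time `nΔt`. There it vanishes almost
    -- surely, since the dominating function lives on an empty time interval.
    rw [h, hI.integral_mul_eq hN hg2 (Real.toNNReal_le_toNNReal h01) hY hY2]
    have h4 : eLpNorm (I (n * Δt).toNNReal) 2 P = 0 := by
      have h5 := hle (n * Δt) h0
      have h6 : noiseBound lam h₁ X (n * Δt) (n * Δt) = (0 : Ω × ℝ × E → ℝ) := by
        funext p; simp [noiseBound]
      rw [h6, eLpNorm_zero] at h5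
      exact le_antisymm h5 zero_le
    rw [eLpNorm_eq_zero_iff (hI.aestronglyMeasurable _) two_ne_zero] at h4
    refine integral_eq_zero_of_ae ?_
    filter_upwards [h4] with ω hω
    simp [hω]

end Bounds
end NoiseIncrement

/-! ### Entropy inequality for one upwind step -/

section Flux
variable {f : ℝ → ℝ} {c : ℝ≥0}

/-- The entropy flux `∫_0^a s f'(s) ds = a f(a) - ∫_0^a f` associated with the square. -/
def entropyFlux (f : ℝ → ℝ) (a : ℝ) : ℝ := a * f a - ∫ s in (0 : ℝ)..a, f s

/-- The numerical entropy dissipation of the upwind flux. -/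
def dissipation (f : ℝ → ℝ) (b a : ℝ) : ℝ := b * (f b - f a) - (entropyFlux f b - entropyFlux f a)

/-- In this form the sign is visible for monotone `f`, and the derivative in `b` is `f b - f a`. -/
theorem dissipation_eq (hf : Continuous f) (b a : ℝ) :
    dissipation f b a = ∫ s in a..b, (f s - f a) := by
  have h1 := intervalIntegral.integral_add_adjacent_intervals
    (hf.intervalIntegrable (μ := volume) 0 a) (hf.intervalIntegrable a b)
  rw [intervalIntegral.integral_sub (hf.intervalIntegrable a b) (by simp),
    intervalIntegral.integral_const, smul_eq_mul, dissipation, entropyFlux, entropyFlux, ← h1]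
  ring

/-- Right side minus left side vanishes at `a` and has derivative `2 (f s - f a)(c - f' s)` in `s =
b`. Since `f' ≤ c`, this has the sign of `s - a`, so the difference has its minimum at `a`. -/
theorem sq_sub_le_dissipation (hf : Differentiable ℝ f) (hlip : LipschitzWith c f)
    (hmono : Monotone f) (b a : ℝ) : (f b - f a) ^ 2 ≤ 2 * c * dissipation f b a := by
  set g : ℝ → ℝ := fun s => 2 * c * (∫ x in a..s, (f x - f a)) - (f s - f a) ^ 2 with hg
  have hcont : Continuous fun x => f x - f a := hf.continuous.sub continuous_const
  have hd : ∀ s, HasDerivAt g (2 * (f s - f a) * (c - deriv f s)) s := fun s => by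
    have h1 : HasDerivAt (fun s => ∫ x in a..s, (f x - f a)) (f s - f a) s :=
      hcont.integral_hasStrictDerivAt a s |>.hasDerivAt
    have h2 := ((hf s).hasDerivAt.sub_const (f a)).pow 2
    refine ((h1.const_mul (2 * (c : ℝ))).sub h2).congr_deriv ?_
    simp only [Nat.cast_ofNat, Nat.add_one_sub_one, pow_one]
    ring
  have hgd : Differentiable ℝ g := fun s => (hd s).differentiableAt
  have hle : ∀ s, 0 ≤ (c : ℝ) - deriv f s := fun s =>
    sub_nonneg.2 ((le_abs_self _).trans (norm_deriv_le_of_lipschitz hlip))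
  have hga : g a = 0 := by simp [hg]
  have hpos : 0 ≤ g b := by
    rw [← hga]
    rcases le_total a b with hab | hab
    · refine monotoneOn_of_deriv_nonneg (convex_Ici a) hgd.continuous.continuousOn
        hgd.differentiableOn (fun s hs => ?_) self_mem_Ici hab hab
      rw [interior_Ici] at hs
      rw [(hd s).deriv]
      exact mul_nonneg (mul_nonneg two_pos.le (sub_nonneg.2 (hmono hs.le))) (hle s)
    · refine antitoneOn_of_deriv_nonpos (convex_Iic a) hgd.continuous.continuousOn
        hgd.differentiableOn (fun s hs => ?_) hab self_mem_Iic hab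
      rw [interior_Iic] at hs
      rw [(hd s).deriv]
      exact mul_nonpos_of_nonpos_of_nonneg
        (mul_nonpos_of_nonneg_of_nonpos two_pos.le (sub_nonpos.2 (hmono hs.le))) (hle s)
  rw [dissipation_eq hf.continuous]
  simp only [hg] at hpos
  linarith

theorem dissipation_nonneg (hf : Continuous f) (hmono : Monotone f) (b a : ℝ) :
    0 ≤ dissipation f b a := by
  rw [dissipation_eq hf]
  rcases le_total a b with hab | hab
  · exact intervalIntegral.integral_nonneg hab fun s hs => sub_nonneg.2 (hmono hs.1)
  · rw [intervalIntegral.integral_symm, ← intervalIntegral.integral_neg]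
    exact intervalIntegral.integral_nonneg hab fun s hs =>
      neg_nonneg.2 (sub_nonpos.2 (hmono hs.2))

theorem LipschitzWith.abs_le_of_zero (hlip : LipschitzWith c f) (h0 : f 0 = 0) (a : ℝ) :
    |f a| ≤ c * |a| := by
  simpa [Real.dist_eq, h0] using hlip.dist_le_mul a 0

/-- The entropy flux is controlled by the energy, which gives its integrability over `Ω` and its
summability over the cells. -/
theorem abs_entropyFlux_le (hlip : LipschitzWith c f) (h0 : f 0 = 0) (a : ℝ) :
    |entropyFlux f a| ≤ 2 * c * a ^ 2 := by
  have h1 : |a * f a| ≤ c * a ^ 2 := by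
    rw [abs_mul, ← sq_abs a]
    nlinarith [hlip.abs_le_of_zero h0 a, abs_nonneg a]
  have h2 : ‖∫ s in (0 : ℝ)..a, f s‖ ≤ c * |a| * |a - 0| := by
    refine intervalIntegral.norm_integral_le_of_norm_le_const fun s hs => ?_
    refine (hlip.abs_le_of_zero h0 s).trans ?_
    refine mul_le_mul_of_nonneg_left ?_ c.coe_nonneg
    rcases le_total 0 a with ha | ha
    · rw [uIoc_of_le ha] at hs
      rw [abs_of_pos hs.1, abs_of_nonneg ha]; exact hs.2
    · rw [uIoc_of_ge ha] at hs
      rw [abs_of_nonpos hs.2, abs_of_nonpos ha]; linarith [hs.1]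
  rw [sub_zero, mul_assoc, ← sq, sq_abs, Real.norm_eq_abs] at h2
  calc |entropyFlux f a| ≤ |a * f a| + |∫ s in (0 : ℝ)..a, f s| := abs_sub _ _
    _ ≤ 2 * c * a ^ 2 := by linarith

theorem continuous_entropyFlux (hf : Continuous f) : Continuous (entropyFlux f) :=
  (continuous_id.mul hf).sub (intervalIntegral.continuous_primitive
    (fun a b => hf.intervalIntegrable a b) 0)

variable {ι : Type*} {s : Finset ι} {w a : ι → ℝ} {b Δt vol ξ : ℝ}

/-- Cauchy-Schwarz with weights `w` leaves `(∑ w) ∑ w (f b - f (a i))²`. The squares are at most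
`2c` times the dissipations, and `Δt c ∑ w` is bounded by the CFL condition. -/
theorem sq_upwind_flux_le (hf : Differentiable ℝ f) (hlip : LipschitzWith c f) (hmono : Monotone f)
    (hw : ∀ i ∈ s, 0 ≤ w i) (hΔt : 0 ≤ Δt) (hcfl : Δt * c * ∑ i ∈ s, w i ≤ (1 - ξ) * vol) :
    Δt * (∑ i ∈ s, w i * (f b - f (a i))) ^ 2
      ≤ 2 * (1 - ξ) * vol * ∑ i ∈ s, w i * dissipation f b (a i) := by
  have h1 : (∑ i ∈ s, w i * (f b - f (a i))) ^ 2
      ≤ (∑ i ∈ s, w i) * ∑ i ∈ s, w i * (f b - f (a i)) ^ 2 :=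
    Finset.sum_sq_le_sum_mul_sum_of_sq_le_mul s hw
      (fun i hi => mul_nonneg (hw i hi) (sq_nonneg _)) fun i _ => le_of_eq (by ring)
  have h2 : ∑ i ∈ s, w i * (f b - f (a i)) ^ 2 ≤ 2 * c * ∑ i ∈ s, w i * dissipation f b (a i) := by
    rw [Finset.mul_sum]
    refine Finset.sum_le_sum fun i hi => ?_
    have := mul_le_mul_of_nonneg_left (sq_sub_le_dissipation hf hlip hmono b (a i)) (hw i hi)
    linarith
  have h3 : 0 ≤ ∑ i ∈ s, w i := Finset.sum_nonneg hw
  have h4 : 0 ≤ ∑ i ∈ s, w i * dissipation f b (a i) := Finset.sum_nonneg fun i hi =>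
    mul_nonneg (hw i hi) (dissipation_nonneg hf.continuous hmono _ _)
  calc Δt * (∑ i ∈ s, w i * (f b - f (a i))) ^ 2
      ≤ Δt * ((∑ i ∈ s, w i) * (2 * c * ∑ i ∈ s, w i * dissipation f b (a i))) := by
        gcongr
        exact h1.trans (by gcongr)
    _ = 2 * (Δt * c * ∑ i ∈ s, w i) * ∑ i ∈ s, w i * dissipation f b (a i) := by ring
    _ ≤ 2 * ((1 - ξ) * vol) * ∑ i ∈ s, w i * dissipation f b (a i) := by gcongr
    _ = _ := by ring

/-- The discrete entropy inequality of the deterministic upwind step. -/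
theorem sq_upwind_step_le (hf : Differentiable ℝ f) (hlip : LipschitzWith c f) (hmono : Monotone f)
    (hw : ∀ i ∈ s, 0 ≤ w i) (hΔt : 0 ≤ Δt) (hvol : 0 < vol)
    (hcfl : Δt * c * ∑ i ∈ s, w i ≤ (1 - ξ) * vol) :
    vol * (b - Δt / vol * ∑ i ∈ s, w i * (f b - f (a i))) ^ 2
      + 2 * ξ * Δt * ∑ i ∈ s, w i * dissipation f b (a i)
      ≤ vol * b ^ 2 - 2 * Δt * ∑ i ∈ s, w i * (entropyFlux f b - entropyFlux f (a i)) := by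
  have h1 := sq_upwind_flux_le (b := b) (a := a) hf hlip hmono hw hΔt hcfl
  have h2 : b * ∑ i ∈ s, w i * (f b - f (a i)) = ∑ i ∈ s, w i * dissipation f b (a i)
      + ∑ i ∈ s, w i * (entropyFlux f b - entropyFlux f (a i)) := by
    rw [Finset.mul_sum, ← Finset.sum_add_distrib]
    exact Finset.sum_congr rfl fun i _ => by rw [dissipation]; ring
  set G := ∑ i ∈ s, w i * (f b - f (a i))
  set D := ∑ i ∈ s, w i * dissipation f b (a i)
  set F := ∑ i ∈ s, w i * (entropyFlux f b - entropyFlux f (a i))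
  have h3 : vol * (b - Δt / vol * G) ^ 2
      = vol * b ^ 2 - 2 * Δt * (b * G) + Δt / vol * (Δt * G ^ 2) := by field_simp; ring
  -- The quadratic remainder of the explicit step consumes the fraction `1 - ξ` of the dissipation
  -- `2 Δt D` gained from `b * G`.
  have h4 : Δt / vol * (Δt * G ^ 2) ≤ Δt / vol * (2 * (1 - ξ) * vol * D) := by gcongr
  have h5 : Δt / vol * (2 * (1 - ξ) * vol * D) = 2 * (1 - ξ) * Δt * D := by field_simp
  rw [h3, h2]
  linarith

end Flux

/-! ### Summation over cells and discrete Gronwall argument -/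

section Summation
variable {ι : Type*} {nb : ι → Finset ι} {c : ι → ι → ℝ}

/-- A conservative exchange between neighbours has zero total. -/
theorem hasSum_exchange (hnb : ∀ K L, L ∈ nb K ↔ K ∈ nb L) (hc : ∀ K L, 0 ≤ c K L)
    (hbal : ∀ K, ∑ L ∈ nb K, c L K = ∑ L ∈ nb K, c K L) {φ : ι → ℝ}
    (hφ : Summable fun K => (∑ L ∈ nb K, c K L) * |φ K|) :
    HasSum (fun K => ∑ L ∈ nb K, c K L * (φ K - φ L)) 0 := by
  classical
  -- `F` weights `φ K` by inflows and `G` by outflows. By the balance they have the same total, and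
  -- exchanging the two indices turns `G` into the inflow-weighted `φ L`. Absolute summability
  -- justifies the rearrangement.
  set F : ι × ι → ℝ := fun p => if p.2 ∈ nb p.1 then c p.1 p.2 * φ p.1 else 0 with hF
  set G : ι × ι → ℝ := fun p => if p.2 ∈ nb p.1 then c p.2 p.1 * φ p.1 else 0 with hG
  have hsupp : ∀ (K : ι) (r : ι → ℝ),
      HasSum (fun L => if L ∈ nb K then r L else 0) (∑ L ∈ nb K, r L) := fun K r => by
    rw [← Finset.sum_congr rfl fun L (hL : L ∈ nb K) => if_pos (t := r L) (e := 0) hL]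
    exact hasSum_sum_of_ne_finset_zero fun L hL => if_neg hL
  have habs : ∀ (K L : ι) (x : ℝ), |if L ∈ nb K then x else 0| = if L ∈ nb K then |x| else 0 :=
    fun K L x => by split_ifs <;> simp
  have hFs : Summable F := by
    rw [← summable_abs_iff, summable_prod_of_nonneg fun p => abs_nonneg _]
    simp only [hF, habs, abs_mul, abs_of_nonneg (hc _ _)]
    refine ⟨fun K => (hsupp K _).summable, hφ.congr fun K => ?_⟩
    rw [(hsupp K _).tsum_eq, Finset.sum_mul]
  have hGs : Summable G := by
    rw [← summable_abs_iff, summable_prod_of_nonneg fun p => abs_nonneg _]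
    simp only [hG, habs, abs_mul, abs_of_nonneg (hc _ _)]
    refine ⟨fun K => (hsupp K _).summable, hφ.congr fun K => ?_⟩
    rw [(hsupp K _).tsum_eq, ← hbal, Finset.sum_mul]
  have hF1 : HasSum (fun K => ∑ L ∈ nb K, c K L * φ K) (∑' p, F p) :=
    hFs.hasSum.prod_fiberwise fun K => hsupp K fun L => c K L * φ K
  have hG1 : HasSum (fun K => ∑ L ∈ nb K, c L K * φ K) (∑' p, G p) :=
    hGs.hasSum.prod_fiberwise fun K => hsupp K fun L => c L K * φ K
  have hG2 : HasSum (fun K => ∑ L ∈ nb K, c K L * φ L) (∑' p, G p) := by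
    have h1 : HasSum (G ∘ Equiv.prodComm ι ι) (∑' p, G p) :=
      (Equiv.hasSum_iff (Equiv.prodComm ι ι)).2 hGs.hasSum
    refine h1.prod_fiberwise fun K => ?_
    have h2 : (fun L => (G ∘ Equiv.prodComm ι ι) (K, L))
        = fun L => if L ∈ nb K then c K L * φ L else 0 := by
      funext L
      simp only [hG, Function.comp_apply, Equiv.prodComm_apply, Prod.swap, ← hnb K L]
    rw [h2]
    exact hsupp K fun L => c K L * φ L
  have heq : ∑' p, F p = ∑' p, G p := by
    refine hF1.unique ?_
    simp only [← Finset.sum_mul, hbal] at hG1 ⊢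
    exact hG1
  have h := hF1.sub hG2
  rw [heq, sub_self] at h
  simpa only [← Finset.sum_sub_distrib, ← mul_sub] using h

/-- Discrete energy estimate: `A n K` is the energy density of the cell `K` at step `n`, `q n K`
its dissipation, and `φ n` the entropy flux. -/
theorem energy_estimate {c : ℕ → ι → ι → ℝ} (hnb : ∀ K L, L ∈ nb K ↔ K ∈ nb L)
    {vol : ι → ℝ} (hvol : ∀ K, 0 ≤ vol K) {A q φ : ℕ → ι → ℝ} {M : ℕ} {κ Δt ξ C e₀ B : ℝ}
    (hA : ∀ n K, 0 ≤ A n K) (hq : ∀ n K, 0 ≤ q n K) (hc : ∀ n K L, 0 ≤ c n K L)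
    (hκ : 0 ≤ κ) (hΔt : 0 < Δt) (hξ : 0 < ξ)
    (hbal : ∀ n < M, ∀ K, ∑ L ∈ nb K, c n L K = ∑ L ∈ nb K, c n K L)
    (hcM : ∀ n < M, ∀ K, ∑ L ∈ nb K, c n K L ≤ B * vol K)
    (hφ : ∀ n < M, ∀ K, |φ n K| ≤ C * A n K)
    (hstep : ∀ n < M, ∀ K, vol K * A (n + 1) K + 2 * ξ * Δt * q n K
      ≤ (1 + κ * Δt) * (vol K * A n K) - 2 * Δt * ∑ L ∈ nb K, c n K L * (φ n K - φ n L))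
    (h0 : Summable fun K => vol K * A 0 K) (h0e : ∑' K, vol K * A 0 K ≤ e₀) :
    (∀ n ≤ M, Summable (fun K => vol K * A n K) ∧
      ∑' K, vol K * A n K ≤ Real.exp (κ * (M * Δt)) * e₀) ∧
    (∀ n < M, Summable (q n)) ∧
    2 * ξ * Δt * ∑ n ∈ Finset.range M, ∑' K, q n K
      ≤ (1 + κ * (M * Δt) * Real.exp (κ * (M * Δt))) * e₀ := by
  -- In one step the exchange term sums to zero, and summability is inherited by the next energy and
  -- by the dissipation. The constants `B` and `C` enter only the summability of the exchange.
  have hone : ∀ n < M, (Summable fun K => vol K * A n K) →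
      (Summable fun K => vol K * A (n + 1) K) ∧ Summable (q n) ∧
      ∑' K, vol K * A (n + 1) K + 2 * ξ * Δt * ∑' K, q n K
        ≤ (1 + κ * Δt) * ∑' K, vol K * A n K := by
    intro n hn hs
    have hex : HasSum (fun K => ∑ L ∈ nb K, c n K L * (φ n K - φ n L)) 0 := by
      refine hasSum_exchange hnb (hc n) (hbal n hn) ?_
      refine Summable.of_nonneg_of_le
        (fun K => mul_nonneg (Finset.sum_nonneg fun L _ => hc n K L) (abs_nonneg _)) (fun K => ?_)
        (hs.mul_left (B * C))
      calc (∑ L ∈ nb K, c n K L) * |φ n K| ≤ (B * vol K) * (C * A n K) :=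
            mul_le_mul (hcM n hn K) (hφ n hn K) (abs_nonneg _)
              ((Finset.sum_nonneg fun L _ => hc n K L).trans (hcM n hn K))
        _ = _ := by ring
    have hr := (hs.hasSum.mul_left (1 + κ * Δt)).sub (hex.mul_left (2 * Δt))
    rw [mul_zero, sub_zero] at hr
    have h1 : ∀ K, 0 ≤ vol K * A (n + 1) K := fun K => mul_nonneg (hvol K) (hA _ K)
    have h2 : ∀ K, 0 ≤ 2 * ξ * Δt * q n K := fun K => mul_nonneg (by positivity) (hq n K)
    have hs1 : Summable fun K => vol K * A (n + 1) K := Summable.of_nonneg_of_le h1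
      (fun K => (le_add_of_nonneg_right (h2 K)).trans (hstep n hn K)) hr.summable
    have hs2 : Summable fun K => 2 * ξ * Δt * q n K := Summable.of_nonneg_of_le h2
      (fun K => (le_add_of_nonneg_left (h1 K)).trans (hstep n hn K)) hr.summable
    have hs3 : Summable (q n) := (summable_mul_left_iff (by positivity)).1 hs2
    refine ⟨hs1, hs3, ?_⟩
    rw [← tsum_mul_left, ← hs1.tsum_add hs2]
    exact hasSum_le (hstep n hn) (hs1.add hs2).hasSum hr
  have he0 : 0 ≤ e₀ := (tsum_nonneg fun K => mul_nonneg (hvol K) (hA 0 K)).trans h0e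
  have hpow : ∀ n ≤ M, Summable (fun K => vol K * A n K) ∧
      ∑' K, vol K * A n K ≤ (1 + κ * Δt) ^ n * e₀ := by
    intro n
    induction n with
    | zero => intro _; simpa using ⟨h0, h0e⟩
    | succ n ih =>
      intro hn
      obtain ⟨h1, h2⟩ := ih (by omega)
      obtain ⟨h3, -, h5⟩ := hone n hn h1
      refine ⟨h3, ?_⟩
      have h6 : 0 ≤ 2 * ξ * Δt * ∑' K, q n K :=
        mul_nonneg (by positivity) (tsum_nonneg (hq n))
      calc ∑' K, vol K * A (n + 1) K ≤ (1 + κ * Δt) * ∑' K, vol K * A n K := by linarith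
        _ ≤ (1 + κ * Δt) * ((1 + κ * Δt) ^ n * e₀) := by gcongr
        _ = _ := by ring
  have hexp : ∀ n ≤ M, (1 + κ * Δt) ^ n ≤ Real.exp (κ * (M * Δt)) := by
    intro n hn
    calc (1 + κ * Δt) ^ n ≤ Real.exp (κ * Δt) ^ n := by
          gcongr
          rw [add_comm]; exact Real.add_one_le_exp _
      _ = Real.exp (n * (κ * Δt)) := (Real.exp_nat_mul _ _).symm
      _ ≤ Real.exp (κ * (M * Δt)) := by
          refine Real.exp_le_exp.2 ?_
          have h1 : (n : ℝ) ≤ M := by exact_mod_cast hn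
          have h2 : (n : ℝ) * (κ * Δt) ≤ M * (κ * Δt) := by gcongr
          linarith
  have hen : ∀ n ≤ M, Summable (fun K => vol K * A n K) ∧
      ∑' K, vol K * A n K ≤ Real.exp (κ * (M * Δt)) * e₀ := fun n hn =>
    ⟨(hpow n hn).1, (hpow n hn).2.trans (by gcongr; exact hexp n hn)⟩
  refine ⟨hen, fun n hn => (hone n hn (hen n hn.le).1).2.1, ?_⟩
  -- Telescoping the one-step inequality; the growth term `κ Δt` times the energy is replaced at
  -- each step by its uniform bound.
  have hsum : ∀ n ≤ M, ∑' K, vol K * A n K + 2 * ξ * Δt * ∑ i ∈ Finset.range n, ∑' K, q i K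
      ≤ (1 + κ * (n * Δt) * Real.exp (κ * (M * Δt))) * e₀ := by
    intro n
    induction n with
    | zero => intro _; simpa using h0e
    | succ n ih =>
      intro hn
      have h1 := ih (by omega)
      have h2 := (hone n hn (hen n (by omega)).1).2.2
      have h3 := mul_le_mul_of_nonneg_left (hen n (by omega)).2 (mul_nonneg hκ hΔt.le)
      rw [Finset.sum_range_succ, mul_add]
      push_cast
      linarith
  have h1 := hsum M le_rfl
  have h2 : 0 ≤ ∑' K, vol K * A M K := tsum_nonneg fun K => mul_nonneg (hvol K) (hA M K)
  linarith

end Summation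

/-! ### Cell averages of the initial datum -/

section InitialDatum
variable {d : ℕ} {𝒯 : Set (Set (Sp d))} {α : ℝ} {K : Set (Sp d)}

theorem IsPolygonal.volume_lt_top (hK : IsPolygonal K) : volume K < ∞ :=
  hK.isBounded.measure_lt_top

theorem IsPolygonal.volume_interior_ne_top (hK : IsPolygonal K) : volume (interior K) ≠ ∞ :=
  ((measure_mono interior_subset).trans_lt hK.volume_lt_top).ne

theorem IsPolygonal.interior_ae_eq (hK : IsPolygonal K) : interior K =ᵐ[volume] K :=
  interior_ae_eq_of_null_frontier hK.volume_frontier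

theorem IsPolygonal.volume_real_interior (hK : IsPolygonal K) :
    volume.real (interior K) = volume.real K := measureReal_congr hK.interior_ae_eq

/-- Writing the integral as an inner product shows that it is a continuous linear functional of the
datum, which yields measurability in `ω` and access to Bessel's inequality. The interior stands in
for `K` because it is measurable. -/
theorem IsPolygonal.setIntegral_eq_inner (hK : IsPolygonal K)
    (u : Lp ℝ 2 (volume : Measure (Sp d))) :
    ∫ x in K, u x = inner ℝ (indicatorConstLp 2 isOpen_interior.measurableSet
      hK.volume_interior_ne_top (1 : ℝ)) u := by
  rw [L2.inner_indicatorConstLp_one, Measure.restrict_congr_set hK.interior_ae_eq]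

/-- The normalized indicator functions of the cells are orthonormal, so that Bessel's inequality
bounds the discrete initial datum. -/
theorem IsAdmissibleMesh.sum_sq_average_le (h : IsAdmissibleMesh 𝒯 α) (hd : 1 ≤ d) (hα : 0 < α)
    (u : Lp ℝ 2 (volume : Measure (Sp d))) (s : Finset 𝒯) :
    ∑ K ∈ s, volume.real (K : Set (Sp d)) *
      (1 / volume.real (K : Set (Sp d)) * ∫ x in (K : Set (Sp d)), u x) ^ 2 ≤ ‖u‖ ^ 2 := by
  classical
  set w : 𝒯 → Lp ℝ 2 (volume : Measure (Sp d)) := fun K =>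
    (√(volume.real (K : Set (Sp d))))⁻¹ • indicatorConstLp 2 isOpen_interior.measurableSet
      (h.polygonal K K.2).volume_interior_ne_top (1 : ℝ) with hw
  have hpos : ∀ K : 𝒯, 0 < volume.real (K : Set (Sp d)) := fun K =>
    h.volume_real_pos hd hα K.2
  have hon : Orthonormal ℝ w := by
    rw [orthonormal_iff_ite]
    intro K L
    rw [hw]
    simp only
    rw [real_inner_smul_left, real_inner_smul_right,
      L2.real_inner_indicatorConstLp_one_indicatorConstLp_one _ _
        (h.polygonal K K.2).volume_interior_ne_top (h.polygonal L L.2).volume_interior_ne_top]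
    split_ifs with hKL
    · subst hKL
      rw [inter_self, (h.polygonal K K.2).volume_real_interior, ← mul_assoc, ← mul_inv,
        Real.mul_self_sqrt (hpos K).le, inv_mul_cancel₀ (hpos K).ne']
    · have hdis : interior (K : Set (Sp d)) ∩ interior (L : Set (Sp d)) = ∅ :=
        ((h.disjoint_of_ne K.2 L.2 fun e => hKL (Subtype.ext e)).mono interior_subset
          interior_subset).inter_eq
      rw [hdis]
      simp
  refine le_trans (le_of_eq ?_) (hon.sum_inner_products_le u (s := s))
  refine Finset.sum_congr rfl fun K _ => ?_
  rw [hw]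
  simp only
  rw [real_inner_smul_left, ← (h.polygonal K K.2).setIntegral_eq_inner, Real.norm_eq_abs, sq_abs,
    mul_pow, mul_pow, inv_pow, Real.sq_sqrt (hpos K).le, one_div]
  have := (hpos K).ne'
  field_simp

end InitialDatum

/-! ### The upwind scheme: regularity, energy balance, weak BV estimate -/

/-- The hypotheses on the data and the discretization. -/
structure UpwindSetting {Ω E : Type*} {mΩ : MeasurableSpace Ω} [MeasurableSpace E]
    (P : Measure Ω) (ℱ : Filtration ℝ≥0 mΩ) (m : Measure E) (N : Ω → Measure (ℝ × E)) {d : ℕ}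
    (T : ℝ) (f : ℝ → ℝ) (c : ℝ≥0) (v : ℝ → Sp d → Sp d) (V : ℝ) (η : ℝ → E → ℝ) (lam : ℝ)
    (h₁ : E → ℝ) (u₀ : Ω → Lp ℝ 2 (volume : Measure (Sp d))) (𝒯 : Set (Set (Sp d))) (α ξ Δt : ℝ)
    (M : ℕ) : Prop where
  poisson : IsPoissonRandomMeasure P ℱ m N
  one_le_dim : 1 ≤ d
  differentiable : Differentiable ℝ f
  lipschitz : LipschitzWith c f
  map_zero : f 0 = 0
  monotone : Monotone f
  contDiffOn_velocity : ContDiffOn ℝ 1 (fun p : ℝ × Sp d => v p.1 p.2) (Icc 0 T ×ˢ univ)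
  divergence_velocity : ∀ t ∈ Ico 0 T, ∀ x, divergence (v t) x = 0
  norm_velocity_le : ∀ t ∈ Ico 0 T, ∀ x, ‖v t x‖ ≤ V
  measurable_noise : ∀ u, Measurable (η u)
  memLp_bound : MemLp h₁ 2 m
  bound_mem : ∀ z, 0 ≤ h₁ z ∧ h₁ z ≤ 1
  noise_lipschitz : ∀ u w z, |η u z - η w z| ≤ lam * |u - w| * h₁ z
  noise_zero : ∀ z, η 0 z = 0
  stronglyMeasurable_datum : StronglyMeasurable[ℱ 0] u₀
  memLp_datum : MemLp u₀ 2 P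
  mesh : IsAdmissibleMesh 𝒯 α
  alpha_pos : 0 < α
  xi_pos : 0 < ξ
  xi_lt_one : ξ < 1
  step_pos : 0 < Δt
  step_mul : M * Δt = T
  cfl : Δt * (c * V) ≤ (1 - ξ) * α ^ 2 * meshSize 𝒯

namespace UpwindSetting
variable {Ω E : Type*} {mΩ : MeasurableSpace Ω} [MeasurableSpace E]
  {P : Measure Ω} {ℱ : Filtration ℝ≥0 mΩ} {m : Measure E} {N : Ω → Measure (ℝ × E)} {d : ℕ}
  {T : ℝ} {f : ℝ → ℝ} {c : ℝ≥0} {v : ℝ → Sp d → Sp d} {V : ℝ} {η : ℝ → E → ℝ} {lam : ℝ}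
  {h₁ : E → ℝ} {u₀ : Ω → Lp ℝ 2 (volume : Measure (Sp d))} {𝒯 : Set (Set (Sp d))} {α ξ Δt : ℝ}
  {M : ℕ}

theorem step_le (H : UpwindSetting P ℱ m N T f c v V η lam h₁ u₀ 𝒯 α ξ Δt M) {n : ℕ}
    (hn : n < M) : ((n : ℝ) + 1) * Δt ≤ T := by
  rw [← H.step_mul]
  have h1 : (n : ℝ) + 1 ≤ M := by exact_mod_cast hn
  exact mul_le_mul_of_nonneg_right h1 H.step_pos.le

theorem volume_pos (H : UpwindSetting P ℱ m N T f c v V η lam h₁ u₀ 𝒯 α ξ Δt M) (K : 𝒯) :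
    0 < volume.real (K : Set (Sp d)) :=
  H.mesh.volume_real_pos H.one_le_dim H.alpha_pos K.2

open Classical in
/-- The finite set of neighbours of a cell. -/
def neighbour (H : UpwindSetting P ℱ m N T f c v V η lam h₁ u₀ 𝒯 α ξ Δt M) (K : 𝒯) : Finset 𝒯 :=
  (H.mesh.finite_neighbours H.one_le_dim H.alpha_pos K.2).toFinset.subtype (· ∈ 𝒯)

theorem sum_neighbour (H : UpwindSetting P ℱ m N T f c v V η lam h₁ u₀ 𝒯 α ξ Δt M) (K : 𝒯)
    (g : Set (Sp d) → ℝ) : ∑ L ∈ H.neighbour K, g L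
      = ∑ L ∈ (H.mesh.finite_neighbours H.one_le_dim H.alpha_pos K.2).toFinset, g L := by
  classical
  rw [neighbour, ← Finset.sum_subtype_of_mem g (p := (· ∈ 𝒯)) fun L hL => by
    have hL : L ∈ neighbours 𝒯 K := by simpa using hL
    exact hL.1]

theorem mem_neighbour_comm (H : UpwindSetting P ℱ m N T f c v V η lam h₁ u₀ 𝒯 α ξ Δt M)
    (K L : 𝒯) : L ∈ H.neighbour K ↔ K ∈ H.neighbour L := by
  simp only [neighbour, Finset.mem_subtype, Finite.mem_toFinset]
  exact ⟨neighbours_comm K.2, neighbours_comm L.2⟩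

theorem inflow_nonneg (H : UpwindSetting P ℱ m N T f c v V η lam h₁ u₀ 𝒯 α ξ Δt M) (n : ℕ)
    (K L : Set (Sp d)) : 0 ≤ inflow v Δt n K L :=
  _root_.inflow_nonneg (v := v) H.step_pos n K L

theorem balance (H : UpwindSetting P ℱ m N T f c v V η lam h₁ u₀ 𝒯 α ξ Δt M) {n : ℕ}
    (hn : n < M) (K : 𝒯) :
    ∑ L ∈ H.neighbour K, inflow v Δt n L K = ∑ L ∈ H.neighbour K, inflow v Δt n K L := by
  rw [H.sum_neighbour K (fun L => inflow v Δt n L K), H.sum_neighbour K]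
  exact sum_inflow_eq_sum_swap H.mesh H.one_le_dim H.alpha_pos K.2 H.contDiffOn_velocity
    H.norm_velocity_le H.step_pos (H.step_le hn) H.divergence_velocity

theorem cfl_cell (H : UpwindSetting P ℱ m N T f c v V η lam h₁ u₀ 𝒯 α ξ Δt M) {n : ℕ}
    (hn : n < M) (K : 𝒯) :
    Δt * c * ∑ L ∈ H.neighbour K, inflow v Δt n K L ≤ (1 - ξ) * volume.real (K : Set (Sp d)) := by
  rw [H.sum_neighbour K]
  exact sum_inflow_le_volume H.mesh H.one_le_dim H.alpha_pos K.2 H.contDiffOn_velocity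
    H.norm_velocity_le H.step_pos (H.step_le hn) c.coe_nonneg H.xi_lt_one H.cfl

/-- The constant depends on the mesh; this is harmless, because it only serves to sum the exchange
terms over infinitely many cells. -/
theorem exists_sum_inflow_le (H : UpwindSetting P ℱ m N T f c v V η lam h₁ u₀ 𝒯 α ξ Δt M) :
    ∃ B, ∀ n < M, ∀ K : 𝒯,
      ∑ L ∈ H.neighbour K, inflow v Δt n K L ≤ B * volume.real (K : Set (Sp d)) := by
  refine ⟨V * (1 / α * meshSize 𝒯 ^ (d - 1)) / (α * meshSize 𝒯 ^ d), fun n hn K => ?_⟩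
  have hT : 0 < T := lt_of_lt_of_le (by have := H.step_pos; positivity) (H.step_le hn)
  have hV0 : 0 ≤ V := (norm_nonneg _).trans (H.norm_velocity_le 0 ⟨le_rfl, hT⟩ 0)
  have hh := H.mesh.meshSize_pos H.one_le_dim
  have hα := H.alpha_pos
  rw [H.sum_neighbour K]
  refine (sum_inflow_le H.mesh H.one_le_dim H.alpha_pos K.2 H.contDiffOn_velocity
    H.norm_velocity_le H.step_pos (H.step_le hn)).trans ?_
  rw [div_mul_eq_mul_div (V * (1 / α * meshSize 𝒯 ^ (d - 1))), le_div_iff₀ (by positivity)]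
  exact mul_le_mul_of_nonneg_left (H.mesh.le_volume_real K.2) (by positivity)

/-- The upwind flux of the discrete solution. -/
def flux (H : UpwindSetting P ℱ m N T f c v V η lam h₁ u₀ 𝒯 α ξ Δt M) (n : ℕ) (K : 𝒯) (ω : Ω) : ℝ :=
  ∑ L ∈ H.neighbour K, inflow v Δt n K L *
    (f (upwind P ℱ m N η f v u₀ 𝒯 Δt n K ω) - f (upwind P ℱ m N η f v u₀ 𝒯 Δt n L ω))

/-- The balance of inflow and outflow turns the conservative form of the scheme into one with
differences of `f` weighted by inflows alone. -/
theorem upwind_succ (H : UpwindSetting P ℱ m N T f c v V η lam h₁ u₀ 𝒯 α ξ Δt M) {n : ℕ}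
    (hn : n < M) (K : 𝒯) (ω : Ω) :
    upwind P ℱ m N η f v u₀ 𝒯 Δt (n + 1) K ω
      = upwind P ℱ m N η f v u₀ 𝒯 Δt n K ω
        - Δt / volume.real (K : Set (Sp d)) * H.flux n K ω
        + noiseIncrement P ℱ m N η Δt n (upwind P ℱ m N η f v u₀ 𝒯 Δt n K) ((n + 1) * Δt) ω := by
  rw [upwind]
  congr 3
  rw [finsum_mem_eq_finite_toFinset_sum _
    (H.mesh.finite_neighbours H.one_le_dim H.alpha_pos K.2), ← H.sum_neighbour K (fun L =>
      surfaceArea (interface K L) *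
          (normalVelocityPos v Δt n K L * f (upwind P ℱ m N η f v u₀ 𝒯 Δt n K ω)
            - normalVelocityNeg v Δt n K L * f (upwind P ℱ m N η f v u₀ 𝒯 Δt n L ω)))]
  have h1 : ∀ L ∈ H.neighbour K, surfaceArea (interface (K : Set (Sp d)) L) *
          (normalVelocityPos v Δt n K L * f (upwind P ℱ m N η f v u₀ 𝒯 Δt n K ω)
            - normalVelocityNeg v Δt n K L * f (upwind P ℱ m N η f v u₀ 𝒯 Δt n L ω))
      = inflow v Δt n L K * f (upwind P ℱ m N η f v u₀ 𝒯 Δt n K ω)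
        - inflow v Δt n K L * f (upwind P ℱ m N η f v u₀ 𝒯 Δt n L ω) := fun L hL => by
    have hL : (L : Set (Sp d)) ∈ neighbours 𝒯 K := by simpa [neighbour] using hL
    rw [mul_sub, ← mul_assoc, ← mul_assoc,
      surfaceArea_mul_normalVelocityPos H.mesh K.2 hL.1 hL.2.1.symm, inflow.eq_def v Δt n K L]
  rw [Finset.sum_congr rfl h1, Finset.sum_sub_distrib, ← Finset.sum_mul, H.balance hn K,
    Finset.sum_mul, ← Finset.sum_sub_distrib, flux]
  exact Finset.sum_congr rfl fun L _ => by ring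

/-- The expected dissipation in the cell `K`. -/
def meanDissipation (H : UpwindSetting P ℱ m N T f c v V η lam h₁ u₀ 𝒯 α ξ Δt M) (n : ℕ) (K : 𝒯) :
    ℝ :=
  ∑ L ∈ H.neighbour K, inflow v Δt n K L *
    ∫ ω, dissipation f (upwind P ℱ m N η f v u₀ 𝒯 Δt n K ω)
      (upwind P ℱ m N η f v u₀ 𝒯 Δt n L ω) ∂P

theorem meanDissipation_nonneg (H : UpwindSetting P ℱ m N T f c v V η lam h₁ u₀ 𝒯 α ξ Δt M)
    (n : ℕ) (K : 𝒯) : 0 ≤ H.meanDissipation n K :=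
  Finset.sum_nonneg fun L _ => mul_nonneg (H.inflow_nonneg n K L)
    (integral_nonneg fun _ => dissipation_nonneg H.lipschitz.continuous H.monotone _ _)

theorem upwind_zero_regular (H : UpwindSetting P ℱ m N T f c v V η lam h₁ u₀ 𝒯 α ξ Δt M) (K : 𝒯) :
    StronglyMeasurable[ℱ 0] (upwind P ℱ m N η f v u₀ 𝒯 Δt 0 K) ∧
      MemLp (upwind P ℱ m N η f v u₀ 𝒯 Δt 0 K) 2 P := by
  have h1 : upwind P ℱ m N η f v u₀ 𝒯 Δt 0 K = fun ω => 1 / volume.real (K : Set (Sp d)) *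
      innerSL ℝ (indicatorConstLp 2 isOpen_interior.measurableSet
        (H.mesh.polygonal K K.2).volume_interior_ne_top (1 : ℝ)) (u₀ ω) := by
    funext ω
    rw [upwind, (H.mesh.polygonal K K.2).setIntegral_eq_inner, innerSL_apply_apply]
  rw [h1]
  exact ⟨((ContinuousLinearMap.continuous _).comp_stronglyMeasurable
    H.stronglyMeasurable_datum).const_mul _,
    (ContinuousLinearMap.comp_memLp' _ H.memLp_datum).const_mul _⟩

/-- Bessel's inequality is applied for each `ω` and each finite set of cells, then averaged; a bound
uniform over finite sets gives summability. -/
theorem energy_zero (H : UpwindSetting P ℱ m N T f c v V η lam h₁ u₀ 𝒯 α ξ Δt M) :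
    (Summable fun K : 𝒯 => volume.real (K : Set (Sp d)) *
      ∫ ω, upwind P ℱ m N η f v u₀ 𝒯 Δt 0 K ω ^ 2 ∂P) ∧
    ∑' K : 𝒯, volume.real (K : Set (Sp d)) *
      ∫ ω, upwind P ℱ m N η f v u₀ 𝒯 Δt 0 K ω ^ 2 ∂P ≤ ∫ ω, ‖u₀ ω‖ ^ 2 ∂P := by
  have h0 : 0 ≤ fun K : 𝒯 => volume.real (K : Set (Sp d)) *
      ∫ ω, upwind P ℱ m N η f v u₀ 𝒯 Δt 0 K ω ^ 2 ∂P := fun K =>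
    mul_nonneg (H.volume_pos K).le (integral_nonneg fun ω => sq_nonneg _)
  have h1 : ∀ s : Finset 𝒯, ∑ K ∈ s, volume.real (K : Set (Sp d)) *
      ∫ ω, upwind P ℱ m N η f v u₀ 𝒯 Δt 0 K ω ^ 2 ∂P ≤ ∫ ω, ‖u₀ ω‖ ^ 2 ∂P := fun s => by
    have h2 := fun K : 𝒯 => (H.upwind_zero_regular K).2.integrable_sq.const_mul
      (volume.real (K : Set (Sp d)))
    simp only [← integral_const_mul]
    rw [← integral_finsetSum _ fun K _ => h2 K]
    refine integral_mono (integrable_finsetSum _ fun K _ => h2 K)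
      H.memLp_datum.norm.integrable_sq fun ω => ?_
    exact H.mesh.sum_sq_average_le H.one_le_dim H.alpha_pos (u₀ ω) s
  exact ⟨summable_of_sum_le h0 h1, Real.tsum_le_of_sum_le h0 h1⟩

variable [SigmaFinite m] [IsProbabilityMeasure P]

theorem noise_bounds (H : UpwindSetting P ℱ m N T f c v V η lam h₁ u₀ 𝒯 α ξ Δt M) {n : ℕ}
    {X : Ω → ℝ} (hX : StronglyMeasurable[ℱ (n * Δt).toNNReal] X) (hX2 : MemLp X 2 P) :
    (∀ s ∈ Icc (n * Δt) ((n + 1) * Δt), MemLp (noiseIncrement P ℱ m N η Δt n X s) 2 P ∧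
      ∫ ω, noiseIncrement P ℱ m N η Δt n X s ω ^ 2 ∂P
        ≤ (s - n * Δt) * (lam ^ 2 * ∫ z, h₁ z ^ 2 ∂m) * ∫ ω, X ω ^ 2 ∂P) ∧
    ∀ Y, StronglyMeasurable[ℱ (n * Δt).toNNReal] Y → MemLp Y 2 P →
      ∫ ω, Y ω * noiseIncrement P ℱ m N η Δt n X ((n + 1) * Δt) ω ∂P = 0 :=
  noiseIncrement_bounds H.poisson H.measurable_noise H.memLp_bound H.bound_mem H.noise_lipschitz
    H.noise_zero H.step_pos hX hX2

/-- The discrete unknowns are adapted and square integrable. -/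
theorem upwind_regular (H : UpwindSetting P ℱ m N T f c v V η lam h₁ u₀ 𝒯 α ξ Δt M) :
    ∀ n ≤ M, ∀ K : 𝒯,
      StronglyMeasurable[ℱ (n * Δt).toNNReal] (upwind P ℱ m N η f v u₀ 𝒯 Δt n K) ∧
        MemLp (upwind P ℱ m N η f v u₀ 𝒯 Δt n K) 2 P := by
  intro n
  induction n with
  | zero => 
    intro _ K
    have h1 := H.upwind_zero_regular K
    rwa [← Real.toNNReal_zero, ← zero_mul Δt, ← Nat.cast_zero (R := ℝ)] at h1
  | succ n ih =>
    intro hn K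
    have ih := ih (by omega)
    have h1 : upwind P ℱ m N η f v u₀ 𝒯 Δt (n + 1) K = fun ω =>
        upwind P ℱ m N η f v u₀ 𝒯 Δt n K ω
        - Δt / volume.real (K : Set (Sp d)) * H.flux n K ω
        + noiseIncrement P ℱ m N η Δt n (upwind P ℱ m N η f v u₀ 𝒯 Δt n K) ((n + 1) * Δt) ω :=
      funext fun ω => H.upwind_succ hn K ω
    have hle : (n : ℝ) * Δt ≤ (n + 1) * Δt := by nlinarith [H.step_pos]
    have hfil : ℱ (n * Δt).toNNReal ≤ ℱ ((n + 1) * Δt).toNNReal :=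
      ℱ.mono (Real.toNNReal_le_toNNReal hle)
    have hfm := fun L => H.lipschitz.continuous.comp_stronglyMeasurable (ih L).1
    have hf2 := fun L => H.lipschitz.comp_memLp H.map_zero (ih L).2
    have hnoise := (H.noise_bounds (ih K).1 (ih K).2).1 _ (right_mem_Icc.2 hle)
    rw [h1, Nat.cast_succ]
    constructor
    · have hnm : StronglyMeasurable[ℱ ((n + 1) * Δt).toNNReal] (noiseIncrement P ℱ m N η Δt n
          (upwind P ℱ m N η f v u₀ 𝒯 Δt n K) ((n + 1) * Δt)) :=
        stronglyMeasurable_noiseIncrement _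
      refine StronglyMeasurable.add (StronglyMeasurable.mono ?_ hfil) hnm
      refine (ih K).1.sub (StronglyMeasurable.const_mul ?_ _)
      exact Finset.stronglyMeasurable_fun_sum _ fun L _ => ((hfm K).sub (hfm L)).const_mul _
    · refine MemLp.add (MemLp.sub (ih K).2 (MemLp.const_mul ?_ _)) hnoise.1
      exact memLp_finsetSum _ fun L _ => ((hf2 K).sub (hf2 L)).const_mul _

theorem flux_regular (H : UpwindSetting P ℱ m N T f c v V η lam h₁ u₀ 𝒯 α ξ Δt M) {n : ℕ}
    (hn : n ≤ M) (K : 𝒯) :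
    StronglyMeasurable[ℱ (n * Δt).toNNReal] (H.flux n K) ∧ MemLp (H.flux n K) 2 P := by
  have ih := H.upwind_regular n hn
  have hfm := fun L => H.lipschitz.continuous.comp_stronglyMeasurable (ih L).1
  have hf2 := fun L => H.lipschitz.comp_memLp H.map_zero (ih L).2
  exact ⟨Finset.stronglyMeasurable_fun_sum _ fun L _ => ((hfm K).sub (hfm L)).const_mul _,
    memLp_finsetSum _ fun L _ => ((hf2 K).sub (hf2 L)).const_mul _⟩

theorem integrable_entropyFlux (H : UpwindSetting P ℱ m N T f c v V η lam h₁ u₀ 𝒯 α ξ Δt M)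
    {n : ℕ} (hn : n ≤ M) (K : 𝒯) :
    Integrable (fun ω => entropyFlux f (upwind P ℱ m N η f v u₀ 𝒯 Δt n K ω)) P := by
  have ih := H.upwind_regular n hn K
  refine Integrable.mono' (ih.2.integrable_sq.const_mul (2 * c))
    ((continuous_entropyFlux H.lipschitz.continuous).comp_aestronglyMeasurable ih.2.1)
    (Eventually.of_forall fun ω => abs_entropyFlux_le H.lipschitz H.map_zero _)

theorem integrable_dissipation (H : UpwindSetting P ℱ m N T f c v V η lam h₁ u₀ 𝒯 α ξ Δt M)
    {n : ℕ} (hn : n ≤ M) (K L : 𝒯) :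
    Integrable (fun ω => dissipation f (upwind P ℱ m N η f v u₀ 𝒯 Δt n K ω)
      (upwind P ℱ m N η f v u₀ 𝒯 Δt n L ω)) P := by
  have ih := H.upwind_regular n hn
  have hf2 := fun L => H.lipschitz.comp_memLp H.map_zero (ih L).2
  exact ((ih K).2.integrable_mul ((hf2 K).sub (hf2 L))).sub
    ((H.integrable_entropyFlux hn K).sub (H.integrable_entropyFlux hn L))

theorem meanDissipation_eq (H : UpwindSetting P ℱ m N T f c v V η lam h₁ u₀ 𝒯 α ξ Δt M) {n : ℕ}
    (hn : n ≤ M) (K : 𝒯) :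
    Integrable (fun ω => ∑ L ∈ H.neighbour K, inflow v Δt n K L *
      dissipation f (upwind P ℱ m N η f v u₀ 𝒯 Δt n K ω) (upwind P ℱ m N η f v u₀ 𝒯 Δt n L ω)) P ∧
    ∫ ω, ∑ L ∈ H.neighbour K, inflow v Δt n K L *
      dissipation f (upwind P ℱ m N η f v u₀ 𝒯 Δt n K ω)
        (upwind P ℱ m N η f v u₀ 𝒯 Δt n L ω) ∂P = H.meanDissipation n K := by
  have h1 := fun L => (H.integrable_dissipation hn K L).const_mul (inflow v Δt n K L)
  refine ⟨integrable_finsetSum _ fun L _ => h1 L, ?_⟩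
  rw [integral_finsetSum _ fun L _ => h1 L, meanDissipation]
  exact Finset.sum_congr rfl fun L _ => integral_const_mul _ _

theorem integral_sq_flux_le (H : UpwindSetting P ℱ m N T f c v V η lam h₁ u₀ 𝒯 α ξ Δt M) {n : ℕ}
    (hn : n < M) (K : 𝒯) :
    Δt * ∫ ω, H.flux n K ω ^ 2 ∂P
      ≤ 2 * (1 - ξ) * volume.real (K : Set (Sp d)) * H.meanDissipation n K := by
  obtain ⟨h1, h2⟩ := H.meanDissipation_eq hn.le K
  rw [← h2, ← integral_const_mul, ← integral_const_mul]
  refine integral_mono ((H.flux_regular hn.le K).2.integrable_sq.const_mul _) (h1.const_mul _)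
    fun ω => ?_
  exact sq_upwind_flux_le H.differentiable H.lipschitz H.monotone
    (fun L _ => H.inflow_nonneg n K L) H.step_pos.le (H.cfl_cell hn K)

/-- The energy balance of one step of the scheme in one cell. -/
theorem energy_step (H : UpwindSetting P ℱ m N T f c v V η lam h₁ u₀ 𝒯 α ξ Δt M) {n : ℕ}
    (hn : n < M) (K : 𝒯) :
    volume.real (K : Set (Sp d)) * ∫ ω, upwind P ℱ m N η f v u₀ 𝒯 Δt (n + 1) K ω ^ 2 ∂P
        + 2 * ξ * Δt * H.meanDissipation n K
      ≤ (1 + lam ^ 2 * (∫ z, h₁ z ^ 2 ∂m) * Δt) * (volume.real (K : Set (Sp d)) *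
          ∫ ω, upwind P ℱ m N η f v u₀ 𝒯 Δt n K ω ^ 2 ∂P)
        - 2 * Δt * ∑ L ∈ H.neighbour K, inflow v Δt n K L *
          (∫ ω, entropyFlux f (upwind P ℱ m N η f v u₀ 𝒯 Δt n K ω) ∂P
            - ∫ ω, entropyFlux f (upwind P ℱ m N η f v u₀ 𝒯 Δt n L ω) ∂P) := by
  have hvol := H.volume_pos K
  have hle : (n : ℝ) * Δt ≤ (n + 1) * Δt := by nlinarith [H.step_pos]
  obtain ⟨hu1, hu2⟩ := H.upwind_regular n hn.le K
  obtain ⟨hg1, hg2⟩ := H.flux_regular hn.le K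
  obtain ⟨hd1, hd2⟩ := H.meanDissipation_eq hn.le K
  obtain ⟨hnb, hno⟩ := H.noise_bounds hu1 hu2
  obtain ⟨hw2, hwle⟩ := hnb _ (right_mem_Icc.2 hle)
  -- The deterministic part of the step is known at time `nΔt`, hence orthogonal to the noise `W`:
  -- the second moments simply add.
  set Z : Ω → ℝ := fun ω => upwind P ℱ m N η f v u₀ 𝒯 Δt n K ω
    - Δt / volume.real (K : Set (Sp d)) * H.flux n K ω with hZ
  set W := noiseIncrement P ℱ m N η Δt n (upwind P ℱ m N η f v u₀ 𝒯 Δt n K) ((n + 1) * Δt)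
  have hZ1 : StronglyMeasurable[ℱ (n * Δt).toNNReal] Z := hu1.sub (hg1.const_mul _)
  have hZ2 : MemLp Z 2 P := hu2.sub (hg2.const_mul _)
  have hZW : Integrable (fun ω => Z ω * W ω) P := hZ2.integrable_mul hw2
  have hsq : ∫ ω, upwind P ℱ m N η f v u₀ 𝒯 Δt (n + 1) K ω ^ 2 ∂P
      = ∫ ω, Z ω ^ 2 ∂P + ∫ ω, W ω ^ 2 ∂P := by
    have h1 : ∀ ω, upwind P ℱ m N η f v u₀ 𝒯 Δt (n + 1) K ω ^ 2
        = Z ω ^ 2 + 2 * (Z ω * W ω) + W ω ^ 2 := fun ω => by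
      rw [H.upwind_succ hn K ω]; simp only [hZ, W]; ring
    have h2 : Integrable (fun ω => Z ω ^ 2 + 2 * (Z ω * W ω)) P :=
      hZ2.integrable_sq.add (hZW.const_mul 2)
    simp only [h1]
    rw [integral_add h2 hw2.integrable_sq, integral_add hZ2.integrable_sq (hZW.const_mul 2),
      integral_const_mul, hno Z hZ1 hZ2, mul_zero, add_zero]
  have hef : ∀ L : 𝒯, Integrable (fun ω => inflow v Δt n K L *
      (entropyFlux f (upwind P ℱ m N η f v u₀ 𝒯 Δt n K ω)
        - entropyFlux f (upwind P ℱ m N η f v u₀ 𝒯 Δt n L ω))) P := fun L =>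
    ((H.integrable_entropyFlux hn.le K).sub (H.integrable_entropyFlux hn.le L)).const_mul _
  have hefs : Integrable (fun ω => ∑ L ∈ H.neighbour K, inflow v Δt n K L *
      (entropyFlux f (upwind P ℱ m N η f v u₀ 𝒯 Δt n K ω)
        - entropyFlux f (upwind P ℱ m N η f v u₀ 𝒯 Δt n L ω))) P :=
    integrable_finsetSum _ fun L _ => hef L
  have hefi : ∫ ω, ∑ L ∈ H.neighbour K, inflow v Δt n K L *
      (entropyFlux f (upwind P ℱ m N η f v u₀ 𝒯 Δt n K ω)
        - entropyFlux f (upwind P ℱ m N η f v u₀ 𝒯 Δt n L ω)) ∂P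
      = ∑ L ∈ H.neighbour K, inflow v Δt n K L *
          (∫ ω, entropyFlux f (upwind P ℱ m N η f v u₀ 𝒯 Δt n K ω) ∂P
            - ∫ ω, entropyFlux f (upwind P ℱ m N η f v u₀ 𝒯 Δt n L ω) ∂P) := by
    rw [integral_finsetSum _ fun L _ => hef L]
    refine Finset.sum_congr rfl fun L _ => ?_
    rw [integral_const_mul, integral_sub (H.integrable_entropyFlux hn.le K)
      (H.integrable_entropyFlux hn.le L)]
  have hmain := integral_mono
    ((hZ2.integrable_sq.const_mul (volume.real (K : Set (Sp d)))).add (hd1.const_mul (2 * ξ * Δt)))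
    ((hu2.integrable_sq.const_mul (volume.real (K : Set (Sp d)))).sub (hefs.const_mul (2 * Δt)))
    fun ω => sq_upwind_step_le H.differentiable H.lipschitz H.monotone
      (fun L _ => H.inflow_nonneg n K L) H.step_pos.le hvol (H.cfl_cell hn K)
  rw [integral_add' (hZ2.integrable_sq.const_mul _) (hd1.const_mul _),
    integral_sub' (hu2.integrable_sq.const_mul _) (hefs.const_mul _), integral_const_mul,
    integral_const_mul, integral_const_mul, integral_const_mul, hd2, hefi] at hmain
  have hwle' := mul_le_mul_of_nonneg_left hwle hvol.le
  rw [hsq]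
  linarith

/-- The energy estimate and the weak bounded variation estimate for the upwind scheme. -/
theorem energy (H : UpwindSetting P ℱ m N T f c v V η lam h₁ u₀ 𝒯 α ξ Δt M) {κ : ℝ}
    (hκ : κ = lam ^ 2 * ∫ z, h₁ z ^ 2 ∂m) :
    (∀ n ≤ M, Summable (fun K : 𝒯 => volume.real (K : Set (Sp d)) *
        ∫ ω, upwind P ℱ m N η f v u₀ 𝒯 Δt n K ω ^ 2 ∂P) ∧
      ∑' K : 𝒯, volume.real (K : Set (Sp d)) *
        ∫ ω, upwind P ℱ m N η f v u₀ 𝒯 Δt n K ω ^ 2 ∂P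
        ≤ Real.exp (κ * T) * ∫ ω, ‖u₀ ω‖ ^ 2 ∂P) ∧
    (∀ n < M, Summable (H.meanDissipation n)) ∧
    2 * ξ * Δt * ∑ n ∈ Finset.range M, ∑' K, H.meanDissipation n K
      ≤ (1 + κ * T * Real.exp (κ * T)) * ∫ ω, ‖u₀ ω‖ ^ 2 ∂P := by
  obtain ⟨B, hB⟩ := H.exists_sum_inflow_le
  have hκ0 : 0 ≤ κ := hκ ▸ mul_nonneg (sq_nonneg _) (integral_nonneg fun _ => sq_nonneg _)
  obtain ⟨h0, h0e⟩ := H.energy_zero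
  have hφ : ∀ n < M, ∀ K : 𝒯, |∫ ω, entropyFlux f (upwind P ℱ m N η f v u₀ 𝒯 Δt n K ω) ∂P|
      ≤ 2 * c * ∫ ω, upwind P ℱ m N η f v u₀ 𝒯 Δt n K ω ^ 2 ∂P := fun n hn K => by
    rw [← integral_const_mul]
    refine (abs_integral_le_integral_abs).trans (integral_mono
      (H.integrable_entropyFlux hn.le K).abs
      ((H.upwind_regular n hn.le K).2.integrable_sq.const_mul _) fun ω => ?_)
    exact abs_entropyFlux_le H.lipschitz H.map_zero _
  have hest := energy_estimate (nb := H.neighbour) (vol := fun K : 𝒯 => volume.real (K : Set (Sp d)))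
    (A := fun n K => ∫ ω, upwind P ℱ m N η f v u₀ 𝒯 Δt n K ω ^ 2 ∂P)
    (q := H.meanDissipation) (c := fun n K L => inflow v Δt n K L)
    (φ := fun n K => ∫ ω, entropyFlux f (upwind P ℱ m N η f v u₀ 𝒯 Δt n K ω) ∂P)
    (C := 2 * c) H.mem_neighbour_comm (fun K => (H.volume_pos K).le)
    (fun n K => integral_nonneg fun ω => sq_nonneg _) H.meanDissipation_nonneg
    (fun n K L => H.inflow_nonneg n K L) hκ0 H.step_pos H.xi_pos
    (fun n hn K => H.balance hn K) hB hφ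
    (fun n hn K => hκ ▸ H.energy_step hn K) h0 h0e
  rw [H.step_mul] at hest
  exact hest

end UpwindSetting

/-! ### The difference of the two approximations on space-time cells -/

/-- Integration over a product of a function that does not depend on the last variable. -/
theorem lintegral_sq_prod_le {Ω X : Type*} {mΩ : MeasurableSpace Ω} {mX : MeasurableSpace X}
    {P : Measure Ω} [SFinite P] {ρ : Measure ℝ} [SFinite ρ] {ν : Measure X} [SFinite ν]
    {g : Ω → ℝ → ℝ} {b : ℝ≥0∞}
    (hg : AEStronglyMeasurable (fun p : Ω × ℝ => g p.1 p.2) (P.prod ρ))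
    (hb : ∀ᵐ t ∂ρ, ∫⁻ ω, ENNReal.ofReal (g ω t ^ 2) ∂P ≤ b) :
    AEStronglyMeasurable (fun p : Ω × ℝ × X => g p.1 p.2.1) (P.prod (ρ.prod ν)) ∧
      ∫⁻ p : Ω × ℝ × X, ENNReal.ofReal (g p.1 p.2.1 ^ 2) ∂(P.prod (ρ.prod ν))
        ≤ b * (ρ univ * ν univ) := by
  have h1 : AEStronglyMeasurable (fun p : Ω × ℝ × X => g p.1 p.2.1) (P.prod (ρ.prod ν)) :=
    (hg.comp_fst (ν := ν)).comp_measurePreserving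
      (measurePreserving_prodAssoc P ρ ν).symm
  refine ⟨h1, ?_⟩
  rw [lintegral_prod_symm _ (h1.aemeasurable.pow_const 2).ennreal_ofReal]
  calc ∫⁻ y : ℝ × X, ∫⁻ ω, ENNReal.ofReal (g ω y.1 ^ 2) ∂P ∂(ρ.prod ν)
      ≤ ∫⁻ _, b ∂(ρ.prod ν) :=
        lintegral_mono_ae (Measure.quasiMeasurePreserving_fst.ae hb)
    _ = b * (ρ univ * ν univ) := by
        rw [lintegral_const, ← univ_prod_univ, Measure.prod_prod]

theorem finsum_indicator_eq {X : Type*} {𝒯 : Set (Set X)} (h : 𝒯.PairwiseDisjoint id) {K : Set X}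
    (hK : K ∈ 𝒯) {x : X} (hx : x ∈ K) (g : Set X → ℝ) :
    ∑ᶠ L ∈ 𝒯, L.indicator (fun _ => g L) x = g K := by
  rw [finsum_eq_single _ K fun L hne => ?_]
  · rw [finsum_eq_single _ hK fun h' hne => absurd rfl hne, indicator_of_mem hx]
  · by_cases hL : L ∈ 𝒯
    · rw [finsum_eq_single _ hL fun h' hne => absurd rfl hne]
      exact indicator_of_notMem (fun hxL => (h hL hK hne).le_bot ⟨hxL, hx⟩) _
    · simp [hL]

theorem floor_div_eq {Δt t : ℝ} (hΔt : 0 < Δt) {n : ℕ}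
    (ht : t ∈ Ico (n * Δt) ((n + 1) * Δt)) : ⌊t / Δt⌋₊ = n := by
  have h0 : 0 ≤ t := le_trans (by positivity) ht.1
  rw [Nat.floor_eq_iff (by positivity), le_div_iff₀ hΔt, div_lt_iff₀ hΔt]
  exact ht

namespace UpwindSetting
variable {Ω E : Type*} {mΩ : MeasurableSpace Ω} [MeasurableSpace E]
  {P : Measure Ω} {ℱ : Filtration ℝ≥0 mΩ} {m : Measure E} {N : Ω → Measure (ℝ × E)} {d : ℕ}
  {T : ℝ} {f : ℝ → ℝ} {c : ℝ≥0} {v : ℝ → Sp d → Sp d} {V : ℝ} {η : ℝ → E → ℝ} {lam : ℝ}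
  {h₁ : E → ℝ} {u₀ : Ω → Lp ℝ 2 (volume : Measure (Sp d))} {𝒯 : Set (Set (Sp d))} {α ξ Δt : ℝ}
  {M : ℕ}

/-- The increment `v_K^n(s) - u_K^n`. -/
def increment (H : UpwindSetting P ℱ m N T f c v V η lam h₁ u₀ 𝒯 α ξ Δt M) (n : ℕ) (K : 𝒯) (ω : Ω)
    (s : ℝ) : ℝ :=
  noiseIncrement P ℱ m N η Δt n (upwind P ℱ m N η f v u₀ 𝒯 Δt n K) s ω
    - (s - n * Δt) / volume.real (K : Set (Sp d)) * H.flux n K ω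

theorem timeContinuousUnknown_sub (H : UpwindSetting P ℱ m N T f c v V η lam h₁ u₀ 𝒯 α ξ Δt M)
    (n : ℕ) (K : 𝒯) (ω : Ω) (s : ℝ) :
    timeContinuousUnknown P ℱ m N η f v u₀ 𝒯 Δt n K s ω - upwind P ℱ m N η f v u₀ 𝒯 Δt n K ω
      = H.increment n K ω s := by
  have h1 : ∑ᶠ L ∈ neighbours 𝒯 K, surfaceArea (interface (K : Set (Sp d)) L)
        * normalVelocityNeg v Δt n K L *
        ((f (upwind P ℱ m N η f v u₀ 𝒯 Δt n L ω) - f (upwind P ℱ m N η f v u₀ 𝒯 Δt n K ω))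
          / volume.real (K : Set (Sp d)))
      = -(1 / volume.real (K : Set (Sp d)) * H.flux n K ω) := by
    rw [finsum_mem_eq_finite_toFinset_sum _
      (H.mesh.finite_neighbours H.one_le_dim H.alpha_pos K.2), ← H.sum_neighbour K (fun L =>
        surfaceArea (interface (K : Set (Sp d)) L) * normalVelocityNeg v Δt n K L *
        ((f (upwind P ℱ m N η f v u₀ 𝒯 Δt n L ω) - f (upwind P ℱ m N η f v u₀ 𝒯 Δt n K ω))
          / volume.real (K : Set (Sp d)))), flux, Finset.mul_sum, ← Finset.sum_neg_distrib]
    refine Finset.sum_congr rfl fun L _ => ?_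
    rw [inflow]
    ring
  rw [timeContinuousUnknown, h1, intervalIntegral.integral_const, increment, smul_eq_mul]
  ring

/-- On a space-time cell the approximate solutions differ by the increment. -/
theorem approx_sub (H : UpwindSetting P ℱ m N T f c v V η lam h₁ u₀ 𝒯 α ξ Δt M)
    (n : ℕ) (K : 𝒯) {p : Ω × ℝ × Sp d} (ht : p.2.1 ∈ Ico (n * Δt) ((n + 1) * Δt))
    (hx : p.2.2 ∈ (K : Set (Sp d))) :
    timeContinuousApprox P ℱ m N η f v u₀ 𝒯 Δt p - upwindApprox P ℱ m N η f v u₀ 𝒯 Δt p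
      = H.increment n K p.1 p.2.1 := by
  rw [timeContinuousApprox, upwindApprox, floor_div_eq H.step_pos ht,
    finsum_indicator_eq H.mesh.disjoint K.2 hx
      (fun K => timeContinuousUnknown P ℱ m N η f v u₀ 𝒯 Δt n K p.2.1 p.1),
    finsum_indicator_eq H.mesh.disjoint K.2 hx
      (fun K => upwind P ℱ m N η f v u₀ 𝒯 Δt n K p.1), H.timeContinuousUnknown_sub]

/-- The bound for the second moment of the increment, up to the factor `Δt`. -/
def cellBound (H : UpwindSetting P ℱ m N T f c v V η lam h₁ u₀ 𝒯 α ξ Δt M) (n : ℕ) (K : 𝒯) : ℝ :=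
  4 * H.meanDissipation n K + 2 * (lam ^ 2 * ∫ z, h₁ z ^ 2 ∂m) *
    (volume.real (K : Set (Sp d)) * ∫ ω, upwind P ℱ m N η f v u₀ 𝒯 Δt n K ω ^ 2 ∂P)

theorem cellBound_nonneg (H : UpwindSetting P ℱ m N T f c v V η lam h₁ u₀ 𝒯 α ξ Δt M)
    (n : ℕ) (K : 𝒯) : 0 ≤ H.cellBound n K := by
  have hq := H.meanDissipation_nonneg n K
  have hA : 0 ≤ ∫ ω, upwind P ℱ m N η f v u₀ 𝒯 Δt n K ω ^ 2 ∂P := integral_nonneg fun _ => sq_nonneg _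
  have hκ : 0 ≤ ∫ z, h₁ z ^ 2 ∂m := integral_nonneg fun _ => sq_nonneg _
  have hvol := (H.volume_pos K).le
  rw [cellBound]
  positivity

/-- The space-time cell `Ω × [nΔt, (n+1)Δt) × K`, up to a null set. -/
def spaceTimeCell (Ω : Type*) {d : ℕ} (Δt : ℝ) (n : ℕ) (K : Set (Sp d)) : Set (Ω × ℝ × Sp d) :=
  univ ×ˢ (Ico (n * Δt) ((n + 1) * Δt) ×ˢ interior K)

theorem measurableSet_spaceTimeCell (n : ℕ) (K : Set (Sp d)) :
    MeasurableSet (spaceTimeCell Ω Δt n K) :=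
  MeasurableSet.univ.prod (measurableSet_Ico.prod isOpen_interior.measurableSet)

/-- Almost every point lies in the interior of a mesh cell, and the index `⌊t/Δt⌋` stays below `M`
because `t < T = M Δt`. -/
theorem ae_mem_spaceTimeCell (H : UpwindSetting P ℱ m N T f c v V η lam h₁ u₀ 𝒯 α ξ Δt M) :
    ∀ᵐ p ∂(P.prod ((volume.restrict (Ico 0 T)).prod volume)),
      p ∈ ⋃ q : Fin M × 𝒯, spaceTimeCell Ω Δt q.1 (q.2 : Set (Sp d)) := by
  have h1 : ∀ᵐ x : Sp d, x ∈ ⋃ K ∈ 𝒯, interior K :=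
    mem_ae_iff.2 (H.mesh.volume_compl_iUnion_interior H.one_le_dim H.alpha_pos)
  have h2 : ∀ᵐ q ∂((volume.restrict (Ico 0 T)).prod (volume : Measure (Sp d))), q.1 ∈ Ico 0 T :=
    Measure.quasiMeasurePreserving_fst.ae (ae_restrict_mem measurableSet_Ico)
  have h3 : ∀ᵐ q ∂((volume.restrict (Ico 0 T)).prod (volume : Measure (Sp d))),
      q.2 ∈ ⋃ K ∈ 𝒯, interior K := Measure.quasiMeasurePreserving_snd.ae h1
  filter_upwards [(Measure.quasiMeasurePreserving_snd (μ := P)).ae (h2.and h3)] with p hp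
  obtain ⟨ht, hx⟩ := hp
  obtain ⟨K, hK, hxK⟩ := mem_iUnion₂.1 hx
  have hΔt := H.step_pos
  have h4 : 0 ≤ p.2.1 / Δt := div_nonneg ht.1 hΔt.le
  have h5 : ⌊p.2.1 / Δt⌋₊ < M := by
    rw [Nat.floor_lt h4, div_lt_iff₀ hΔt, H.step_mul]
    exact ht.2
  refine mem_iUnion.2 ⟨(⟨_, h5⟩, ⟨K, hK⟩), mem_univ _, ⟨?_, ?_⟩, hxK⟩
  · exact (le_div_iff₀ hΔt).1 (Nat.floor_le h4)
  · exact (div_lt_iff₀ hΔt).1 (Nat.lt_floor_add_one _)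

variable [IsProbabilityMeasure P]

theorem restrict_spaceTimeCell (H : UpwindSetting P ℱ m N T f c v V η lam h₁ u₀ 𝒯 α ξ Δt M)
    {n : ℕ} (hn : n < M) (K : 𝒯) :
    (P.prod ((volume.restrict (Ico 0 T)).prod volume)).restrict (spaceTimeCell Ω Δt n K)
      = P.prod ((volume.restrict (Ico (n * Δt) ((n + 1) * Δt))).prod
        (volume.restrict (interior (K : Set (Sp d))))) := by
  have hsub : Ico ((n : ℝ) * Δt) ((n + 1) * Δt) ⊆ Ico 0 T := fun t ht =>
    ⟨le_trans (by have := H.step_pos; positivity) ht.1, ht.2.trans_le (H.step_le hn)⟩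
  rw [spaceTimeCell, ← Measure.prod_restrict, Measure.restrict_univ, ← Measure.prod_restrict,
    Measure.restrict_restrict measurableSet_Ico, inter_eq_left.2 hsub]

variable [SigmaFinite m]

theorem aestronglyMeasurable_increment
    (H : UpwindSetting P ℱ m N T f c v V η lam h₁ u₀ 𝒯 α ξ Δt M) {n : ℕ} (hn : n < M) (K : 𝒯) :
    AEStronglyMeasurable (fun p : Ω × ℝ => H.increment n K p.1 p.2) (P.prod volume) := by
  refine AEStronglyMeasurable.sub aestronglyMeasurable_noiseIncrement ?_
  refine AEStronglyMeasurable.mul (Measurable.aestronglyMeasurable (by fun_prop)) ?_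
  exact (H.flux_regular hn.le K).2.1.comp_fst

theorem lintegral_sq_increment_le (H : UpwindSetting P ℱ m N T f c v V η lam h₁ u₀ 𝒯 α ξ Δt M)
    {n : ℕ} (hn : n < M) (K : 𝒯) {s : ℝ} (hs : s ∈ Icc (n * Δt) ((n + 1) * Δt)) :
    ∫⁻ ω, ENNReal.ofReal (H.increment n K ω s ^ 2) ∂P
      ≤ ENNReal.ofReal (Δt * H.cellBound n K / volume.real (K : Set (Sp d))) := by
  have hvol := H.volume_pos K
  have hΔt := H.step_pos
  have hξ := H.xi_pos
  obtain ⟨hu1, hu2⟩ := H.upwind_regular n hn.le K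
  obtain ⟨hg1, hg2⟩ := H.flux_regular hn.le K
  obtain ⟨hw2, hwle⟩ := (H.noise_bounds hu1 hu2).1 s hs
  have hflux := H.integral_sq_flux_le hn K
  have hq := H.meanDissipation_nonneg n K
  set θ := s - n * Δt with hθ
  have hθ0 : 0 ≤ θ := sub_nonneg.2 hs.1
  have hθ1 : θ ≤ Δt := by have := hs.2; rw [hθ]; linarith
  have hA : 0 ≤ ∫ ω, upwind P ℱ m N η f v u₀ 𝒯 Δt n K ω ^ 2 ∂P := integral_nonneg fun _ => sq_nonneg _
  have hκ : 0 ≤ lam ^ 2 * ∫ z, h₁ z ^ 2 ∂m :=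
    mul_nonneg (sq_nonneg _) (integral_nonneg fun _ => sq_nonneg _)
  have hD : MemLp (fun ω => H.increment n K ω s) 2 P := hw2.sub (hg2.const_mul _)
  rw [← ofReal_integral_eq_lintegral_ofReal hD.integrable_sq
    (Eventually.of_forall fun ω => sq_nonneg _)]
  refine ENNReal.ofReal_le_ofReal ?_
  -- From `(a - b)² ≤ 2a² + 2b²`; this factor `2` and the `2` of the flux bound make the `4` in
  -- `cellBound`.
  have h1 : ∫ ω, H.increment n K ω s ^ 2 ∂P
      ≤ 2 * ∫ ω, noiseIncrement P ℱ m N η Δt n (upwind P ℱ m N η f v u₀ 𝒯 Δt n K) s ω ^ 2 ∂P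
        + 2 * (θ / volume.real (K : Set (Sp d))) ^ 2 * ∫ ω, H.flux n K ω ^ 2 ∂P := by
    rw [← integral_const_mul, ← integral_const_mul,
      ← integral_add (hw2.integrable_sq.const_mul _) (hg2.integrable_sq.const_mul _)]
    refine integral_mono hD.integrable_sq
      ((hw2.integrable_sq.const_mul _).add (hg2.integrable_sq.const_mul _)) fun ω => ?_
    simp only [increment]
    linarith [sq_nonneg (noiseIncrement P ℱ m N η Δt n (upwind P ℱ m N η f v u₀ 𝒯 Δt n K) s ω
      + θ / volume.real (K : Set (Sp d)) * H.flux n K ω)]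
  have h2 : (θ / volume.real (K : Set (Sp d))) ^ 2 * ∫ ω, H.flux n K ω ^ 2 ∂P
      ≤ 2 * Δt * H.meanDissipation n K / volume.real (K : Set (Sp d)) := by
    -- One of the two factors `Δt` is needed to apply the bound on `Δt E G²`; the other survives.
    have h3 : θ ^ 2 ≤ Δt * Δt := by nlinarith
    have h4 : 0 ≤ ∫ ω, H.flux n K ω ^ 2 ∂P := integral_nonneg fun _ => sq_nonneg _
    calc (θ / volume.real (K : Set (Sp d))) ^ 2 * ∫ ω, H.flux n K ω ^ 2 ∂P
        = θ ^ 2 * (∫ ω, H.flux n K ω ^ 2 ∂P) / volume.real (K : Set (Sp d)) ^ 2 := by ring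
      _ ≤ Δt * Δt * (∫ ω, H.flux n K ω ^ 2 ∂P) / volume.real (K : Set (Sp d)) ^ 2 := by gcongr
      _ = Δt * (Δt * ∫ ω, H.flux n K ω ^ 2 ∂P) / volume.real (K : Set (Sp d)) ^ 2 := by ring
      _ ≤ Δt * (2 * (1 - ξ) * volume.real (K : Set (Sp d)) * H.meanDissipation n K)
          / volume.real (K : Set (Sp d)) ^ 2 := by gcongr
      _ = (1 - ξ) * (2 * Δt * H.meanDissipation n K / volume.real (K : Set (Sp d))) := by
          field_simp
      _ ≤ 1 * (2 * Δt * H.meanDissipation n K / volume.real (K : Set (Sp d))) := by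
          gcongr
          linarith
      _ = _ := one_mul _
  have h5 : ∫ ω, noiseIncrement P ℱ m N η Δt n (upwind P ℱ m N η f v u₀ 𝒯 Δt n K) s ω ^ 2 ∂P
      ≤ Δt * (lam ^ 2 * ∫ z, h₁ z ^ 2 ∂m) * ∫ ω, upwind P ℱ m N η f v u₀ 𝒯 Δt n K ω ^ 2 ∂P :=
    hwle.trans (by gcongr)
  have h6 : Δt * H.cellBound n K / volume.real (K : Set (Sp d))
      = 2 * (Δt * (lam ^ 2 * ∫ z, h₁ z ^ 2 ∂m)
          * ∫ ω, upwind P ℱ m N η f v u₀ 𝒯 Δt n K ω ^ 2 ∂P)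
        + 2 * (2 * Δt * H.meanDissipation n K / volume.real (K : Set (Sp d))) := by
    rw [cellBound]
    field_simp
    ring
  rw [h6]
  linarith

/-- The weak BV estimate contributes `4/(2ξ) = 2/ξ`. The uniform energy bound is summed over `M`
steps, with `M Δt = T`. -/
theorem cellBound_sum (H : UpwindSetting P ℱ m N T f c v V η lam h₁ u₀ 𝒯 α ξ Δt M) {κ : ℝ}
    (hκ : κ = lam ^ 2 * ∫ z, h₁ z ^ 2 ∂m) :
    (∀ n < M, Summable (H.cellBound n)) ∧
    Δt * ∑ n ∈ Finset.range M, ∑' K, H.cellBound n K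
      ≤ (2 / ξ * (1 + κ * T * Real.exp (κ * T)) + 2 * κ * T * Real.exp (κ * T))
        * ∫ ω, ‖u₀ ω‖ ^ 2 ∂P := by
  obtain ⟨h1, h2, h3⟩ := H.energy hκ
  have hξ := H.xi_pos
  have hΔt := H.step_pos
  have hκ0 : 0 ≤ κ := hκ ▸ mul_nonneg (sq_nonneg _) (integral_nonneg fun _ => sq_nonneg _)
  have hsum : ∀ n < M, HasSum (H.cellBound n) (4 * ∑' K, H.meanDissipation n K
      + 2 * κ * ∑' K : 𝒯, volume.real (K : Set (Sp d)) *
        ∫ ω, upwind P ℱ m N η f v u₀ 𝒯 Δt n K ω ^ 2 ∂P) := fun n hn => by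
    rw [hκ]
    exact ((h2 n hn).hasSum.mul_left 4).add ((h1 n hn.le).1.hasSum.mul_left _)
  refine ⟨fun n hn => (hsum n hn).summable, ?_⟩
  have h4 : ∑ n ∈ Finset.range M, ∑' K, H.cellBound n K
      ≤ ∑ n ∈ Finset.range M, (4 * ∑' K, H.meanDissipation n K
        + 2 * κ * (Real.exp (κ * T) * ∫ ω, ‖u₀ ω‖ ^ 2 ∂P)) := by
    refine Finset.sum_le_sum fun n hn => ?_
    have hn := Finset.mem_range.1 hn
    rw [(hsum n hn).tsum_eq]
    have := (h1 n hn.le).2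
    gcongr
  rw [Finset.sum_add_distrib, ← Finset.mul_sum, Finset.sum_const, Finset.card_range,
    nsmul_eq_mul] at h4
  have h5 : Δt * (M * (2 * κ * (Real.exp (κ * T) * ∫ ω, ‖u₀ ω‖ ^ 2 ∂P)))
      = 2 * κ * T * Real.exp (κ * T) * ∫ ω, ‖u₀ ω‖ ^ 2 ∂P := by
    rw [← H.step_mul]; ring
  have h6 : Δt * (4 * ∑ n ∈ Finset.range M, ∑' K, H.meanDissipation n K)
      ≤ 2 / ξ * ((1 + κ * T * Real.exp (κ * T)) * ∫ ω, ‖u₀ ω‖ ^ 2 ∂P) := by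
    calc _ = 2 / ξ * (2 * ξ * Δt * ∑ n ∈ Finset.range M, ∑' K, H.meanDissipation n K) := by
          field_simp; ring
      _ ≤ _ := by gcongr
  have h7 := mul_le_mul_of_nonneg_left h4 hΔt.le
  rw [mul_add, h5] at h7
  linarith

/-- The difference of the approximate solutions on one space-time cell. -/
theorem approx_sub_cell (H : UpwindSetting P ℱ m N T f c v V η lam h₁ u₀ 𝒯 α ξ Δt M)
    {n : ℕ} (hn : n < M) (K : 𝒯) :
    AEStronglyMeasurable (fun p => timeContinuousApprox P ℱ m N η f v u₀ 𝒯 Δt p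
        - upwindApprox P ℱ m N η f v u₀ 𝒯 Δt p)
      ((P.prod ((volume.restrict (Ico 0 T)).prod volume)).restrict (spaceTimeCell Ω Δt n K)) ∧
    ∫⁻ p in spaceTimeCell Ω Δt n K, ENNReal.ofReal
      ((timeContinuousApprox P ℱ m N η f v u₀ 𝒯 Δt p - upwindApprox P ℱ m N η f v u₀ 𝒯 Δt p) ^ 2)
        ∂(P.prod ((volume.restrict (Ico 0 T)).prod volume))
      ≤ ENNReal.ofReal (Δt * (Δt * H.cellBound n K)) := by
  have hvol := H.volume_pos K
  have hae : (fun p => timeContinuousApprox P ℱ m N η f v u₀ 𝒯 Δt p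
        - upwindApprox P ℱ m N η f v u₀ 𝒯 Δt p)
      =ᵐ[(P.prod ((volume.restrict (Ico 0 T)).prod volume)).restrict (spaceTimeCell Ω Δt n K)]
      fun p => H.increment n K p.1 p.2.1 := by
    filter_upwards [ae_restrict_mem (measurableSet_spaceTimeCell (Ω := Ω) (Δt := Δt) n (K : Set (Sp d)))] with p hp
    exact H.approx_sub n K hp.2.1 (interior_subset hp.2.2)
  have hcell := lintegral_sq_prod_le (P := P)
    (ρ := volume.restrict (Ico ((n : ℝ) * Δt) ((n + 1) * Δt)))
    (ν := volume.restrict (interior (K : Set (Sp d)))) (g := H.increment n K)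
    ((H.aestronglyMeasurable_increment hn K).mono_measure
      (Measure.prod_mono le_rfl Measure.restrict_le_self))
    (by
      filter_upwards [ae_restrict_mem measurableSet_Ico] with t ht
      exact H.lintegral_sq_increment_le hn K ⟨ht.1, ht.2.le⟩)
  rw [← H.restrict_spaceTimeCell hn K] at hcell
  refine ⟨hcell.1.congr hae.symm, ?_⟩
  -- The second moment supplies `Δt/|K|`; integration over the cell supplies `Δt |K|`.
  refine (lintegral_congr_ae (hae.fun_comp fun y => ENNReal.ofReal (y ^ 2))).le.trans
    (hcell.2.trans (le_of_eq ?_))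
  rw [Measure.restrict_apply_univ, Measure.restrict_apply_univ, Real.volume_Ico,
    measure_congr (H.mesh.polygonal K K.2).interior_ae_eq,
    ← ofReal_measureReal (H.mesh.polygonal K K.2).volume_lt_top.ne,
    ← ENNReal.ofReal_mul' hvol.le, ← ENNReal.ofReal_mul' (mul_nonneg (by nlinarith [H.step_pos])
      hvol.le)]
  congr 1
  field_simp
  ring

/-- The `L²` estimate of the difference of the two approximate solutions. -/
theorem approx_sub_estimate (H : UpwindSetting P ℱ m N T f c v V η lam h₁ u₀ 𝒯 α ξ Δt M) {κ : ℝ}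
    (hκ : κ = lam ^ 2 * ∫ z, h₁ z ^ 2 ∂m) :
    MemLp (fun p => timeContinuousApprox P ℱ m N η f v u₀ 𝒯 Δt p
        - upwindApprox P ℱ m N η f v u₀ 𝒯 Δt p) 2
      (P.prod ((volume.restrict (Ico 0 T)).prod volume)) ∧
    eLpNorm (fun p => timeContinuousApprox P ℱ m N η f v u₀ 𝒯 Δt p
        - upwindApprox P ℱ m N η f v u₀ 𝒯 Δt p) 2
      (P.prod ((volume.restrict (Ico 0 T)).prod volume)) ^ 2
      ≤ ENNReal.ofReal ((2 / ξ * (1 + κ * T * Real.exp (κ * T)) + 2 * κ * T * Real.exp (κ * T))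
        * (∫ ω, ‖u₀ ω‖ ^ 2 ∂P) * Δt) := by
  have hΔt := H.step_pos
  have hcount : Countable 𝒯 := (H.mesh.countable H.one_le_dim H.alpha_pos).to_subtype
  set μ := P.prod ((volume.restrict (Ico 0 T)).prod (volume : Measure (Sp d)))
  set F : Ω × ℝ × Sp d → ℝ := fun p => timeContinuousApprox P ℱ m N η f v u₀ 𝒯 Δt p
    - upwindApprox P ℱ m N η f v u₀ 𝒯 Δt p
  have hμ : μ.restrict (⋃ q : Fin M × 𝒯, spaceTimeCell Ω Δt q.1 (q.2 : Set (Sp d))) = μ :=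
    Measure.restrict_eq_self_of_ae_mem H.ae_mem_spaceTimeCell
  have hm : AEStronglyMeasurable F μ := by
    rw [← hμ, aestronglyMeasurable_iUnion_iff]
    exact fun q => (H.approx_sub_cell q.1.2 q.2).1
  have hle : eLpNorm F 2 μ ^ 2 ≤ ENNReal.ofReal
      ((2 / ξ * (1 + κ * T * Real.exp (κ * T)) + 2 * κ * T * Real.exp (κ * T))
        * (∫ ω, ‖u₀ ω‖ ^ 2 ∂P) * Δt) := by
    obtain ⟨hs, hsum⟩ := H.cellBound_sum hκ
    calc eLpNorm F 2 μ ^ 2 = ∫⁻ p, ENNReal.ofReal (F p ^ 2) ∂μ := eLpNorm_two_sq F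
      _ = ∫⁻ p in ⋃ q : Fin M × 𝒯, spaceTimeCell Ω Δt q.1 (q.2 : Set (Sp d)),
          ENNReal.ofReal (F p ^ 2) ∂μ := by rw [hμ]
      _ ≤ ∑' q : Fin M × 𝒯, ∫⁻ p in spaceTimeCell Ω Δt q.1 (q.2 : Set (Sp d)),
          ENNReal.ofReal (F p ^ 2) ∂μ := lintegral_iUnion_le _ _
      _ ≤ ∑' q : Fin M × 𝒯, ENNReal.ofReal (Δt * (Δt * H.cellBound q.1 q.2)) :=
          ENNReal.tsum_le_tsum fun q => (H.approx_sub_cell q.1.2 q.2).2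
      _ = ∑ n : Fin M, ∑' K : 𝒯, ENNReal.ofReal (Δt * (Δt * H.cellBound n K)) := by
          rw [ENNReal.tsum_prod (f := fun (n : Fin M) (K : 𝒯) =>
            ENNReal.ofReal (Δt * (Δt * H.cellBound n K))), tsum_fintype]
      _ = ∑ n : Fin M, ENNReal.ofReal (Δt * (Δt * ∑' K : 𝒯, H.cellBound n K)) := by
          refine Finset.sum_congr rfl fun n _ => ?_
          rw [← ENNReal.ofReal_tsum_of_nonneg (fun K => mul_nonneg hΔt.le
            (mul_nonneg hΔt.le (H.cellBound_nonneg n K))) (((hs n n.2).mul_left Δt).mul_left Δt),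
            tsum_mul_left, tsum_mul_left]
      _ = ENNReal.ofReal (Δt * (Δt * ∑ n ∈ Finset.range M, ∑' K : 𝒯, H.cellBound n K)) := by
          have hnn : ∀ n ∈ (Finset.univ : Finset (Fin M)),
              0 ≤ Δt * (Δt * ∑' K : 𝒯, H.cellBound n K) := fun n _ => mul_nonneg hΔt.le
            (mul_nonneg hΔt.le (tsum_nonneg fun K => H.cellBound_nonneg n K))
          rw [← ENNReal.ofReal_sum_of_nonneg hnn, ← Finset.mul_sum, ← Finset.mul_sum,
            Fin.sum_univ_eq_sum_range (fun n => ∑' K : 𝒯, H.cellBound n K)]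
      -- One factor `Δt` goes into the sum over the time steps, the other is the rate of
      -- convergence.
      _ ≤ _ := by
          refine ENNReal.ofReal_le_ofReal ?_
          rw [mul_comm]
          exact mul_le_mul_of_nonneg_right hsum hΔt.le
  refine ⟨⟨hm, ?_⟩, hle⟩
  by_contra h
  rw [not_lt, top_le_iff] at h
  rw [h] at hle
  simp at hle

end UpwindSetting
-- Choice of the constants
theorem mainTheorem8
    {Ω E : Type*} {mΩ : MeasurableSpace Ω} [MeasurableSpace E]
    -- the filtered probability space, under the usual hypotheses
    (P : Measure Ω) [IsProbabilityMeasure P]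
    (ℱ : Filtration ℝ≥0 mΩ) [ℱ.IsRightContinuous]
    (hnull : ∀ A : Set Ω, P A = 0 → MeasurableSet[ℱ 0] A)
    -- the Poisson random measure
    (m : Measure E) [SigmaFinite m]
    (N : Ω → Measure (ℝ × E)) (hN : IsPoissonRandomMeasure P ℱ m N)
    (d : ℕ) (hd : 1 ≤ d) (T : ℝ) (hT : 0 < T)
    -- the flux function, with Lipschitz constant `c_f`
    (f : ℝ → ℝ) (hf : ContDiff ℝ 2 f) (c_f : ℝ≥0) (hf_lip : LipschitzWith c_f f)
    (hf_zero : f 0 = 0) (hf_mono : Monotone f)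
    -- the velocity field
    (v : ℝ → Sp d → Sp d)
    (hv : ContDiffOn ℝ 1 (fun p : ℝ × Sp d => v p.1 p.2) (Icc 0 T ×ˢ univ))
    (hv_div : ∀ t ∈ Ico 0 T, ∀ x, divergence (v t) x = 0)
    (V : ℝ) (hV : ∀ t ∈ Ico 0 T, ∀ x, ‖v t x‖ ≤ V)
    -- the noise coefficient
    (η : ℝ → E → ℝ) (hη_meas : ∀ u, Measurable (η u))
    (lam : ℝ) (hlam : 0 < lam ∧ lam < 1) (Cstar : ℝ) (hCstar : 0 < Cstar)
    (h₁ : E → ℝ) (hh₁ : MemLp h₁ 2 m) (hh₁_range : ∀ z, 0 ≤ h₁ z ∧ h₁ z ≤ 1)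
    (hη_lip : ∀ u w z, |η u z - η w z| ≤ lam * |u - w| * h₁ z)
    (hη_bdd : ∀ u z, |η u z| ≤ Cstar * h₁ z)
    (hη_zero : ∀ z, η 0 z = 0)
    -- the initial datum
    (u₀ : Ω → Lp ℝ 2 (volume : Measure (Sp d)))
    (hu₀ : StronglyMeasurable[ℱ 0] u₀) (hu₀_sq : MemLp u₀ 2 P)
    -- the mesh regularity and CFL parameters
    (α : ℝ) (hα : 0 < α) (ξ : ℝ) (hξ : 0 < ξ ∧ ξ < 1) :
    ∃ C C₁ : ℝ, 0 < C ∧ 0 < C₁ ∧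
      ∀ 𝒯 : Set (Set (Sp d)), IsAdmissibleMesh 𝒯 α →
      ∀ (n : ℕ) (Δt : ℝ), 0 < n → Δt = T / n →
        Δt * (c_f * V) ≤ (1 - ξ) * α ^ 2 * meshSize 𝒯 →
        MemLp (fun p => timeContinuousApprox P ℱ m N η f v u₀ 𝒯 Δt p
              - upwindApprox P ℱ m N η f v u₀ 𝒯 Δt p) 2
            (P.prod ((volume.restrict (Ico 0 T)).prod volume)) ∧
          eLpNorm (fun p => timeContinuousApprox P ℱ m N η f v u₀ 𝒯 Δt p
              - upwindApprox P ℱ m N η f v u₀ 𝒯 Δt p) 2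
            (P.prod ((volume.restrict (Ico 0 T)).prod volume)) ^ 2
            ≤ ENNReal.ofReal (C * meshSize 𝒯 + C₁ * Δt) := by
  set κ : ℝ := lam ^ 2 * ∫ z, h₁ z ^ 2 ∂m with hκ
  set B : ℝ := (2 / ξ * (1 + κ * T * Real.exp (κ * T)) + 2 * κ * T * Real.exp (κ * T))
    * ∫ ω, ‖u₀ ω‖ ^ 2 ∂P with hB
  have hκ0 : 0 ≤ κ := mul_nonneg (sq_nonneg _) (integral_nonneg fun _ => sq_nonneg _)
  have hu0 : 0 ≤ ∫ ω, ‖u₀ ω‖ ^ 2 ∂P := integral_nonneg fun _ => sq_nonneg _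
  have hξ0 := hξ.1
  have hB0 : 0 ≤ B := by positivity
  -- The bound `B Δt` suffices. The coefficient `1` of `h` is arbitrary, and `B + 1` ensures strict
  -- positivity, since `B` vanishes when `u₀ = 0`.
  refine ⟨1, B + 1, one_pos, by positivity, fun 𝒯 h𝒯 n Δt hn hΔt hcfl => ?_⟩
  have hn' : (0 : ℝ) < n := by exact_mod_cast hn
  have hpos : 0 < Δt := hΔt ▸ div_pos hT hn'
  have H : UpwindSetting P ℱ m N T f c_f v V η lam h₁ u₀ 𝒯 α ξ Δt n :=
    { poisson := hN
      one_le_dim := hd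
      differentiable := hf.differentiable two_ne_zero
      lipschitz := hf_lip
      map_zero := hf_zero
      monotone := hf_mono
      contDiffOn_velocity := hv
      divergence_velocity := hv_div
      norm_velocity_le := hV
      measurable_noise := hη_meas
      memLp_bound := hh₁
      bound_mem := hh₁_range
      noise_lipschitz := hη_lip
      noise_zero := hη_zero
      stronglyMeasurable_datum := hu₀
      memLp_datum := hu₀_sq
      mesh := h𝒯
      alpha_pos := hα
      xi_pos := hξ.1
      xi_lt_one := hξ.2
      step_pos := hpos
      step_mul := by rw [hΔt]; field_simp
      cfl := hcfl }
  obtain ⟨h1, h2⟩ := H.approx_sub_estimate hκ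
  refine ⟨h1, h2.trans (ENNReal.ofReal_le_ofReal ?_)⟩
  have hh := h𝒯.meshSize_pos hd
  rw [← hB]
  linarith

end
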